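/- **Setting.** An anytime-constrained Markov game (acMG) $G$ has $n$ players, a finite state set with a fixed initial state $s_1$, finite nonempty individual action sets, a horizon $H\ge 1$, transition distributions $P_h(s,a)$, integrable reward distributions with means $r_h(s,a)\in\mathbb R^n$, cost distributions $C_h(s,a)$ on $\mathbb R^n$ and a budget vector $B\in\mathbb R^n$. Joint policies $\pi$ map histories $\tau_h=(s_1,a_1,c_1,s_2,\dots,s_h)$ (including costs) measurably to distributions over joint actions. The policy $\pi$ is *feasible* if almost surely $\sum_{t\le h}c_t\le B$ (componentwise) for all $h\in[H]$; $\Pi_G$ is the set of feasible policies, and $\Pi_G(\tau_h)$ is the set of policies for which this holds conditionally on $\tau_h$. *$\varepsilon$-relative feasibility* replaces $B$ by $B(1+\varepsilon\sigma_B)$, with $\sigma_B$ the sign of $B$. Let $\mathcal F_h$ be the set of histories realized with positive probability by some $\pi\in\Pi_G$. An *$\varepsilon$-relative approximate ACSPE* is a joint policy $\pi$ such that for all $h\in[H+1]$ and $\tau_h\in\mathcal F_h$: (1) conditionally on $\tau_h$, $\pi$ is $\varepsilon$-relative feasible; (2) for every player $i$ and every deviation $\pi'$ of $i$, either $\pi'\notin\Pi_G(\tau_h)$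 or $V_{i,h}^{\pi}(\tau_h)\ge V_{i,h}^{\pi'}(\tau_h)$, where $V_{i,h}$ is the expected reward of $i$ from time $h$ on. The deviations are $\pi'=(\pi_i',\pi_{-i})$ for CCE, and $\pi'=\phi_i\circ\pi$ (player $i$ replaces the recommended own action by a possibly random one, depending on the history and the recommendation) for CE. **Assumptions.** Each $C_h(s,a)$ is a product distribution; $c^{max}_i=\sup_{h,s,a}\sup\mathrm{Supp}(C_{i,h}(s,a))<\infty$, $c_i^{max}>0$, $Hc_i^{max}>B_i$ and $B_i\ne0$ for every player $i$. **Algorithm 4** with rounding units $\ell_i>0$: form the approximate game $\hat G$, in which each cost $c_i$ is replaced by the larger of $\lfloor c_i/\ell_i\rfloor\ell_i$ and $\lfloor (B_i-Hc^{max}_i)/\ell_i\rfloor\ell_i$. Build the AND/OR graph of (time, state, cumulative cost)-triples reachable by actions that never violate the budget immediately, evaluate it bottom-up (a triple at time $H+1$ is TRUE, an action is TRUE if all its successors are, an earlier triple is TRUE if some action is), and output "Infeasible" if its root is FALSE. Otherwise restrict to the TRUE triples and actions and proceed by backward induction, solving at each triple by the given linear-program feasibility solver the CE/CCE linear program over distributions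 on the TRUE actions $X$, in which actions outside $X$ have utility $-\infty$ (and $0\cdot\infty=0$). The resulting policy is played in $G$ by tracking the rounded cumulative costs. **Cost model.** $|G|$ counts the states, individual actions, time steps, players' budgets and maximal costs, and one entry for each transition probability, expected reward and marginal cost distribution. Running time is the number of elementary steps (real arithmetic, comparison, rounding, array/list access, evaluation of a marginal distribution function), plus the steps of the linear-program solver, which is assumed to use at most $p(\#\text{variables}+\#\text{rows})$ steps for a polynomial $p$. **Statement.** Let $\varepsilon>0$ and $\ell=\varepsilon|B|/H$ (a vector), and fix either notion, CE or CCE. 1. With any correct linear-program feasibility solver: if Algorithm 4 outputs "Infeasible", then $G$ has no feasible policy; if it outputs a policy, that policy is $\varepsilon$-relative feasible and an $\varepsilon$-relative approximate ACSPE for $G$. (In particular, it outputs "Infeasible" whenever no $\varepsilon$-relative feasible policy exists.) 2. For all polynomials $p$ and $q$ there is a polynomial $\mathcal P$ in two variables such that for every $n\ge1$, every $n$-player $G$ as above with $c^{max}\le q(|G|)\,|B|$ componentwise, every $\varepsilon>0$ and every solver with step bound $p$, Algorithm 4 takes at most $\mathcal P\big(|G|^n,\,1/\varepsilon^n\big)$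 steps. In particular, for each fixed number $n$ of players it runs in time $\mathrm{poly}(|G|,1/\varepsilon^n)$. -/

import Mathlib

open MeasureTheory ProbabilityTheory

noncomputable section

/-! ## Anytime-constrained Markov games -/

/-- Joint actions of `n` players, player `i` having the actions `0, …, m i - 1`. -/
abbrev JointAction {n : ℕ} (m : Fin n → ℕ) : Type := ∀ i, Fin (m i)

/-- A tabular finite-horizon `n`-player constrained Markov game together with its budget vector.
Times are counted from `0`, so the history after `t` completed steps is the one
observed at the beginning of step `t`; only the data at times `t < horizon` are ever used. -/
structure MarkovGame (n : ℕ) where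
  numStates : ℕ
  numActions : Fin n → ℕ
  horizon : ℕ
  start : Fin numStates
  trans : ℕ → Fin numStates → JointAction numActions → PMF (Fin numStates)
  reward : ℕ → Fin numStates → JointAction numActions → Measure (Fin n → ℝ)
  cost : ℕ → Fin numStates → JointAction numActions → Measure (Fin n → ℝ)
  budget : Fin n → ℝ
  horizon_pos : 0 < horizon
  numActions_pos : ∀ i, 0 < numActions i
  reward_prob : ∀ t s a, IsProbabilityMeasure (reward t s a)
  reward_integrable : ∀ t s a i, Integrable (fun x : Fin n → ℝ => x i) (reward t s a)
  cost_prob : ∀ t s a, IsProbabilityMeasure (cost t s a)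

attribute [instance] MarkovGame.reward_prob MarkovGame.cost_prob

namespace MarkovGame

variable {n : ℕ} (G : MarkovGame n)

abbrev State : Type := Fin G.numStates

abbrev Action : Type := JointAction G.numActions

/-- The expected reward of player `i`. -/
def meanReward (t : ℕ) (s : G.State) (a : G.Action) (i : Fin n) : ℝ :=
  ∫ x, x i ∂(G.reward t s a)

/-- Histories after `t` completed steps: every step records the joint action, the cost vector and
the next state; the first state is always `G.start`. -/
abbrev Hist (t : ℕ) : Type := Fin t → G.Action × (Fin n → ℝ) × G.State

variable {G}

/-- The state reached after the first `j` steps of a history. -/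
def stateAt {t : ℕ} (τ : G.Hist t) : (j : ℕ) → j ≤ t → G.State
  | 0, _ => G.start
  | j + 1, h => (τ ⟨j, h⟩).2.2

/-- The state in which a history ends. -/
def lastState {t : ℕ} (τ : G.Hist t) : G.State := stateAt τ t le_rfl

/-- The cost of player `i` accumulated in the first `j` steps of a history. -/
def cumCost {t : ℕ} (τ : G.Hist t) (j : ℕ) (i : Fin n) : ℝ :=
  ∑ x : Fin t, if x.val < j then (τ x).2.1 i else 0

theorem measurable_stateAt {t : ℕ} (j : ℕ) (h : j ≤ t) :
    Measurable fun τ : G.Hist t => stateAt τ j h := by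
  cases j with
  | zero => exact measurable_const
  | succ j => exact (measurable_snd.comp measurable_snd).comp (measurable_pi_apply _)

theorem measurable_lastState {t : ℕ} : Measurable fun τ : G.Hist t => lastState τ :=
  measurable_stateAt t le_rfl

variable (G)

/-- A joint policy: a distribution over joint actions for every history (depending measurably on
it). -/
structure Policy where
  act : ∀ t, Kernel (G.Hist t) G.Action
  markov : ∀ t, IsMarkovKernel (act t)

/-- A policy of player `i` alone. -/
structure PlayerPolicy (i : Fin n) where
  act : ∀ t, Kernel (G.Hist t) (Fin (G.numActions i))
  markov : ∀ t, IsMarkovKernel (act t)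

/-- A (randomized) strategy modification of player `i`: given the history and the own action that
was recommended, choose another own action. -/
structure Modification (i : Fin n) where
  act : ∀ t, Kernel (G.Hist t × Fin (G.numActions i)) (Fin (G.numActions i))
  markov : ∀ t, IsMarkovKernel (act t)

attribute [instance] Policy.markov PlayerPolicy.markov Modification.markov

/-- The reaction of the environment: given a history and a joint action, the cost vector and the
next state are drawn independently. -/
def env (t : ℕ) : Kernel (G.Hist t × G.Action) ((Fin n → ℝ) × G.State) :=
  (Kernel.ofFunOfCountable fun sa : G.State × G.Action =>
      (G.cost t sa.1 sa.2).prod (G.trans t sa.1 sa.2).toMeasure).comap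
    (fun p => (lastState p.1, p.2))
    ((measurable_lastState.comp measurable_fst).prodMk measurable_snd)

variable {G}

/-- `π.lawGiven τ k` is the law of the `k`-step history when the first `t` steps are those of `τ`
and the policy `π` is followed afterwards. -/
def Policy.lawGiven (π : G.Policy) {t : ℕ} (τ : G.Hist t) : (k : ℕ) → Measure (G.Hist k)
  | 0 => Measure.dirac fun x => x.elim0
  | k + 1 =>
    if h : k + 1 ≤ t then Measure.dirac fun x => τ (x.castLE h)
    else ((π.lawGiven τ k).compProd ((π.act k).compProd (G.env k))).map
      fun p => (Fin.snoc p.1 p.2 : G.Hist (k + 1))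

/-- The law of the `k`-step history under `π`. -/
def Policy.law (π : G.Policy) (k : ℕ) : Measure (G.Hist k) :=
  π.lawGiven (t := 0) (fun x => x.elim0) k

/-- Conditionally on `τ`, the policy `π` almost surely respects the budget vector `b` at all
times. -/
def Policy.FeasibleGiven (π : G.Policy) (b : Fin n → ℝ) {t : ℕ} (τ : G.Hist t) : Prop :=
  ∀ᵐ ω ∂(π.lawGiven τ G.horizon), ∀ j, 1 ≤ j → j ≤ G.horizon → ∀ i, cumCost ω j i ≤ b i

/-- The policy `π` almost surely respects the budget vector `b` at all times. -/
def Policy.Feasible (π : G.Policy) (b : Fin n → ℝ) : Prop :=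
  ∀ᵐ ω ∂(π.law G.horizon), ∀ j, 1 ≤ j → j ≤ G.horizon → ∀ i, cumCost ω j i ≤ b i

/-- The value of player `i` from time `t` onward, conditionally on `τ`. -/
def Policy.value (π : G.Policy) (i : Fin n) {t : ℕ} (τ : G.Hist t) : ℝ :=
  ∫ ω, (∑ x : Fin G.horizon,
      if t ≤ x.val then G.meanReward x.val (stateAt ω x.val x.isLt.le) (ω x).1 i else 0)
    ∂(π.lawGiven τ G.horizon)

variable (G) in
/-- The histories that some feasible policy realizes with positive probability. -/
def FeasiblyRealizable (t : ℕ) : Set (G.Hist t) :=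
  {τ | ∃ π : G.Policy, π.Feasible G.budget ∧ 0 < π.law t {τ}}

/-- The joint policy in which player `i` plays `ρ` and the other players follow `π`. -/
def Policy.deviate (π : G.Policy) (i : Fin n) (ρ : G.PlayerPolicy i) : G.Policy where
  act t := ((π.act t).prod (ρ.act t)).map fun p => Function.update p.1 i p.2
  markov _ := Kernel.IsMarkovKernel.map _ Measurable.of_discrete

/-- The joint policy in which the action that `π` recommends to player `i` is modified by `φ`. -/
def Policy.modify (π : G.Policy) (i : Fin n) (φ : G.Modification i) : G.Policy where
  act t := ((π.act t).compProd ((φ.act t).comap (fun p : G.Hist t × G.Action => (p.1, p.2 i))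
      (measurable_fst.prodMk ((measurable_pi_apply i).comp measurable_snd)))).map
    fun p => Function.update p.1 i p.2
  markov _ := Kernel.IsMarkovKernel.map _ Measurable.of_discrete

end MarkovGame

/-- The two equilibrium notions: coarse correlated and correlated equilibrium. -/
inductive EqConcept where
  | cce
  | ce

namespace MarkovGame

variable {n : ℕ} {G : MarkovGame n}

/-- The joint policies that result from a deviation of player `i`. -/
def Policy.deviations (π : G.Policy) (i : Fin n) : EqConcept → Set G.Policy
  | .cce => Set.range (π.deviate i)
  | .ce => Set.range (π.modify i)

variable (G)

/-- The relaxed budget vector `B (1 + ε σ_B)`. -/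
def relBudget (ε : ℝ) (i : Fin n) : ℝ := G.budget i * (1 + ε * Real.sign (G.budget i))

variable {G}

/-- `π` is an `ε`-relative approximate anytime-constrained subgame-perfect equilibrium: in every
feasible subgame it respects the relaxed budget, and no deviation that respects the true budget has
a higher value for the deviating player. -/
def Policy.IsRelApproxACSPE (π : G.Policy) (c : EqConcept) (ε : ℝ) : Prop :=
  ∀ t ≤ G.horizon, ∀ τ ∈ G.FeasiblyRealizable t,
    π.FeasibleGiven (G.relBudget ε) τ ∧
      ∀ i, ∀ π' ∈ π.deviations i c,
        ¬ π'.FeasibleGiven G.budget τ ∨ π'.value i τ ≤ π.value i τ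

variable (G)

/-- The supported costs of player `i`. -/
def supportedCosts (i : Fin n) : Set ℝ :=
  {x | ∃ t < G.horizon, ∃ s a, x ∈ ((G.cost t s a).map fun c => c i).support}

/-- The largest supported cost of player `i`. -/
def maxCost (i : Fin n) : ℝ := sSup (G.supportedCosts i)

/-- The standing assumptions: cost distributions are products and bounded above, the maximal cost
is positive and could exhaust the budget, and the budget is nonzero (so that the rounding unit is
positive). -/
structure Standing : Prop where
  product : ∀ t < G.horizon, ∀ s a,
    G.cost t s a = Measure.pi fun i => (G.cost t s a).map fun c => c i
  bounded : ∀ i, BddAbove (G.supportedCosts i)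
  maxCost_pos : ∀ i, 0 < G.maxCost i
  budget_lt : ∀ i, G.budget i < G.horizon * G.maxCost i
  budget_ne : ∀ i, G.budget i ≠ 0

/-- The description size of the game: numbers of states, of individual actions, of time steps, one
entry for every transition probability, expected reward and marginal cost distribution, and the
budgets and maximal costs. -/
def size : ℕ :=
  G.numStates + (∑ i, G.numActions i) + G.horizon
    + G.horizon * G.numStates * (∏ i, G.numActions i) * (G.numStates + 2 * n) + 2 * n

/-- The distribution function `x ↦ Pr[c_i < x]` of a cost of player `i`. -/
def costCdf (t : ℕ) (s : G.State) (a : G.Action) (i : Fin n) (x : ℝ) : ℝ :=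
  ((G.cost t s a) {c | c i < x}).toReal

/-- The vector `ε |B| / H`. -/
def relUnit (ε : ℝ) (i : Fin n) : ℝ := ε * |G.budget i| / G.horizon

end MarkovGame

/-! ## Counting elementary steps

Algorithms are written for a machine with unit-cost operations on real numbers (arithmetic,
comparison, rounding) and on indices, and unit-cost array and list-cell access. A computation carries
its result and the number of elementary steps it took. -/

structure Timed (α : Type) where
  val : α
  steps : ℕ

instance : Monad Timed where
  pure x := ⟨x, 0⟩
  bind x f := ⟨(f x.val).val, x.steps + (f x.val).steps⟩

namespace Timed

variable {α β : Type}

/-- A result obtained by `k` elementary steps. -/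
def ops (k : ℕ) (x : α) : Timed α := ⟨x, k⟩

/-- A loop over a list that updates an accumulator. -/
def fold (f : β → α → Timed β) : β → List α → Timed β
  | b, [] => ops 1 b
  | b, a :: l => do
    let b₁ ← f b a
    let b₂ ← fold f b₁ l
    ops 1 b₂

/-- A loop over a list that collects the results. -/
def mapList (f : α → Timed β) : List α → Timed (List β)
  | [] => ops 1 []
  | a :: l => do
    let b ← f a
    let r ← mapList f l
    ops 1 (b :: r)

/-- A loop over a list that keeps the elements passing a test. -/
def filterList (f : α → Timed Bool) : List α → Timed (List α)
  | [] => ops 1 []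
  | a :: l => do
    let b ← f a
    let r ← filterList f l
    ops 1 (if b then a :: r else r)

/-- Test whether all elements of a list pass a test. -/
def allList (f : α → Timed Bool) : List α → Timed Bool
  | [] => ops 1 true
  | a :: l => do
    let b ← f a
    let r ← allList f l
    ops 1 (b && r)

/-- A loop over a list that adds up real numbers. -/
def sumList (f : α → Timed ℝ) : List α → Timed ℝ
  | [] => ops 1 0
  | a :: l => do
    let x ← f a
    let y ← sumList f l
    ops 1 (x + y)

/-- A loop that fills an array indexed by a finite type. -/
def tabulate {ι : Type} [Fintype ι] {β : ι → Type} (f : ∀ x, Timed (β x)) : Timed (∀ x, β x) :=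
  ⟨fun x => (f x).val, 1 + ∑ x, ((f x).steps + 1)⟩

end Timed

/-! ## Linear-program feasibility solvers -/

/-- A linear feasibility problem in `k` nonnegative variables `x`: every row `(c, r)` demands
`∑ v, c v * x v ≥ r`. A coefficient may be `⊤` (an infinite utility loss), with `⊤ * 0 = 0`. -/
structure LinProg (k : ℕ) where
  rows : List ((Fin k → EReal) × ℝ)

def LinProg.IsSolution {k : ℕ} (L : LinProg k) (x : Fin k → ℝ) : Prop :=
  (∀ v, 0 ≤ x v) ∧ ∀ row ∈ L.rows, (row.2 : EReal) ≤ ∑ v, row.1 v * (x v : EReal)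

/-- A procedure for linear feasibility problems, with its number of elementary steps. -/
structure LPSolver where
  solve : ∀ {k : ℕ}, LinProg k → Timed (Fin k → ℝ)

/-- The solver finds a solution whenever there is one. -/
def LPSolver.Correct (LP : LPSolver) : Prop :=
  ∀ {k : ℕ} (L : LinProg k), (∀ row ∈ L.rows, ∀ v, row.1 v ≠ ⊥) →
    (∃ x, L.IsSolution x) → L.IsSolution (LP.solve L).val

/-- The number of steps of the solver is at most the polynomial `p` of the numbers of variables and
rows. -/
def LPSolver.PolyTime (LP : LPSolver) (p : Polynomial ℕ) : Prop :=
  ∀ {k : ℕ} (L : LinProg k), (LP.solve L).steps ≤ p.eval (k + L.rows.length)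

/-! ## Solving games with finitely supported costs -/

/-- A constrained Markov game in tabular form; `costs t s a` lists the supported cost vectors with
their probabilities. -/
structure FiniteGame (n S : ℕ) (m : Fin n → ℕ) (H : ℕ) where
  start : Fin S
  trans : Fin H → Fin S → JointAction m → Fin S → ℝ
  reward : Fin H → Fin S → JointAction m → Fin n → ℝ
  costs : Fin H → Fin S → JointAction m → List ((Fin n → ℝ) × ℝ)
  budget : Fin n → ℝ

/-- A state together with a vector of cumulative costs. -/
abbrev Node (n S : ℕ) : Type := Fin S × (Fin n → ℝ)

/-- The list of all joint actions. -/
def jointActions {n : ℕ} (m : Fin n → ℕ) : List (JointAction m) := Finset.univ.toList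

section Algorithms

variable {n S H : ℕ} {m : Fin n → ℕ}

def nodeEq (x y : Node n S) : Timed Bool := Timed.ops (n + 1) (decide (x = y))

def insertNode (x : Node n S) : List (Node n S) → Timed (List (Node n S))
  | [] => Timed.ops 1 [x]
  | y :: l => do
    let e ← nodeEq x y
    if e then Timed.ops 1 (y :: l)
    else do
      let r ← insertNode x l
      Timed.ops 1 (y :: r)

def memNode (x : Node n S) : List (Node n S) → Timed Bool
  | [] => Timed.ops 1 false
  | y :: l => do
    let e ← nodeEq x y
    if e then Timed.ops 1 true else do
      let r ← memNode x l
      Timed.ops 1 r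

/-- Look up the value vector of a node in a list; absent nodes have value `0`. -/
def lookupValue (x : Node n S) : List (Node n S × (Fin n → ℝ)) → Timed (Fin n → ℝ)
  | [] => Timed.ops (n + 1) 0
  | y :: l => do
    let e ← nodeEq x y.1
    if e then Timed.ops 1 y.2 else do
      let r ← lookupValue x l
      Timed.ops 1 r

namespace FiniteGame

/-- No supported cost of the action `a` violates the budget immediately. -/
def feasibleAction (F : FiniteGame n S m H) (t : Fin H) (x : Node n S) (a : JointAction m) :
    Timed Bool :=
  Timed.allList (fun c => Timed.ops (3 * n + 1) (decide (∀ i, x.2 i + c.1 i ≤ F.budget i)))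
    (F.costs t x.1 a)

/-- The nodes that can follow `x` under the action `a`, with their probabilities. -/
def successors (F : FiniteGame n S m H) (t : Fin H) (x : Node n S) (a : JointAction m) :
    Timed (List (Node n S × ℝ)) :=
  Timed.fold (fun acc c =>
      Timed.fold (fun acc₁ s =>
          if 0 < F.trans t x.1 a s then
            Timed.ops (n + 6)
              (((s, fun i => x.2 i + c.1 i), c.2 * F.trans t x.1 a s) :: acc₁)
          else Timed.ops 2 acc₁)
        acc (List.finRange S))
    [] (F.costs t x.1 a)

/-- One level of the AND/OR graph: the OR-nodes, each with its AND-nodes (feasible actions), each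
with its successors. -/
abbrev Level (n S : ℕ) (m : Fin n → ℕ) : Type :=
  List (Node n S × List (JointAction m × List (Node n S × ℝ)))

/-- The AND-nodes below an OR-node. -/
def expand (F : FiniteGame n S m H) (t : Fin H) (x : Node n S) :
    Timed (List (JointAction m × List (Node n S × ℝ))) := do
  let acts ← Timed.filterList (F.feasibleAction t x) (jointActions m)
  Timed.mapList (fun a => do
    let ch ← F.successors t x a
    Timed.ops 1 (a, ch)) acts

/-- The feasibility graph: the levels in decreasing order of time, and the OR-nodes reached at the
end of the horizon. -/
def feasibilityTree (F : FiniteGame n S m H) :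
    Timed (List (Fin H × Level n S m) × List (Node n S)) :=
  Timed.fold (fun st t => do
      let level ← Timed.mapList (fun x => do
        let ands ← F.expand t x
        Timed.ops 1 (x, ands)) st.2
      let next ← Timed.fold (fun acc e =>
        Timed.fold (fun acc₁ b =>
          Timed.fold (fun acc₂ y => insertNode y.1 acc₂) acc₁ b.2) acc e.2) [] level
      Timed.ops 1 ((t, level) :: st.1, next))
    ([], [(F.start, 0)]) (List.finRange H)

/-- Bottom-up evaluation of the feasibility graph. The result consists of the TRUE OR-nodes with
their TRUE AND-nodes in increasing order of time, and the list of TRUE nodes of the first level. An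
AND-node is TRUE if all its successors are; an OR-node is TRUE if one of its AND-nodes is, or if it
lies at the end of the horizon. -/
def evalTree (T : List (Fin H × Level n S m) × List (Node n S)) :
    Timed (List (Fin H × Level n S m) × List (Node n S)) :=
  Timed.fold (fun st lev => do
      let kept ← Timed.fold (fun acc e => do
        let ands ← Timed.filterList
          (fun b => Timed.allList (fun y => memNode y.1 st.2) b.2) e.2
        if ands.isEmpty then Timed.ops 1 acc else Timed.ops 1 ((e.1, ands) :: acc)) [] lev.2
      let nodes ← Timed.mapList (fun e => Timed.ops 1 e.1) kept
      Timed.ops 1 ((lev.1, kept) :: st.1, nodes))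
    ([], T.2) T.1

/-- The feasibility algorithm: `none` means "Infeasible"; otherwise the feasible nodes at every
time with their feasible actions. -/
def feasibility (F : FiniteGame n S m H) :
    Timed (Option (List (Fin H × List (Node n S × List (JointAction m))))) := do
  let T ← F.feasibilityTree
  let E ← evalTree T
  let root ← memNode (F.start, 0) E.2
  if root then do
    let R ← Timed.mapList (fun lev => do
      let es ← Timed.mapList (fun e => do
        let acts ← Timed.mapList (fun b => Timed.ops 1 b.1) e.2
        Timed.ops 1 (e.1, acts)) lev.2
      Timed.ops 1 (lev.1, es)) E.1
    Timed.ops 1 (some R)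
  else Timed.ops 1 none

end FiniteGame

/-- An action-constrained Markov game, whose states at a given time are nodes: every state comes
with its allowed joint actions, and every allowed action with its expected reward vector and its
transition probabilities. -/
abbrev ActionConstrainedMG (n S : ℕ) (m : Fin n → ℕ) (H : ℕ) : Type :=
  List (Fin H × List (Node n S × List (JointAction m × (Fin n → ℝ) × List (Node n S × ℝ))))

/-- A Markovian policy of an action-constrained game: at every time and state, the probabilities of
the allowed joint actions. -/
abbrev PolicyTable (n S : ℕ) (m : Fin n → ℕ) (H : ℕ) : Type :=
  List (Fin H × List (Node n S × List (JointAction m × ℝ)))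

/-- The reduced game on the feasible nodes and actions. -/
def FiniteGame.reducedGame (F : FiniteGame n S m H)
    (R : List (Fin H × List (Node n S × List (JointAction m)))) :
    Timed (ActionConstrainedMG n S m H) :=
  Timed.mapList (fun lev => do
    let es ← Timed.mapList (fun e => do
      let acts ← Timed.mapList (fun a => do
        let ch ← F.successors lev.1 e.1 a
        Timed.ops (n + 1) (a, F.reward lev.1 e.1.1 a, ch)) e.2
      Timed.ops 1 (e.1, acts)) lev.2
    Timed.ops 1 (lev.1, es)) R

/-- The utility of player `i` in a stage game that is given by its list of allowed joint actions
with their utility vectors; a joint action that is not allowed has utility `-∞`. -/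
def utility (i : Fin n) (a : JointAction m) : List (JointAction m × (Fin n → ℝ)) → Timed EReal
  | [] => Timed.ops 1 ⊥
  | y :: l =>
    if a = y.1 then Timed.ops (n + 1) (y.2 i : EReal)
    else do
      let r ← utility i a l
      Timed.ops (n + 1) r

/-- The utility that player `i` loses by playing `b` instead of the recommended action, when the
joint recommendation is the `v`-th allowed action. -/
def utilityLoss (Q : List (JointAction m × (Fin n → ℝ))) (i : Fin n) (b : Fin (m i))
    (v : Fin Q.length) : Timed EReal := do
  let x ← utility i Q[v].1 Q
  let y ← utility i (Function.update Q[v].1 i b) Q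
  Timed.ops (n + 1) (x - y)

/-- The deviation rows of the linear program: for coarse correlated equilibria, one for every player
and own action; for correlated equilibria, one for every player, recommended action and own
action. -/
def deviationRows (Q : List (JointAction m × (Fin n → ℝ))) :
    EqConcept → Timed (List ((Fin Q.length → EReal) × ℝ))
  | .cce => Timed.mapList (fun d : Σ i, Fin (m i) => do
      let c ← Timed.tabulate fun v => utilityLoss Q d.1 d.2 v
      Timed.ops 1 (c, 0)) Finset.univ.toList
  | .ce => Timed.mapList (fun d : Σ i, Fin (m i) × Fin (m i) => do
      let c ← Timed.tabulate fun v =>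
        if Q[v].1 d.1 = d.2.1 then utilityLoss Q d.1 d.2.2 v else Timed.ops 1 0
      Timed.ops 1 (c, 0)) Finset.univ.toList

/-- The linear program of a stage game: the variables are the probabilities of the allowed joint
actions; they sum to one and satisfy the deviation rows. -/
def stageLP (c : EqConcept) (Q : List (JointAction m × (Fin n → ℝ))) :
    Timed (LinProg Q.length) := do
  let rows ← deviationRows Q c
  Timed.ops (2 * Q.length + 2) ⟨(fun _ => 1, 1) :: (fun _ => -1, -1) :: rows⟩

/-- Backward induction: solve the stage game of every state of the action-constrained game by the
linear program. -/
def constrainedSolver (LP : LPSolver) (c : EqConcept) (M : ActionConstrainedMG n S m H) :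
    Timed (PolicyTable n S m H) := do
  let rev ← Timed.fold (fun acc lev => Timed.ops 1 (lev :: acc)) [] M
  let res ← Timed.fold
    (fun (st : PolicyTable n S m H × List (Node n S × (Fin n → ℝ))) lev => do
      let out ← Timed.mapList (fun e => do
        let Q ← Timed.mapList (fun act => do
          let q ← Timed.tabulate fun i => do
            let z ← Timed.sumList (fun y => do
              let v ← lookupValue y.1 st.2
              Timed.ops 2 (y.2 * v i)) act.2.2
            Timed.ops 2 (act.2.1 i + z)
          Timed.ops 1 (act.1, q)) e.2
        let L ← stageLP c Q
        let σ ← LP.solve L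
        let dist ← Timed.mapList (fun v : Fin Q.length => Timed.ops 2 (Q[v].1, σ v))
          (List.finRange Q.length)
        let val ← Timed.tabulate fun i =>
          Timed.sumList (fun v : Fin Q.length => Timed.ops 3 (σ v * Q[v].2 i))
            (List.finRange Q.length)
        Timed.ops 1 (e.1, dist, val)) lev.2
      let pol ← Timed.mapList (fun o => Timed.ops 2 (o.1, o.2.1)) out
      let vals ← Timed.mapList (fun o => Timed.ops 2 (o.1, o.2.2)) out
      Timed.ops 1 ((lev.1, pol) :: st.1, vals))
    ([], []) rev
  Timed.ops 1 res.1

/-- The reduction: `none` means "Infeasible". -/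
def FiniteGame.reduction (F : FiniteGame n S m H) (LP : LPSolver) (c : EqConcept) :
    Timed (Option (PolicyTable n S m H)) := do
  let x ← F.feasibility
  match x with
  | none => Timed.ops 1 none
  | some R => do
    let M ← F.reducedGame R
    let π ← constrainedSolver LP c M
    Timed.ops 1 (some π)

end Algorithms

/-! ## The approximation algorithm -/

namespace MarkovGame

variable {n : ℕ} (G : MarkovGame n) (ℓ : Fin n → ℝ)

/-- The smallest rounded cost of player `i`, in multiples of `ℓ i`. -/
def loIdx (i : Fin n) : ℤ := ⌊(G.budget i - G.horizon * G.maxCost i) / ℓ i⌋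

/-- The largest rounded cost of player `i`, in multiples of `ℓ i`. -/
def hiIdx (i : Fin n) : ℤ := ⌊G.maxCost i / ℓ i⌋

/-- The rounded cost in multiples of `ℓ i`: costs are rounded down to a multiple of `ℓ i`, and costs
below the smallest rounded cost are replaced by that one. -/
def roundIdx (i : Fin n) (c : ℝ) : ℤ := max (G.loIdx ℓ i) ⌊c / ℓ i⌋

/-- The probability that the rounded cost of player `i` is `k * ℓ i`, by means of the distribution
function. -/
def cellProb (t : ℕ) (s : G.State) (a : G.Action) (i : Fin n) (k : ℤ) : ℝ :=
  if k = G.loIdx ℓ i then G.costCdf t s a i ((k + 1) * ℓ i)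
  else G.costCdf t s a i ((k + 1) * ℓ i) - G.costCdf t s a i (k * ℓ i)

/-- Construction of the approximate game: the same game with the rounded costs, which are supported
on finitely many vectors. -/
def approxGame : Timed (FiniteGame n G.numStates G.numActions G.horizon) := do
  let lo ← Timed.tabulate fun i => Timed.ops 7 (G.loIdx ℓ i)
  let hi ← Timed.tabulate fun i => Timed.ops 4 (G.hiIdx ℓ i)
  let trans ← Timed.tabulate fun t : Fin G.horizon => Timed.tabulate fun s : G.State =>
    Timed.tabulate fun a : G.Action => Timed.tabulate fun s₁ : G.State =>
      Timed.ops 1 (G.trans t s a s₁).toReal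
  let reward ← Timed.tabulate fun t : Fin G.horizon => Timed.tabulate fun s : G.State =>
    Timed.tabulate fun a : G.Action => Timed.tabulate fun i : Fin n =>
      Timed.ops 1 (G.meanReward t s a i)
  let costs ← Timed.tabulate fun t : Fin G.horizon => Timed.tabulate fun s : G.State =>
    Timed.tabulate fun a : G.Action =>
      Timed.fold (fun acc k => do
          let p ← Timed.tabulate fun i => Timed.ops 10 (G.cellProb ℓ t s a i (k i))
          let q ← Timed.ops (n + 1) (∏ i, p i)
          if 0 < q then Timed.ops (2 * n + 2) ((fun i => k i * ℓ i, q) :: acc)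
          else Timed.ops 1 acc)
        [] (Fintype.piFinset fun i => Finset.Icc (lo i) (hi i)).toList
  let budget ← Timed.tabulate fun i => Timed.ops 1 (G.budget i)
  Timed.ops 1 ⟨G.start, trans, reward, costs, budget⟩

/-- The approximation algorithm with rounding units `ℓ`: `none` means "Infeasible". -/
def approximation (LP : LPSolver) (c : EqConcept) :
    Timed (Option (PolicyTable n G.numStates G.numActions G.horizon)) := do
  let F ← G.approxGame ℓ
  F.reduction LP c

variable {G}

/-- The last state and the accumulated rounded cost (in multiples of `ℓ`) of a history. -/
def roundedNode {t : ℕ} (τ : G.Hist t) : G.State × (Fin n → ℤ) :=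
  (lastState τ, fun i => ∑ x, G.roundIdx ℓ i ((τ x).2.1 i))

theorem measurable_roundedNode {t : ℕ} :
    Measurable fun τ : G.Hist t => roundedNode ℓ τ := by
  refine measurable_lastState.prodMk (measurable_pi_lambda _ fun i => ?_)
  refine Finset.measurable_sum _ fun x _ => ?_
  have h : Measurable fun τ : G.Hist t => (τ x).2.1 i :=
    (measurable_pi_apply i).comp
      ((measurable_fst.comp measurable_snd).comp (measurable_pi_apply x))
  exact measurable_const.max (h.div_const _).floor

/-- The distribution with weights `w` over joint actions; an arbitrary fixed action is chosen if the
weights do not sum to one. -/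
def toPMF (w : G.Action → ℝ) : PMF G.Action :=
  open Classical in
  if h : ∑ a, ENNReal.ofReal (w a) = 1 then PMF.ofFintype (fun a => ENNReal.ofReal (w a)) h
  else PMF.pure fun i => ⟨0, G.numActions_pos i⟩

/-- The weight that a table gives to the joint action `a` at time `t` and node `x`. -/
def tableWeight (T : PolicyTable n G.numStates G.numActions G.horizon) (t : ℕ)
    (x : Node n G.numStates) (a : G.Action) : ℝ :=
  if h : t < G.horizon then
    ((((T.lookup ⟨t, h⟩).getD []).lookup x).getD []).lookup a |>.getD 0
  else 0

/-- The history-dependent policy represented by a table: the players follow the table at the last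
state and the accumulated rounded cost of the history. -/
def tablePolicy (T : PolicyTable n G.numStates G.numActions G.horizon) : G.Policy where
  act t := (Kernel.ofFunOfCountable fun y : G.State × (Fin n → ℤ) =>
      (toPMF (tableWeight T t (y.1, fun i => y.2 i * ℓ i))).toMeasure).comap
    (roundedNode ℓ) (measurable_roundedNode ℓ)
  markov t :=
    have : IsMarkovKernel (Kernel.ofFunOfCountable fun y : G.State × (Fin n → ℤ) =>
      (toPMF (tableWeight T t (y.1, fun i => y.2 i * ℓ i))).toMeasure) :=
      ⟨fun _ => PMF.toMeasure.isProbabilityMeasure _⟩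
    inferInstance

end MarkovGame

end

/-! The nodes of the approximate game, a state with an accumulated rounded cost, carry all that is
needed to decide feasibility. Two inequalities tie them to true costs. A history within budget has a
rounded cost within budget (`nodeOf_le_budget`): rounding down only lowers costs, and a cost clipped
to the lowest level, at most `B - H c^max`, leaves room for all the others. Conversely the true cost
exceeds the rounded one by at most `ℓ` per step (`totalCost_le_nodeOf`), hence by at most `H ℓ = ε
|B|` in all.

The next node depends only on the current node, the action, the rounded cost and the next state.
Since the players' costs are independent, the products of cell probabilities are the exact law of
the rounded cost. So almost sure statements and expectations over the true environment become
statements about successors in the graph (`ae_env_nodeOf`, `integral_env_nodeOf`).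

Backward induction then shows that a policy that is feasible given a history almost surely plays
TRUE actions only (`ae_goodAct`). Hence a FALSE root excludes feasible policies, and a feasible
deviation stays inside the restricted stage games. Their linear programs are solvable, because a
correlated equilibrium with prescribed support exists as soon as all other joint actions have a
constant minimal utility (`exists_correlated_equilibrium`, by stationary measures and separation of
convex sets). Each solved stage game gives a one-step inequality between the node values `V` and a
deviation; these telescope along the law of the deviation (`value_le_of_step`), while the computed
policy attains at least `V` (`le_value_of_step`).

For the running time, every loop is bounded in terms of a single number `N` that dominates all list
lengths, and the total is a polynomial in `N`. Lists of nodes have no repetitions, so `N = |G| ∏ (H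
spread + 1)` suffices, where each factor is polynomial in `|G|` times `1 + 1/ε`. For a polynomial
independent of `n`, the polynomial in `|G|` is dominated by a pure power `|G|^d`, whose `n`-th power
is `(|G|^n)^d`, and `(1 + 1/ε)^n ≤ 2^n (1 + 1/ε^n)`. -/

noncomputable section

/-! ## Existence of correlated equilibria with restricted support -/

/-- A Markov chain with positive transition rates has a positive stationary measure. -/
theorem exists_stationary {ι : Type*} [Fintype ι] [DecidableEq ι] [Nonempty ι] (α : ι → ι → ℝ)
    (hα : ∀ a b, 0 < α a b) :
    ∃ p : ι → ℝ, (∀ a, 0 < p a) ∧ ∀ b, ∑ a, p a * α a b = p b * ∑ c, α b c := by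
  -- The rows of this matrix sum to zero, so it is singular. A left null vector solves the balance
  -- equations, possibly with mixed signs.
  let L : Matrix ι ι ℝ := Matrix.of fun a b => α a b - if a = b then ∑ c, α a c else 0
  have hdet : L.det = 0 := by
    refine Matrix.exists_mulVec_eq_zero_iff.mp ⟨fun _ => 1, ?_, ?_⟩
    · intro h
      exact one_ne_zero (congrFun h (Classical.arbitrary ι))
    · funext a
      simp [L, Matrix.mulVec, dotProduct, Finset.sum_sub_distrib]
  obtain ⟨w, hw0, hw⟩ := Matrix.exists_vecMul_eq_zero_iff.mpr hdet
  have hw' : ∀ b, ∑ a, w a * α a b = w b * ∑ c, α b c := by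
    intro b
    have := congrFun hw b
    simp only [L, Matrix.vecMul, dotProduct, Matrix.of_apply, mul_sub, Finset.sum_sub_distrib,
      mul_ite, mul_zero, Finset.sum_ite_eq', Finset.mem_univ, if_true, Pi.zero_apply] at this
    linarith
  have hS : ∀ b, 0 < ∑ c, α b c := fun b =>
    Finset.sum_pos (fun c _ => hα b c) Finset.univ_nonempty
  -- By the triangle inequality `|w|` satisfies the balance equations as inequalities. Both sides
  -- have the same total, so all of them are equalities.
  have hle : ∀ b ∈ Finset.univ, |w b| * ∑ c, α b c ≤ ∑ a, |w a| * α a b := by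
    intro b _
    rw [← abs_of_pos (hS b), ← abs_mul, ← hw' b]
    refine (Finset.abs_sum_le_sum_abs _ _).trans_eq ?_
    exact Finset.sum_congr rfl fun a _ => by rw [abs_mul, abs_of_pos (hα a b)]
  have hsum : ∑ b, |w b| * ∑ c, α b c = ∑ b, ∑ a, |w a| * α a b := by
    rw [Finset.sum_comm]
    exact Finset.sum_congr rfl fun a _ => by rw [Finset.mul_sum]
  have heq := (Finset.sum_eq_sum_iff_of_le hle).mp hsum
  refine ⟨fun a => |w a|, fun b => ?_, fun b => (heq b (Finset.mem_univ b)).symm⟩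
  obtain ⟨a, ha⟩ := Function.ne_iff.mp hw0
  have : 0 < |w b| * ∑ c, α b c := by
    rw [heq b (Finset.mem_univ b)]
    exact Finset.sum_pos' (fun c _ => mul_nonneg (abs_nonneg _) (hα c b).le)
      ⟨a, Finset.mem_univ a, mul_pos (abs_pos.mpr ha) (hα a b)⟩
  exact pos_of_mul_pos_left this (hS b).le

section

variable {n : ℕ} {m : Fin n → ℕ}

/-- Under a product of stationary measures, the expected gain from the transitions of one player
vanishes. -/
theorem sum_prod_stationary (α : ∀ i, Fin (m i) → Fin (m i) → ℝ) (p : ∀ i, Fin (m i) → ℝ)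
    (hp : ∀ i b, ∑ a, p i a * α i a b = p i b * ∑ c, α i b c) (i : Fin n)
    (f : JointAction m → ℝ) :
    ∑ a : JointAction m, (∏ j, p j (a j)) *
      ∑ b, α i (a i) b * (f a - f (Function.update a i b)) = 0 := by
  set R : JointAction m → ℝ := fun a => ∏ j ∈ Finset.univ.erase i, p j (a j) with hR
  have hP : ∀ a : JointAction m, ∏ j, p j (a j) = p i (a i) * R a := fun a =>
    (Finset.mul_prod_erase _ _ (Finset.mem_univ i)).symm
  have hRu : ∀ (a : JointAction m) b, R (Function.update a i b) = R a := fun a b =>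
    Finset.prod_congr rfl fun j hj => by
      rw [Function.update_of_ne (Finset.ne_of_mem_erase hj)]
  -- Exchanging the action `a i` with its replacement is an involution on pairs that fixes `R`. It
  -- turns the utility after a transition into an inflow to `a i`, which stationarity cancels
  -- against the outflow.
  have hinv : ∑ x : JointAction m × Fin (m i),
        p i (x.1 i) * R x.1 * (α i (x.1 i) x.2 * f (Function.update x.1 i x.2))
      = ∑ x : JointAction m × Fin (m i), p i x.2 * R x.1 * (α i x.2 (x.1 i) * f x.1) := by
    let e : JointAction m × Fin (m i) → JointAction m × Fin (m i) := fun x =>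
      (Function.update x.1 i x.2, x.1 i)
    have he : Function.Involutive e := fun x => by simp [e]
    refine Finset.sum_equiv he.toPerm (by simp) fun x _ => ?_
    simp [e, hRu]
  have h1 : ∑ a : JointAction m, (∏ j, p j (a j)) *
        ∑ b, α i (a i) b * (f a - f (Function.update a i b))
      = ∑ a : JointAction m, ∑ b, p i (a i) * R a * (α i (a i) b * f a)
        - ∑ a : JointAction m, ∑ b, p i (a i) * R a *
            (α i (a i) b * f (Function.update a i b)) := by
    rw [← Finset.sum_sub_distrib]
    refine Finset.sum_congr rfl fun a _ => ?_
    rw [hP, Finset.mul_sum, ← Finset.sum_sub_distrib]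
    exact Finset.sum_congr rfl fun b _ => by ring
  rw [h1, ← Fintype.sum_prod_type' (f := fun (a : JointAction m) b => p i (a i) * R a *
            (α i (a i) b * f (Function.update a i b))), hinv, Fintype.sum_prod_type,
    ← Finset.sum_sub_distrib]
  refine Finset.sum_eq_zero fun a _ => ?_
  have := hp i (a i)
  calc _ = R a * f a * (p i (a i) * ∑ c, α i (a i) c - ∑ b, p i b * α i b (a i)) := by
        rw [mul_sub]
        congr 1
        · rw [Finset.mul_sum, Finset.mul_sum]
          exact Finset.sum_congr rfl fun b _ => by ring
        · rw [Finset.mul_sum]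
          exact Finset.sum_congr rfl fun b _ => by ring
    _ = 0 := by rw [this, sub_self, mul_zero]

/-- What player `i` loses in the joint action `a` by playing `b'` whenever `b` is recommended. -/
def deviationLoss (u : JointAction m → Fin n → ℝ) (a : JointAction m)
    (r : Σ i, Fin (m i) × Fin (m i)) : ℝ :=
  if a r.1 = r.2.1 then u a r.1 - u (Function.update a r.1 r.2.2) r.1 else 0

/-- Use the weights of each player as transition rates and average over the product of the
stationary measures: the expected weighted loss is zero. Outside `X` utilities are minimal, so
losses there are at most zero. If they were negative on all of `X`, the average would be negative.
-/
theorem exists_nonneg_weighted_loss (X : Finset (JointAction m)) (hX : X.Nonempty)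
    (u : JointAction m → Fin n → ℝ) (c : Fin n → ℝ) (hc : ∀ a ∉ X, ∀ i, u a i = c i)
    (hu : ∀ a i, c i ≤ u a i) (w : (Σ i, Fin (m i) × Fin (m i)) → ℝ) (hw : ∀ r, 0 < w r) :
    ∃ a ∈ X, 0 ≤ ∑ r, w r * deviationLoss u a r := by
  obtain ⟨a₀, ha₀⟩ := hX
  have : ∀ i, Nonempty (Fin (m i)) := fun i => ⟨a₀ i⟩
  choose p hp hst using fun i => exists_stationary (fun b b' => w ⟨i, b, b'⟩) fun b b' => hw _
  have hloss : ∀ a, ∑ r, w r * deviationLoss u a r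
      = ∑ i, ∑ b, w ⟨i, a i, b⟩ * (u a i - u (Function.update a i b) i) := by
    intro a
    rw [Fintype.sum_sigma]
    refine Finset.sum_congr rfl fun i _ => ?_
    rw [Fintype.sum_prod_type]
    simp only [deviationLoss, mul_ite, mul_zero]
    rw [Finset.sum_eq_single (a i)]
    · simp
    · intro b _ hb
      simp [hb.symm]
    · simp
  have htot : ∑ a : JointAction m, (∏ j, p j (a j)) * ∑ r, w r * deviationLoss u a r = 0 := by
    simp_rw [hloss, Finset.mul_sum (s := (Finset.univ : Finset (Fin n)))]
    rw [Finset.sum_comm]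
    exact Finset.sum_eq_zero fun i _ => sum_prod_stationary (fun i b b' => w ⟨i, b, b'⟩) p hst i _
  by_contra! hneg
  refine absurd htot (ne_of_lt ?_)
  have hPpos : ∀ a : JointAction m, 0 < ∏ j, p j (a j) := fun a =>
    Finset.prod_pos fun j _ => hp j _
  refine Finset.sum_neg' (fun a _ => ?_) ⟨a₀, Finset.mem_univ _, ?_⟩
  · by_cases ha : a ∈ X
    · exact (mul_neg_of_pos_of_neg (hPpos a) (hneg a ha)).le
    · refine mul_nonpos_of_nonneg_of_nonpos (hPpos a).le ?_
      rw [hloss]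
      refine Finset.sum_nonpos fun i _ => Finset.sum_nonpos fun b _ => ?_
      exact mul_nonpos_of_nonneg_of_nonpos (hw _).le
        (by rw [hc a ha]; linarith [hu (Function.update a i b) i])
  · exact mul_neg_of_pos_of_neg (hPpos a₀) (hneg a₀ ha₀)

/-- A finite family of vectors has a convex combination in the nonnegative orthant if no positive
weight vector makes all of them negative. -/
theorem exists_convex_combination_nonneg {ι κ : Type*} [Fintype ι] (X : Finset κ)
    (hX : X.Nonempty) (D : κ → ι → ℝ)
    (h : ∀ w : ι → ℝ, (∀ r, 0 < w r) → ∃ a ∈ X, 0 ≤ ∑ r, w r * D a r) :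
    ∃ σ : κ → ℝ, (∀ a ∈ X, 0 ≤ σ a) ∧ ∑ a ∈ X, σ a = 1 ∧ ∀ r, 0 ≤ ∑ a ∈ X, σ a * D a r := by
  classical
  by_contra hno
  -- Theorem of the alternative: without such a combination, the compact hull of the vectors and the
  -- closed orthant are disjoint, hence strictly separated.
  have hdisj : Disjoint (convexHull ℝ ((X.image D : Finset (ι → ℝ)) : Set (ι → ℝ)))
      (Set.Ici (0 : ι → ℝ)) := by
    rw [Set.disjoint_left]
    intro y hy hy0
    rw [Finset.coe_image, ← Set.image_id (D '' (X : Set κ))] at hy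
    rw [Set.image_id, convexHull_eq_union_convexHull_finite_subsets] at hy
    obtain ⟨s, hs, hy⟩ : ∃ s : Finset (ι → ℝ), (s : Set (ι → ℝ)) ⊆ D '' X ∧
        y ∈ convexHull ℝ (s : Set (ι → ℝ)) := by simpa using hy
    obtain ⟨w, hw0, hw1, hwy⟩ := Finset.mem_convexHull'.mp hy
    have : Nonempty κ := hX.to_type
    -- `D` need not be injective, so the weight of each vector is put on one chosen preimage.
    choose! g hgX hg using fun z (hz : z ∈ s) => hs hz
    have hinj : Set.InjOn g s := fun a ha b hb hab => by
      rw [← hg a ha, ← hg b hb, hab]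
    have hsum : ∀ F : κ → ℝ → ℝ, (∀ a, F a 0 = 0) →
        ∑ a ∈ X, F a (if a ∈ s.image g then w (D a) else 0) = ∑ z ∈ s, F (g z) (w z) := by
      intro F hF
      rw [← Finset.sum_subset (s₁ := s.image g), Finset.sum_image hinj]
      · refine Finset.sum_congr rfl fun z hz => ?_
        rw [if_pos (Finset.mem_image_of_mem g hz), hg z hz]
      · intro a ha
        obtain ⟨z, hz, rfl⟩ := Finset.mem_image.mp ha
        exact hgX z hz
      · intro a _ ha
        rw [if_neg ha, hF]
    refine hno ⟨fun a => if a ∈ s.image g then w (D a) else 0, fun a _ => ?_, ?_, fun r => ?_⟩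
    · dsimp only
      split_ifs with ha
      · obtain ⟨z, hz, rfl⟩ := Finset.mem_image.mp ha
        rw [hg z hz]
        exact hw0 z hz
      · exact le_rfl
    · rw [hsum (fun _ x => x) (by simp), hw1]
    · rw [hsum (fun a x => x * D a r) (by simp)]
      have : ∑ z ∈ s, w z * D (g z) r = y r := by
        rw [← hwy, Finset.sum_apply]
        exact Finset.sum_congr rfl fun z hz => by rw [hg z hz]; simp
      rw [this]
      exact hy0 r
  obtain ⟨f, s, t, hfs, hst, hft⟩ := geometric_hahn_banach_compact_closed
    (convex_convexHull ℝ _) ((X.image D).finite_toSet.isCompact_convexHull ℝ)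
    (convex_Ici (0 : ι → ℝ)) isClosed_Ici hdisj
  have ht0 : t < 0 := by simpa using hft 0 (Set.mem_Ici.mpr le_rfl)
  have hf : ∀ y, f y = ∑ r, f (Pi.single r 1) * y r := by
    intro y
    conv_lhs => rw [pi_eq_sum_univ' y]
    rw [map_sum]
    refine Finset.sum_congr rfl fun r _ => ?_
    rw [map_smul, smul_eq_mul, mul_comm]
  -- If a coordinate were negative, a nonnegative multiple of this unit vector would attain the
  -- value `t` exactly, although the functional exceeds `t` on the orthant.
  have hf0 : ∀ r, 0 ≤ f (Pi.single r 1) := by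
    intro r
    by_contra! hr
    have h1 := hft ((t / f (Pi.single r 1)) • Pi.single r (1 : ℝ)) (by
      refine Set.mem_Ici.mpr (smul_nonneg (div_nonneg_of_nonpos ht0.le hr.le) ?_)
      exact Pi.single_nonneg.mpr zero_le_one)
    rw [map_smul, smul_eq_mul, div_mul_cancel₀ _ hr.ne] at h1
    exact lt_irrefl _ h1
  have hfX : ∀ a ∈ X, ∑ r, f (Pi.single r 1) * D a r < 0 := by
    intro a ha
    rw [← hf]
    exact ((hfs _ (subset_convexHull ℝ _ (by simpa using ⟨a, ha, rfl⟩))).trans hst).trans ht0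
  -- The separating weights are only nonnegative. As `X` is finite, a small increase makes them
  -- positive and keeps all sums negative.
  have hev : ∀ a ∈ X, ∀ᶠ δ in nhdsWithin (0 : ℝ) (Set.Ioi 0),
      ∑ r, (f (Pi.single r 1) + δ) * D a r < 0 := by
    intro a ha
    have hcont : Continuous fun δ : ℝ => ∑ r, (f (Pi.single r 1) + δ) * D a r := by fun_prop
    refine nhdsWithin_le_nhds (hcont.continuousAt.eventually_lt continuousAt_const ?_)
    simpa using hfX a ha
  obtain ⟨δ, hδ, hδ0⟩ :=
    (((Filter.eventually_all_finset X).mpr hev).and self_mem_nhdsWithin).exists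
  obtain ⟨a, ha, hpos⟩ := h (fun r => f (Pi.single r 1) + δ) fun r =>
    add_pos_of_nonneg_of_pos (hf0 r) hδ0
  exact absurd hpos (not_le.mpr (hδ a ha))

/-- A game has a correlated equilibrium supported on a given nonempty set of joint actions if all
other joint actions have a constant utility that is minimal. -/
theorem exists_correlated_equilibrium (X : Finset (JointAction m)) (hX : X.Nonempty)
    (u : JointAction m → Fin n → ℝ) (c : Fin n → ℝ) (hc : ∀ a ∉ X, ∀ i, u a i = c i)
    (hu : ∀ a i, c i ≤ u a i) :
    ∃ σ : JointAction m → ℝ, (∀ a ∈ X, 0 ≤ σ a) ∧ ∑ a ∈ X, σ a = 1 ∧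
      ∀ r, 0 ≤ ∑ a ∈ X, σ a * deviationLoss u a r :=
  exists_convex_combination_nonneg X hX _ fun w hw =>
    exists_nonneg_weighted_loss X hX u c hc hu w hw

end

/-! ### Results of timed computations, with the step counts stripped -/

namespace Timed

variable {α β γ : Type}

@[simp] theorem val_bind (x : Timed α) (f : α → Timed β) : (x >>= f).val = (f x.val).val := rfl

theorem steps_bind (x : Timed α) (f : α → Timed β) :
    (x >>= f).steps = x.steps + (f x.val).steps := rfl

@[simp] theorem val_ops (k : ℕ) (x : α) : (ops k x).val = x := rfl

@[simp] theorem steps_ops (k : ℕ) (x : α) : (ops k x).steps = k := rfl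

@[simp] theorem val_ite (p : Prop) [Decidable p] (x y : Timed α) :
    (if p then x else y).val = if p then x.val else y.val := apply_ite _ _ _ _

@[simp] theorem val_fold (f : β → α → Timed β) (b : β) (l : List α) :
    (fold f b l).val = l.foldl (fun b a => (f b a).val) b := by
  induction l generalizing b with
  | nil => rfl
  | cons a l ih => simp [fold, ih]

@[simp] theorem val_mapList (f : α → Timed β) (l : List α) :
    (mapList f l).val = l.map fun a => (f a).val := by
  induction l with
  | nil => rfl
  | cons a l ih => simp [mapList, ih]

@[simp] theorem val_filterList (f : α → Timed Bool) (l : List α) :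
    (filterList f l).val = l.filter fun a => (f a).val := by
  induction l with
  | nil => rfl
  | cons a l ih => simp [filterList, ih, List.filter_cons]

@[simp] theorem val_allList (f : α → Timed Bool) (l : List α) :
    (allList f l).val = l.all fun a => (f a).val := by
  induction l with
  | nil => rfl
  | cons a l ih => simp [allList, ih]

@[simp] theorem val_sumList (f : α → Timed ℝ) (l : List α) :
    (sumList f l).val = (l.map fun a => (f a).val).sum := by
  induction l with
  | nil => rfl
  | cons a l ih => simp [sumList, ih]

@[simp] theorem val_tabulate {ι : Type} [Fintype ι] {β : ι → Type} (f : ∀ x, Timed (β x)) :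
    (tabulate f).val = fun x => (f x).val := rfl

end Timed

/-! ### The feasibility graph and its bottom-up evaluation -/

section Algorithms

variable {n S H : ℕ} {m : Fin n → ℕ}

@[simp] theorem val_nodeEq (x y : Node n S) : (nodeEq x y).val = decide (x = y) := rfl

theorem mem_val_insertNode (x y : Node n S) (l : List (Node n S)) :
    y ∈ (insertNode x l).val ↔ y = x ∨ y ∈ l := by
  induction l with
  | nil => simp [insertNode]
  | cons z l ih =>
    by_cases h : x = z
    · subst h
      simp [insertNode]
    · simp only [insertNode, Timed.val_bind, val_nodeEq, h, decide_false, Bool.false_eq_true,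
        if_false, Timed.val_ops, List.mem_cons, ih]
      tauto

theorem nodup_val_insertNode (x : Node n S) (l : List (Node n S)) (hl : l.Nodup) :
    (insertNode x l).val.Nodup := by
  induction l with
  | nil => simp [insertNode]
  | cons z l ih =>
    by_cases h : x = z
    · subst h
      simpa [insertNode] using hl
    · simp only [insertNode, Timed.val_bind, val_nodeEq, h, decide_false, Bool.false_eq_true,
        if_false, Timed.val_ops, List.nodup_cons, mem_val_insertNode]
      rw [List.nodup_cons] at hl
      exact ⟨fun h' => h'.elim (fun h'' => h h''.symm) hl.1, ih hl.2⟩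

@[simp] theorem val_memNode (x : Node n S) (l : List (Node n S)) :
    (memNode x l).val = decide (x ∈ l) := by
  induction l with
  | nil => simp [memNode]
  | cons z l ih =>
    by_cases h : x = z <;> simp [memNode, h, ih]

theorem val_lookupValue (x : Node n S) (l : List (Node n S × (Fin n → ℝ))) :
    (lookupValue x l).val = (l.lookup x).getD 0 := by
  induction l with
  | nil => simp [lookupValue]
  | cons z l ih =>
    obtain ⟨y, v⟩ := z
    by_cases h : x = y
    · simp [lookupValue, h]
    · have h' : (x == y) = false := by simpa using h
      simp [lookupValue, List.lookup_cons, h, h', ih]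

theorem mem_jointActions (a : JointAction m) : a ∈ jointActions m := by simp [jointActions]

theorem nodup_jointActions : (jointActions m).Nodup := Finset.nodup_toList _

namespace FiniteGame

variable (F : FiniteGame n S m H)

/-- No supported cost of the action violates the budget. -/
def WithinBudget (t : Fin H) (x : Node n S) (a : JointAction m) : Prop :=
  ∀ c ∈ F.costs t x.1 a, ∀ i, x.2 i + c.1 i ≤ F.budget i

/-- The node `y` follows the node `x` with positive probability under the action `a`. -/
def IsSuccessor (t : Fin H) (x : Node n S) (a : JointAction m) (y : Node n S) : Prop :=
  ∃ c ∈ F.costs t x.1 a, 0 < F.trans t x.1 a y.1 ∧ y.2 = fun i => x.2 i + c.1 i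

/-- The TRUE nodes at time `t`, when `k` further steps are considered. -/
def GoodFor : (k t : ℕ) → Node n S → Prop
  | 0, _, _ => True
  | k + 1, t, x => ∃ h : t < H, ∃ a, F.WithinBudget ⟨t, h⟩ x a ∧
      ∀ y, F.IsSuccessor ⟨t, h⟩ x a y → GoodFor k (t + 1) y

/-- The TRUE nodes of the feasibility graph. -/
def Good (t : ℕ) (x : Node n S) : Prop := F.GoodFor (H - t) t x

/-- The TRUE actions of the feasibility graph. -/
def GoodAct (t : Fin H) (x : Node n S) (a : JointAction m) : Prop :=
  F.WithinBudget t x a ∧ ∀ y, F.IsSuccessor t x a y → F.Good (t + 1) y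

theorem good_horizon (x : Node n S) : F.Good H x := by simp [Good, GoodFor]

/-- Turns the recursion on the number of remaining steps, chosen to be structural, into the
recursion in time that the evaluation follows. -/
theorem good_iff (t : Fin H) (x : Node n S) : F.Good t x ↔ ∃ a, F.GoodAct t x a := by
  have h : H - t.val = (H - (t.val + 1)) + 1 := by omega
  simp [Good, GoodAct, h, GoodFor]

/-- The nodes of the feasibility graph. -/
inductive Reach : ℕ → Node n S → Prop
  | start : Reach 0 (F.start, 0)
  | step {t : Fin H} {x y : Node n S} {a : JointAction m} : Reach t x → F.WithinBudget t x a →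
      F.IsSuccessor t x a y → Reach (t + 1) y

theorem feasibleAction_val (t : Fin H) (x : Node n S) (a : JointAction m) :
    (F.feasibleAction t x a).val = true ↔ F.WithinBudget t x a := by
  simp [feasibleAction, WithinBudget]

theorem reach_zero (x : Node n S) : F.Reach 0 x ↔ x = (F.start, 0) := by
  constructor
  · intro h
    cases h
    rfl
  · rintro rfl
    exact .start

theorem reach_succ (t : Fin H) (y : Node n S) : F.Reach (t + 1) y ↔
    ∃ x a, F.Reach t x ∧ F.WithinBudget t x a ∧ F.IsSuccessor t x a y := by
  constructor
  · intro h
    generalize hs : t.val + 1 = s at h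
    cases h with
    | start => omega
    | @step t' x y a h1 h2 h3 =>
      obtain rfl : t = t' := Fin.ext (by omega)
      exact ⟨x, a, h1, h2, h3⟩
  · rintro ⟨x, a, h1, h2, h3⟩
    exact .step h1 h2 h3

theorem successors_val (t : Fin H) (x : Node n S) (a : JointAction m) :
    (F.successors t x a).val =
      ((F.costs t x.1 a).flatMap fun c => ((List.finRange S).filter
        fun s => 0 < F.trans t x.1 a s).map
          fun s => ((s, fun i => x.2 i + c.1 i), c.2 * F.trans t x.1 a s)).reverse := by
  have key : ∀ (c : (Fin n → ℝ) × ℝ) (l : List (Fin S)) (acc : List (Node n S × ℝ)),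
      l.foldl (fun acc₁ s => if 0 < F.trans t x.1 a s then
          ((s, fun i => x.2 i + c.1 i), c.2 * F.trans t x.1 a s) :: acc₁ else acc₁) acc
        = ((l.filter fun s => 0 < F.trans t x.1 a s).map
          fun s => (((s, fun i => x.2 i + c.1 i) : Node n S),
            c.2 * F.trans t x.1 a s)).reverse ++ acc := by
    intro c l
    induction l with
    | nil => simp
    | cons s l ih =>
      intro acc
      by_cases h : 0 < F.trans t x.1 a s <;> simp [h, ih]
  simp only [successors, Timed.val_fold, Timed.val_ite, Timed.val_ops, key]
  suffices ∀ (l : List ((Fin n → ℝ) × ℝ)) (acc : List (Node n S × ℝ)),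
      l.foldl (fun acc c => ((((List.finRange S).filter fun s => 0 < F.trans t x.1 a s).map
          fun s => (((s, fun i => x.2 i + c.1 i) : Node n S),
            c.2 * F.trans t x.1 a s)).reverse ++ acc)) acc
        = (l.flatMap fun c => ((List.finRange S).filter fun s => 0 < F.trans t x.1 a s).map
          fun s => (((s, fun i => x.2 i + c.1 i) : Node n S),
            c.2 * F.trans t x.1 a s)).reverse ++ acc by
    simpa using this (F.costs t x.1 a) []
  intro l
  induction l with
  | nil => simp
  | cons c l ih => intro acc; simp [ih]

theorem exists_mem_successors (t : Fin H) (x y : Node n S) (a : JointAction m) :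
    (∃ p, (y, p) ∈ (F.successors t x a).val) ↔ F.IsSuccessor t x a y := by
  rw [successors_val]
  constructor
  · rintro ⟨p, hp⟩
    simp only [List.mem_reverse, List.mem_flatMap, List.mem_map, List.mem_filter,
      List.mem_finRange, true_and, decide_eq_true_eq] at hp
    obtain ⟨c, hc, s, hs, h⟩ := hp
    obtain ⟨rfl, -⟩ := Prod.mk.inj h
    exact ⟨c, hc, hs, rfl⟩
  · rintro ⟨c, hc, hs, hy⟩
    refine ⟨c.2 * F.trans t x.1 a y.1, ?_⟩
    simp only [List.mem_reverse, List.mem_flatMap, List.mem_map, List.mem_filter,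
      List.mem_finRange, true_and, decide_eq_true_eq]
    exact ⟨c, hc, y.1, hs, by rw [← hy]⟩

theorem forall_mem_successors (t : Fin H) (x : Node n S) (a : JointAction m)
    (P : Node n S → Prop) :
    (∀ y ∈ (F.successors t x a).val, P y.1) ↔ ∀ y, F.IsSuccessor t x a y → P y := by
  constructor
  · intro h y hy
    obtain ⟨p, hp⟩ := (F.exists_mem_successors t x y a).mpr hy
    exact h _ hp
  · intro h y hy
    exact h y.1 ((F.exists_mem_successors t x y.1 a).mp ⟨y.2, hy⟩)

/-- The list omits next states without positive probability; nonnegativity makes the omitted terms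
zero. Repeated nodes would do no harm, as every occurrence carries its own weight. -/
theorem sum_successors (t : Fin H) (x : Node n S) (a : JointAction m)
    (f : Node n S → ℝ) (hF : ∀ s, 0 ≤ F.trans t x.1 a s) :
    ((F.successors t x a).val.map fun y => y.2 * f y.1).sum =
      ((F.costs t x.1 a).map fun c => c.2 *
        ∑ s, F.trans t x.1 a s * f (s, fun i => x.2 i + c.1 i)).sum := by
  rw [successors_val, List.map_reverse, List.sum_reverse, List.map_flatMap, List.flatMap_def,
    List.sum_flatten, List.map_map]
  congr 1
  refine List.map_congr_left fun c _ => ?_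
  have : ∀ l : List (Fin S), ((l.filter fun s => 0 < F.trans t x.1 a s).map fun s =>
      c.2 * F.trans t x.1 a s * f (s, fun i => x.2 i + c.1 i)).sum
      = (l.map fun s => c.2 * (F.trans t x.1 a s * f (s, fun i => x.2 i + c.1 i))).sum := by
    intro l
    induction l with
    | nil => simp
    | cons s l ih =>
      by_cases h : 0 < F.trans t x.1 a s
      · simp only [mul_assoc] at ih
        simp [h, ih, mul_assoc]
      · have h0 : F.trans t x.1 a s = 0 := le_antisymm (not_lt.mp h) (hF s)
        simp [h0, ih]
  simp only [List.map_map, Function.comp_def]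
  rw [this, Finset.mul_sum]
  rw [← List.ofFn_eq_map, List.sum_ofFn]

open Classical in
/-- The AND-nodes below a node. -/
theorem expand_val (t : Fin H) (x : Node n S) :
    (F.expand t x).val = ((jointActions m).filter fun a => F.WithinBudget t x a).map
      fun a => (a, (F.successors t x a).val) := by
  simp only [expand, Timed.val_bind, Timed.val_filterList, Timed.val_mapList, Timed.val_ops]
  congr 1
  refine List.filter_congr fun a _ => ?_
  rw [Bool.eq_iff_iff, feasibleAction_val, decide_eq_true_iff]

end FiniteGame

theorem mem_foldl_iff {α β : Type*} (ins : List β → α → List β) (Q : α → β → Prop)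
    (h : ∀ acc a y, y ∈ ins acc a ↔ y ∈ acc ∨ Q a y) (l : List α) (acc : List β) (y : β) :
    y ∈ l.foldl ins acc ↔ y ∈ acc ∨ ∃ a ∈ l, Q a y := by
  induction l generalizing acc with
  | nil => simp
  | cons a l ih => simp [ih, h, or_assoc]

theorem foldl_induction {α β : Type*} (f : β → α → β) (P : β → Prop) (l : List α) (b : β)
    (hb : P b) (h : ∀ b, ∀ a ∈ l, P b → P (f b a)) : P (l.foldl f b) := by
  induction l generalizing b with
  | nil => exact hb
  | cons a l ih =>
    exact ih _ (h _ _ (by simp) hb) fun b a' ha' => h b a' (by simp [ha'])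

/-- An invariant indexed by the time, proved for all suffixes of the loop because the accumulator
varies. -/
theorem foldl_finRange_induction {β : Type*} {H : ℕ} (f : β → Fin H → β) (P : ℕ → β → Prop)
    (b : β) (hb : P 0 b) (h : ∀ (t : Fin H) b, P t b → P (t + 1) (f b t)) :
    P H ((List.finRange H).foldl f b) := by
  suffices ∀ k t, t + k = H → ∀ b, P t b → P H (((List.finRange H).drop t).foldl f b) by
    simpa using this H 0 (by simp) b hb
  intro k
  induction k with
  | zero =>
    intro t ht b hb
    rw [List.drop_of_length_le (by simp; omega)]
    obtain rfl : t = H := by omega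
    exact hb
  | succ k ih =>
    intro t ht b hb
    rw [List.drop_eq_getElem_cons (by simp; omega), List.foldl_cons]
    refine ih (t + 1) (by omega) _ ?_
    simpa using h ⟨t, by omega⟩ b hb

theorem foldl_keep {α β : Type*} (p : α → Prop) [DecidablePred p] (f : α → β) (l : List α)
    (acc : List β) :
    l.foldl (fun acc e => if p e then acc else f e :: acc) acc
      = ((l.filter fun e => ¬ p e).map f).reverse ++ acc := by
  induction l generalizing acc with
  | nil => simp
  | cons a l ih => by_cases h : p a <;> simp [ih, h]

/-- Lists of levels for the times `k - 1, …, 0`. -/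
inductive DescLevels {α : Type*} {H : ℕ} (P : Fin H → α → Prop) : ℕ → List (Fin H × α) → Prop
  | nil : DescLevels P 0 []
  | cons {t : Fin H} {a : α} {l : List (Fin H × α)} : DescLevels P t l → P t a →
      DescLevels P (t + 1) ((t, a) :: l)

/-- Lists of levels for the times `k, …, H - 1`. -/
inductive AscLevels {α : Type*} {H : ℕ} (P : Fin H → α → Prop) : ℕ → List (Fin H × α) → Prop
  | nil : AscLevels P H []
  | cons {t : Fin H} {a : α} {l : List (Fin H × α)} : AscLevels P (t + 1) l → P t a →
      AscLevels P t ((t, a) :: l)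

theorem AscLevels.map {α β : Type*} {H : ℕ} {P : Fin H → α → Prop} {Q : Fin H → β → Prop}
    {k : ℕ} {l : List (Fin H × α)} (h : AscLevels P k l) (f : Fin H → α → β)
    (hf : ∀ t : Fin H, k ≤ t → ∀ a, P t a → Q t (f t a)) :
    AscLevels Q k (l.map fun x => (x.1, f x.1 x.2)) := by
  induction h with
  | nil => exact .nil
  | cons h1 h2 ih =>
    exact .cons (ih fun t ht a => hf t (by omega) a) (hf _ le_rfl _ h2)

theorem AscLevels.mono {α : Type*} {H : ℕ} {P Q : Fin H → α → Prop}
    {k : ℕ} {l : List (Fin H × α)} (h : AscLevels P k l)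
    (hf : ∀ t : Fin H, k ≤ t → ∀ a, P t a → Q t a) : AscLevels Q k l := by
  simpa using h.map (fun _ a => a) hf

theorem AscLevels.lookup {α : Type*} {H : ℕ} {P : Fin H → α → Prop}
    {k : ℕ} {l : List (Fin H × α)} (h : AscLevels P k l) (t : Fin H) (ht : k ≤ t) :
    ∃ a, l.lookup t = some a ∧ P t a := by
  induction h with
  | nil => omega
  | @cons t' a l h1 h2 ih =>
    by_cases he : t = t'
    · subst he
      exact ⟨a, by simp, h2⟩
    · have h' : (t == t') = false := by simpa using he
      obtain ⟨a, ha, hP⟩ := ih (by have := Fin.val_ne_of_ne he; omega)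
      exact ⟨a, by rw [List.lookup_cons, h', ha], hP⟩

namespace FiniteGame

variable (F : FiniteGame n S m H)

open Classical in
/-- A correctly built level of the feasibility graph. -/
def TreeLevel (t : Fin H) (level : Level n S m) : Prop :=
  ∃ nodes : List (Node n S), nodes.Nodup ∧ (∀ x, x ∈ nodes ↔ F.Reach t x) ∧
    level = nodes.map fun x => (x, ((jointActions m).filter fun a => F.WithinBudget t x a).map
      fun a => (a, (F.successors t x a).val))

/-- One step of the construction of the feasibility graph. -/
def treeStep (st : List (Fin H × Level n S m) × List (Node n S)) (t : Fin H) :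
    Timed (List (Fin H × Level n S m) × List (Node n S)) := do
  let level ← Timed.mapList (fun x => do
    let ands ← F.expand t x
    Timed.ops 1 (x, ands)) st.2
  let next ← Timed.fold (fun acc e =>
    Timed.fold (fun acc₁ b =>
      Timed.fold (fun acc₂ y => insertNode y.1 acc₂) acc₁ b.2) acc e.2) [] level
  Timed.ops 1 ((t, level) :: st.1, next)

theorem feasibilityTree_eq :
    F.feasibilityTree = Timed.fold F.treeStep ([], [(F.start, 0)]) (List.finRange H) := rfl

/-- The levels before time `t` and the nodes at time `t` have been constructed. -/
def Constructed (t : ℕ) (st : List (Fin H × Level n S m) × List (Node n S)) : Prop :=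
  DescLevels F.TreeLevel t st.1 ∧ st.2.Nodup ∧ ∀ x, x ∈ st.2 ↔ F.Reach t x

theorem constructed_zero : F.Constructed 0 ([], [(F.start, 0)]) :=
  ⟨.nil, by simp, fun x => by simp [reach_zero]⟩

theorem treeStep_spec (t : Fin H) (st : List (Fin H × Level n S m) × List (Node n S))
    (hst : F.Constructed t st) : F.Constructed (t + 1) (F.treeStep st t).val := by
  classical
  obtain ⟨ls, nodes⟩ := st
  obtain ⟨h1, h2, h3⟩ := hst
  simp only [treeStep, Timed.val_bind, Timed.val_mapList, Timed.val_ops, Timed.val_fold, expand_val]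
  refine ⟨.cons h1 ⟨nodes, h2, h3, rfl⟩, ?_, fun y => ?_⟩
  · refine foldl_induction _ List.Nodup _ _ List.nodup_nil fun b e _ hb => ?_
    refine foldl_induction _ List.Nodup _ _ hb fun b e _ hb => ?_
    exact foldl_induction _ List.Nodup _ _ hb fun b e _ hb => nodup_val_insertNode _ _ hb
  · rw [mem_foldl_iff _ (fun e y => ∃ b ∈ e.2, ∃ z ∈ b.2, y = z.1) (fun acc e y =>
      mem_foldl_iff _ (fun b y => ∃ z ∈ (b : JointAction m × List (Node n S × ℝ)).2, y = z.1)
        (fun acc b y => mem_foldl_iff _ (fun z y => y = (z : Node n S × ℝ).1) (fun acc z y => by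
          rw [mem_val_insertNode, or_comm]) _ _ _) _ _ _), reach_succ]
    simp only [List.not_mem_nil, false_or, List.mem_map]
    constructor
    · rintro ⟨_, ⟨x, hx, rfl⟩, b, hb, z, hz, rfl⟩
      simp only [List.mem_map, List.mem_filter, decide_eq_true_eq] at hb
      obtain ⟨a, ⟨-, ha⟩, rfl⟩ := hb
      exact ⟨x, a, (h3 x).mp hx, ha, (F.exists_mem_successors _ _ _ _).mp ⟨z.2, hz⟩⟩
    · rintro ⟨x, a, hx, ha, hy⟩
      obtain ⟨p, hp⟩ := (F.exists_mem_successors _ _ _ _).mpr hy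
      refine ⟨_, ⟨x, (h3 x).mpr hx, rfl⟩, (a, (F.successors t x a).val), ?_, _, hp, rfl⟩
      simp only [List.mem_map, List.mem_filter, decide_eq_true_eq]
      exact ⟨a, ⟨mem_jointActions a, ha⟩, rfl⟩

theorem feasibilityTree_spec : F.Constructed H F.feasibilityTree.val := by
  rw [feasibilityTree_eq, Timed.val_fold]
  exact foldl_finRange_induction _ F.Constructed _ F.constructed_zero F.treeStep_spec

open Classical in
/-- A correctly evaluated level, in which every TRUE node carries the data `g x a` for every TRUE
action `a`. -/
def KeptLevel {γ : Type*} (g : Fin H → Node n S → JointAction m → γ) (t : Fin H)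
    (kept : List (Node n S × List γ)) : Prop :=
  ∃ nodes : List (Node n S), nodes.Nodup ∧ (∀ x, x ∈ nodes ↔ F.Reach t x ∧ F.Good t x) ∧
    kept = nodes.map fun x => (x, ((jointActions m).filter fun a => F.GoodAct t x a).map (g t x))

/-- A successor of a reached node under an action within budget is reached too, so for it membership
in the list of reached TRUE nodes means being TRUE. This justifies the membership test of the
algorithm. -/
theorem goodAct_iff (t : Fin H) (x : Node n S) (hx : F.Reach t x) (a : JointAction m)
    (nodes : List (Node n S)) (hn : ∀ x, x ∈ nodes ↔ F.Reach (t + 1) x ∧ F.Good (t + 1) x) :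
    F.GoodAct t x a ↔ F.WithinBudget t x a ∧ ∀ y ∈ (F.successors t x a).val, y.1 ∈ nodes := by
  rw [F.forall_mem_successors t x a (· ∈ nodes)]
  refine and_congr_right fun ha => forall₂_congr fun y hy => ?_
  rw [hn, and_iff_right (.step hx ha hy)]

/-- One step of the bottom-up evaluation. -/
def evalStep (st : List (Fin H × Level n S m) × List (Node n S)) (lev : Fin H × Level n S m) :
    Timed (List (Fin H × Level n S m) × List (Node n S)) := do
  let kept ← Timed.fold (fun acc e => do
    let ands ← Timed.filterList
      (fun b => Timed.allList (fun y => memNode y.1 st.2) b.2) e.2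
    if ands.isEmpty then Timed.ops 1 acc else Timed.ops 1 ((e.1, ands) :: acc)) [] lev.2
  let nodes ← Timed.mapList (fun e => Timed.ops 1 e.1) kept
  Timed.ops 1 ((lev.1, kept) :: st.1, nodes)

theorem evalTree_eq (T : List (Fin H × Level n S m) × List (Node n S)) :
    evalTree T = Timed.fold evalStep ([], T.2) T.1 := rfl

/-- The levels from time `k` on have been evaluated. -/
def Evaluated (k : ℕ) (st : List (Fin H × Level n S m) × List (Node n S)) : Prop :=
  AscLevels (F.KeptLevel fun t x a => (a, (F.successors t x a).val)) k st.1 ∧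
    st.2.Nodup ∧ ∀ x, x ∈ st.2 ↔ F.Reach k x ∧ F.Good k x

/-- Filtering leaves precisely the TRUE actions, and by `good_iff` none is left precisely at the
FALSE nodes, which are then discarded. Since the fold prepends its results, the nodes appear in
reverse order. -/
theorem evalStep_spec (t : Fin H) (level : Level n S m) (hl : F.TreeLevel t level)
    (st : List (Fin H × Level n S m) × List (Node n S)) (hst : F.Evaluated (t + 1) st) :
    F.Evaluated t (evalStep st (t, level)).val := by
  classical
  obtain ⟨nodes, hnd, hnodes, rfl⟩ := hl
  obtain ⟨hst1, -, hst2⟩ := hst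
  have hands : ∀ x ∈ nodes, (((jointActions m).filter fun a => F.WithinBudget t x a).map
      fun a => (a, (F.successors t x a).val)).filter
        (fun b => b.2.all fun y => decide (y.1 ∈ st.2)) =
      ((jointActions m).filter fun a => F.GoodAct t x a).map
        fun a => (a, (F.successors t x a).val) := by
    intro x hx
    rw [List.filter_map, List.filter_filter]
    congr 1
    refine List.filter_congr fun a _ => ?_
    simp only [F.goodAct_iff t x ((hnodes x).mp hx) a st.2 hst2, Function.comp_apply,
      Bool.decide_and, Bool.and_comm]
    congr 1
    rw [Bool.eq_iff_iff]
    simp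
  have hkept : (Timed.fold
      (fun acc (e : Node n S × List (JointAction m × List (Node n S × ℝ))) => do
      let ands ← Timed.filterList
        (fun b => Timed.allList (fun y => memNode y.1 st.2) b.2) e.2
      if ands.isEmpty then Timed.ops 1 acc else Timed.ops 1 ((e.1, ands) :: acc)) []
        (nodes.map fun x => (x, ((jointActions m).filter fun a => F.WithinBudget t x a).map
          fun a => (a, (F.successors t x a).val)))).val =
      ((nodes.filter fun x => decide (F.Good t x)).reverse).map fun x =>
        (x, ((jointActions m).filter fun a => F.GoodAct t x a).map
          fun a => (a, (F.successors t x a).val)) := by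
    simp only [Timed.val_fold, Timed.val_bind, Timed.val_filterList, Timed.val_allList,
      val_memNode, Timed.val_ite, Timed.val_ops]
    rw [foldl_keep (fun e : Node n S × List (JointAction m × List (Node n S × ℝ)) =>
      (e.2.filter fun b => b.2.all fun y => decide (y.1 ∈ st.2)).isEmpty = true)]
    rw [List.filter_map, List.map_map, List.map_reverse, List.append_nil]
    congr 1
    have : nodes.filter (fun x => decide (F.Good t x)) = nodes.filter
        ((fun e : Node n S × List (JointAction m × List (Node n S × ℝ)) =>
        decide ¬ (e.2.filter fun b => b.2.all fun y => decide (y.1 ∈ st.2)).isEmpty = true) ∘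
          fun x => (x, ((jointActions m).filter fun a => F.WithinBudget t x a).map
          fun a => (a, (F.successors t x a).val))) := by
      refine List.filter_congr fun x hx => ?_
      simp only [Function.comp_apply]
      rw [hands x hx]
      rw [decide_eq_decide, good_iff]
      simp [mem_jointActions]
    rw [this]
    refine List.map_congr_left fun x hx => ?_
    simp only [Function.comp_apply]
    rw [hands x (List.mem_filter.mp hx).1]
  constructor
  · refine .cons hst1 ⟨_, ?_, ?_, hkept⟩
    · exact List.nodup_reverse.mpr (hnd.filter _)
    · intro x
      simp [hnodes]
  · simp only [evalStep, Timed.val_bind, hkept, Timed.val_mapList, Timed.val_ops, List.map_map,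
      Function.comp_def, List.map_id']
    exact ⟨List.nodup_reverse.mpr (hnd.filter _), fun x => by simp [hnodes]⟩

theorem evaluated_fold {k : ℕ} {l : List (Fin H × Level n S m)}
    (hl : DescLevels F.TreeLevel k l) (st : List (Fin H × Level n S m) × List (Node n S))
    (hst : F.Evaluated k st) : F.Evaluated 0 (Timed.fold evalStep st l).val := by
  rw [Timed.val_fold]
  induction hl generalizing st with
  | nil => exact hst
  | cons h1 h2 ih => exact ih _ (F.evalStep_spec _ _ h2 _ hst)

theorem evalTree_spec : F.Evaluated 0 (evalTree F.feasibilityTree.val).val := by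
  obtain ⟨hT, hnd, hN⟩ := F.feasibilityTree_spec
  rw [evalTree_eq]
  refine F.evaluated_fold hT _ ⟨.nil, hnd, fun x => ?_⟩
  rw [hN, and_iff_left (F.good_horizon x)]

/-- If the feasibility algorithm fails, the root is not TRUE. -/
theorem feasibility_none (h : F.feasibility.val = none) : ¬ F.Good 0 (F.start, 0) := by
  intro hg
  have := (F.evalTree_spec.2.2 (F.start, 0)).mpr ⟨.start, hg⟩
  simp [feasibility, this] at h

/-- If the feasibility algorithm succeeds, the root is TRUE and the result lists the TRUE actions of
all TRUE nodes. -/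
theorem feasibility_some {R : List (Fin H × List (Node n S × List (JointAction m)))}
    (h : F.feasibility.val = some R) :
    F.Good 0 (F.start, 0) ∧ AscLevels (F.KeptLevel fun _ _ a => a) 0 R := by
  obtain ⟨hE, -, hroot⟩ := F.evalTree_spec
  simp only [feasibility, Timed.val_bind, val_memNode, decide_eq_true_eq, hroot, Timed.val_ite,
    Timed.val_mapList, Timed.val_ops] at h
  split_ifs at h with hg
  rw [val_memNode, decide_eq_true_eq, hroot] at hg
  refine ⟨hg.2, ?_⟩
  rw [Option.some_inj] at h
  subst h
  refine hE.map (fun t lev => lev.map fun e => (e.1, e.2.map fun b => b.1)) ?_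
  rintro t - _ ⟨nodes, hnd, hn, rfl⟩
  refine ⟨nodes, hnd, hn, ?_⟩
  simp [Function.comp_def]

end FiniteGame

end Algorithms

/-! ### Stage games and their linear programs -/

section Algorithms

variable {n S H : ℕ} {m : Fin n → ℕ}

theorem lookup_map_eq {α β γ : Type*} [BEq β] [LawfulBEq β] (l : List α) (f : α → β) (g : α → γ)
    (x : β) : (l.map fun a => (f a, g a)).lookup x = (l.find? fun a => f a == x).map g := by
  induction l with
  | nil => rfl
  | cons a l ih =>
    by_cases h : f a = x
    · simp [h]
    · have h1 : (x == f a) = false := by simpa using Ne.symm h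
      have h2 : (f a == x) = false := by simpa using h
      simp [List.lookup_cons, h1, h2, ih]

theorem lookup_map_of_injective {α β γ : Type*} [BEq β] [LawfulBEq β] (l : List α) (f : α → β)
    (hf : Function.Injective f) (g : α → γ) (a : α) (ha : a ∈ l) :
    (l.map fun a => (f a, g a)).lookup (f a) = some (g a) := by
  induction l with
  | nil => simp at ha
  | cons b l ih =>
    by_cases h : f a = f b
    · simp [hf h]
    · have h1 : (f a == f b) = false := by simpa using h
      rw [List.map_cons, List.lookup_cons, h1]
      exact ih ((List.mem_cons.mp ha).resolve_left fun h' => h (congrArg f h'))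

theorem lookup_map_eq_none {α β γ : Type*} [BEq β] [LawfulBEq β] (l : List α) (f : α → β)
    (g : α → γ) (x : β) (hx : ∀ a ∈ l, f a ≠ x) : (l.map fun a => (f a, g a)).lookup x = none := by
  rw [lookup_map_eq, Option.map_eq_none_iff, List.find?_eq_none]
  simpa using hx

theorem val_utility (i : Fin n) (a : JointAction m) (Q : List (JointAction m × (Fin n → ℝ))) :
    (utility i a Q).val = (Q.lookup a).elim ⊥ fun u => (u i : EReal) := by
  induction Q with
  | nil => rfl
  | cons y l ih =>
    obtain ⟨b, u⟩ := y
    by_cases h : a = b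
    · simp [utility, h]
    · have h' : (a == b) = false := by simpa using h
      simp [utility, List.lookup_cons, h, h', ih]

/-- A stage game on the joint actions listed in `Q`, without repetition and with utilities `q`. -/
structure IsStageGame (Q : List (JointAction m × (Fin n → ℝ))) (A : JointAction m → Prop)
    (q : JointAction m → Fin n → ℝ) : Prop where
  inj : Function.Injective fun v : Fin Q.length => Q[v].1
  mem : ∀ a, A a ↔ ∃ v : Fin Q.length, Q[v].1 = a
  util : ∀ v : Fin Q.length, Q[v].2 = q Q[v].1
  ne : 0 < Q.length

section Stage

variable {Q : List (JointAction m × (Fin n → ℝ))} {A : JointAction m → Prop}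
  {q : JointAction m → Fin n → ℝ}

theorem IsStageGame.utility_of_mem (hQ : IsStageGame Q A q) (i : Fin n) {a : JointAction m}
    (ha : A a) : (utility i a Q).val = (q a i : EReal) := by
  obtain ⟨v, rfl⟩ := (hQ.mem a).mp ha
  have hl : Q = (List.finRange Q.length).map fun v => (Q[v].1, Q[v].2) := by
    conv_lhs => rw [← List.ofFn_getElem (xs := Q), List.ofFn_eq_map]
    rfl
  have : Q.lookup Q[v].1 = some Q[v].2 := by
    refine (congrArg (List.lookup Q[v].1) hl).trans ?_
    exact lookup_map_of_injective _ (fun v : Fin Q.length => Q[v].1) hQ.inj _ v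
      (List.mem_finRange v)
  rw [val_utility, this, ← hQ.util]
  rfl

theorem IsStageGame.utility_of_not_mem (hQ : IsStageGame Q A q) (i : Fin n) {a : JointAction m}
    (ha : ¬ A a) : (utility i a Q).val = ⊥ := by
  have : Q.lookup a = none := by
    rw [List.lookup_eq_none_iff]
    intro y hy
    obtain ⟨v, hv, rfl⟩ := List.getElem_of_mem hy
    have := fun h => ha ((hQ.mem a).mpr ⟨⟨v, hv⟩, h⟩)
    simpa using Ne.symm this
  rw [val_utility, this]
  rfl

theorem IsStageGame.utilityLoss_of_mem (hQ : IsStageGame Q A q) (i : Fin n) (b : Fin (m i))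
    (v : Fin Q.length) (h : A (Function.update Q[v].1 i b)) :
    (utilityLoss Q i b v).val =
      ((q Q[v].1 i - q (Function.update Q[v].1 i b) i : ℝ) : EReal) := by
  simp only [utilityLoss, Timed.val_bind, Timed.val_ops]
  rw [hQ.utility_of_mem i ((hQ.mem _).mpr ⟨v, rfl⟩), hQ.utility_of_mem i h, EReal.coe_sub]

theorem IsStageGame.utilityLoss_of_not_mem (hQ : IsStageGame Q A q) (i : Fin n) (b : Fin (m i))
    (v : Fin Q.length) (h : ¬ A (Function.update Q[v].1 i b)) :
    (utilityLoss Q i b v).val = ⊤ := by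
  simp only [utilityLoss, Timed.val_bind, Timed.val_ops]
  rw [hQ.utility_of_mem i ((hQ.mem _).mpr ⟨v, rfl⟩), hQ.utility_of_not_mem i h, EReal.coe_sub_bot]

theorem IsStageGame.utilityLoss_ne_bot (hQ : IsStageGame Q A q) (i : Fin n) (b : Fin (m i))
    (v : Fin Q.length) : (utilityLoss Q i b v).val ≠ ⊥ := by
  by_cases h : A (Function.update Q[v].1 i b)
  · rw [hQ.utilityLoss_of_mem i b v h]
    exact EReal.coe_ne_bot _
  · rw [hQ.utilityLoss_of_not_mem i b v h]
    exact top_ne_bot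

/-- The coefficients of a deviation row of the correlated or the coarse correlated program; the
recommended action `none` stands for all recommendations. -/
def lossRow (Q : List (JointAction m × (Fin n → ℝ))) (i : Fin n) (b₀ : Option (Fin (m i)))
    (b : Fin (m i)) (v : Fin Q.length) : EReal :=
  if ∀ b₁ ∈ b₀, Q[v].1 i = b₁ then (utilityLoss Q i b v).val else 0

/-- The recommendations that the deviation rows of an equilibrium concept distinguish. -/
def EqConcept.Distinguishes {β : Type*} : EqConcept → Option β → Prop
  | .cce, b => b = none
  | .ce, b => b ≠ none

/-- Puts both equilibrium concepts into one format, so that the later arguments need not treat them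
separately. -/
theorem mem_deviationRows (c : EqConcept) (row : (Fin Q.length → EReal) × ℝ) :
    row ∈ (deviationRows Q c).val ↔ ∃ i, ∃ b₀ : Option (Fin (m i)), c.Distinguishes b₀ ∧ ∃ b,
      row = (lossRow Q i b₀ b, 0) := by
  cases c with
  | cce =>
    simp only [deviationRows, Timed.val_mapList, Timed.val_bind, Timed.val_tabulate,
      Timed.val_ops, List.mem_map, Finset.mem_toList, Finset.mem_univ, true_and,
      EqConcept.Distinguishes, exists_eq_left]
    constructor
    · rintro ⟨⟨i, b⟩, rfl⟩
      exact ⟨i, b, by simp [lossRow, funext_iff]⟩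
    · rintro ⟨i, b, rfl⟩
      exact ⟨⟨i, b⟩, by simp [lossRow, funext_iff]⟩
  | ce =>
    simp only [deviationRows, Timed.val_mapList, Timed.val_bind, Timed.val_tabulate,
      Timed.val_ops, List.mem_map, Finset.mem_toList, Finset.mem_univ, true_and,
      EqConcept.Distinguishes, Timed.val_ite]
    constructor
    · rintro ⟨⟨i, b₀, b⟩, rfl⟩
      exact ⟨i, some b₀, by simp, b, Prod.ext (funext fun v => by simp [lossRow]) rfl⟩
    · rintro ⟨i, b₀, h0, b, rfl⟩
      obtain ⟨b₀, rfl⟩ := Option.ne_none_iff_exists'.mp h0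
      exact ⟨⟨i, b₀, b⟩, Prod.ext (funext fun v => by simp [lossRow]) rfl⟩

theorem coe_sum_ereal {ι : Type*} (s : Finset ι) (f : ι → ℝ) :
    ((∑ v ∈ s, f v : ℝ) : EReal) = ∑ v ∈ s, (f v : EReal) := by
  classical
  induction s using Finset.induction_on with
  | empty => simp
  | insert a s ha ih => rw [Finset.sum_insert ha, Finset.sum_insert ha, EReal.coe_add, ih]

/-- A solution of the stage program is a probability vector that satisfies the deviation
inequalities. -/
theorem stageLP_isSolution_iff (c : EqConcept) (x : Fin Q.length → ℝ) :
    (stageLP c Q).val.IsSolution x ↔ (∀ v, 0 ≤ x v) ∧ ∑ v, x v = 1 ∧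
      ∀ i, ∀ b₀ : Option (Fin (m i)), c.Distinguishes b₀ → ∀ b,
        (0 : EReal) ≤ ∑ v, lossRow Q i b₀ b v * (x v : EReal) := by
  have h1 : ∀ r : ℝ, ((r : EReal) ≤ ∑ v, (fun _ => 1 : Fin Q.length → EReal) v * (x v : EReal)) ↔
      r ≤ ∑ v, x v := by
    intro r
    simp only [one_mul, ← coe_sum_ereal, EReal.coe_le_coe_iff]
  have h2 : ∀ r : ℝ, ((r : EReal) ≤ ∑ v, (fun _ => -1 : Fin Q.length → EReal) v * (x v : EReal)) ↔
      r ≤ - ∑ v, x v := by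
    intro r
    simp only [neg_mul, one_mul, ← EReal.coe_neg, ← coe_sum_ereal, EReal.coe_le_coe_iff,
      Finset.sum_neg_distrib]
  simp only [LinProg.IsSolution, stageLP, Timed.val_bind, Timed.val_ops, List.forall_mem_cons,
    mem_deviationRows]
  refine and_congr_right fun _ => ?_
  rw [h1, h2, ← and_assoc]
  refine and_congr ⟨fun h => by linarith, fun h => by constructor <;> linarith⟩ ?_
  constructor
  · intro h i b₀ hb b
    simpa using h _ ⟨i, b₀, hb, b, rfl⟩
  · rintro h _ ⟨i, b₀, hb, b, rfl⟩
    simpa using h i b₀ hb b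

/-- Replace `-∞` by a finite utility, common to all forbidden actions and below every `q a i`, and
apply `exists_correlated_equilibrium`. Its weights solve the program, because every coefficient of
the program is at least the corresponding finite loss. -/
theorem IsStageGame.exists_solution (hQ : IsStageGame Q A q) (c : EqConcept) :
    ∃ x, (stageLP c Q).val.IsSolution x := by
  classical
  let X : Finset (JointAction m) := Finset.univ.image fun v : Fin Q.length => Q[v].1
  have hX : X.Nonempty :=
    ⟨Q[(⟨0, hQ.ne⟩ : Fin Q.length)].1, Finset.mem_image_of_mem _ (Finset.mem_univ _)⟩
  have hXA : ∀ a, a ∈ X ↔ A a := fun a => by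
    rw [hQ.mem, Finset.mem_image]
    simp only [Finset.mem_univ, true_and]
  let cst : Fin n → ℝ := fun i => - ∑ a, |q a i|
  let u : JointAction m → Fin n → ℝ := fun a i => if a ∈ X then q a i else cst i
  have hu : ∀ a i, cst i ≤ u a i := by
    intro a i
    simp only [u]
    split_ifs
    · have := Finset.single_le_sum (f := fun a => |q a i|) (fun a _ => abs_nonneg _)
        (Finset.mem_univ a)
      have := neg_abs_le (q a i)
      simp only [cst]
      linarith
    · exact le_rfl
  obtain ⟨σ, h0, h1, hσ⟩ := exists_correlated_equilibrium X hX u cst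
    (fun a ha i => by simp [u, ha]) hu
  have hsum : ∀ f : JointAction m → ℝ, ∑ a ∈ X, f a = ∑ v : Fin Q.length, f Q[v].1 := fun f =>
    Finset.sum_image fun v _ w _ h => hQ.inj h
  refine ⟨fun v => σ Q[v].1, (stageLP_isSolution_iff c _).mpr
    ⟨fun v => h0 _ (Finset.mem_image_of_mem _ (Finset.mem_univ v)), by rw [← hsum, h1], ?_⟩⟩
  intro i b₀ _ b
  have hle : ∀ v : Fin Q.length, (((if ∀ b₁ ∈ b₀, Q[v].1 i = b₁ then
      u Q[v].1 i - u (Function.update Q[v].1 i b) i else 0) * σ Q[v].1 : ℝ) : EReal) ≤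
        lossRow Q i b₀ b v * (σ Q[v].1 : EReal) := by
    intro v
    have hv : Q[v].1 ∈ X := Finset.mem_image_of_mem _ (Finset.mem_univ v)
    rw [EReal.coe_mul]
    refine mul_le_mul_of_nonneg_right ?_ (EReal.coe_nonneg.mpr (h0 _ hv))
    simp only [lossRow]
    split_ifs with hb
    · by_cases hA : A (Function.update Q[v].1 i b)
      · rw [hQ.utilityLoss_of_mem i b v hA]
        simp only [u, hv, (hXA _).mpr hA, if_true]
        exact le_rfl
      · rw [hQ.utilityLoss_of_not_mem i b v hA]
        exact le_top
    · exact le_rfl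
  refine le_trans ?_ (Finset.sum_le_sum fun v _ => hle v)
  rw [← coe_sum_ereal, ← hsum (fun a => (if ∀ b₁ ∈ b₀, a i = b₁ then
      u a i - u (Function.update a i b) i else 0) * σ a)]
  refine EReal.coe_nonneg.mpr ?_
  cases b₀ with
  | some b₀ =>
    refine (hσ ⟨i, b₀, b⟩).trans_eq (Finset.sum_congr rfl fun a _ => ?_)
    simp [deviationLoss, mul_comm]
  | none =>
    -- A coarse deviation ignores the recommendation, so its row is the sum of the correlated rows
    -- over all recommendations.
    refine (Finset.sum_nonneg fun b₀ _ => hσ ⟨i, b₀, b⟩ : (0 : ℝ) ≤ ∑ b₀ : Fin (m i), _).trans_eq ?_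
    rw [Finset.sum_comm]
    refine Finset.sum_congr rfl fun a _ => ?_
    simp [deviationLoss, mul_comm]

/-- An equilibrium of a stage game whose allowed actions are those in `A`; deviations to actions
outside `A` are not considered if they have positive probability. -/
structure IsStageEquilibrium (c : EqConcept) (A : JointAction m → Prop)
    (q : JointAction m → Fin n → ℝ) (σ : JointAction m → ℝ) : Prop where
  nonneg : ∀ a, 0 ≤ σ a
  allowed : ∀ a, σ a ≠ 0 → A a
  sum_eq_one : ∑ a, σ a = 1
  stable : ∀ i, ∀ b₀ : Option (Fin (m i)), c.Distinguishes b₀ → ∀ b,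
    (∀ a, σ a ≠ 0 → (∀ b₁ ∈ b₀, a i = b₁) → A (Function.update a i b)) →
      0 ≤ ∑ a, if ∀ b₁ ∈ b₀, a i = b₁ then
        σ a * (q a i - q (Function.update a i b) i) else 0

/-- The weights of the allowed actions are extended by the lookup default zero; the condition on `f`
makes the additional terms vanish. -/
theorem IsStageGame.sum_extend (hQ : IsStageGame Q A q) (x : Fin Q.length → ℝ)
    (f : JointAction m → ℝ → ℝ) (hf : ∀ a, f a 0 = 0) :
    ∑ v, f Q[v].1 (x v) = ∑ a, f a ((((List.finRange Q.length).map
      fun v : Fin Q.length => (Q[v].1, x v)).lookup a).getD 0) := by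
  refine Fintype.sum_of_injective (fun v : Fin Q.length => Q[v].1) hQ.inj _ _ ?_ ?_
  · intro a ha
    rw [lookup_map_eq_none _ _ _ _ fun v _ h => ha ⟨v, h⟩]
    exact hf a
  · intro v
    rw [lookup_map_of_injective _ (fun v : Fin Q.length => Q[v].1) hQ.inj _ v
      (List.mem_finRange v)]
    rfl

/-- If a deviation stays in `A` on the support, infinite coefficients occur only at weight zero,
where `⊤ * 0 = 0` removes them. What remains of the row is a real inequality. -/
theorem IsStageGame.equilibrium_of_isSolution (hQ : IsStageGame Q A q) (c : EqConcept)
    (x : Fin Q.length → ℝ) (hx : (stageLP c Q).val.IsSolution x) :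
    IsStageEquilibrium c A q fun a => (((List.finRange Q.length).map
      fun v : Fin Q.length => (Q[v].1, x v)).lookup a).getD 0 := by
  obtain ⟨h0, h1, hrow⟩ := (stageLP_isSolution_iff c x).mp hx
  have hval : ∀ v : Fin Q.length, (((List.finRange Q.length).map
      fun v : Fin Q.length => (Q[v].1, x v)).lookup Q[v].1).getD 0 = x v := fun v => by
    rw [lookup_map_of_injective _ (fun v : Fin Q.length => Q[v].1) hQ.inj _ v
      (List.mem_finRange v)]
    rfl
  have hout : ∀ a, ¬ A a → (((List.finRange Q.length).map
      fun v : Fin Q.length => (Q[v].1, x v)).lookup a).getD 0 = 0 := fun a ha => by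
    rw [lookup_map_eq_none _ _ _ _ fun v _ h => ha ((hQ.mem a).mpr ⟨v, h⟩)]
    rfl
  refine ⟨fun a => ?_, fun a ha => ?_, ?_, fun i b₀ hb₀ b hA => ?_⟩
  · by_cases ha : A a
    · obtain ⟨v, rfl⟩ := (hQ.mem a).mp ha
      rw [hval]
      exact h0 v
    · rw [hout a ha]
  · by_contra hA
    exact ha (hout a hA)
  · rw [← hQ.sum_extend x (fun _ y => y) fun _ => rfl, h1]
  · rw [← hQ.sum_extend x (fun a y => if ∀ b₁ ∈ b₀, a i = b₁ then
        y * (q a i - q (Function.update a i b) i) else 0) fun a => by simp]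
    rw [← EReal.coe_nonneg, coe_sum_ereal]
    refine (hrow i b₀ hb₀ b).trans_eq (Finset.sum_congr rfl fun v _ => ?_)
    simp only [lossRow]
    split_ifs with hb
    · by_cases hxv : x v = 0
      · simp [hxv]
      · rw [hQ.utilityLoss_of_mem i b v (hA _ (by rw [hval]; exact hxv) hb), ← EReal.coe_mul,
          mul_comm]
    · simp

/-- The guarantee of the solver excludes the coefficient `⊥`. A recommended action is allowed and
has finite utility, so a loss is finite or `⊤`. -/
theorem IsStageGame.solver_solution (hQ : IsStageGame Q A q) (LP : LPSolver) (hLP : LP.Correct)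
    (c : EqConcept) : (stageLP c Q).val.IsSolution (LP.solve (stageLP c Q).val).val := by
  refine hLP _ ?_ (hQ.exists_solution c)
  simp only [stageLP, Timed.val_bind, Timed.val_ops, List.forall_mem_cons, mem_deviationRows]
  refine ⟨fun _ => EReal.coe_ne_bot 1, fun _ => ?_, ?_⟩
  · exact EReal.coe_ne_bot (-1)
  · rintro _ ⟨i, b₀, -, b, rfl⟩ v
    simp only [lossRow]
    split_ifs
    · exact hQ.utilityLoss_ne_bot i b v
    · exact EReal.zero_ne_bot

end Stage

end Algorithms

/-! ### Backward induction over the feasible nodes -/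

section Algorithms

variable {n S H : ℕ} {m : Fin n → ℕ}

/-- The stage game of one state of an action-constrained game, given the values of the next
states. -/
def stageUtilities (vals : List (Node n S × (Fin n → ℝ)))
    (acts : List (JointAction m × (Fin n → ℝ) × List (Node n S × ℝ))) :
    Timed (List (JointAction m × (Fin n → ℝ))) :=
  Timed.mapList (fun act => do
    let q ← Timed.tabulate fun i => do
      let z ← Timed.sumList (fun y => do
        let v ← lookupValue y.1 vals
        Timed.ops 2 (y.2 * v i)) act.2.2
      Timed.ops 2 (act.2.1 i + z)
    Timed.ops 1 (act.1, q)) acts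

/-- Solve the stage game of the state `x` by the linear program. -/
def solveStage (LP : LPSolver) (c : EqConcept) (x : Node n S)
    (Q : List (JointAction m × (Fin n → ℝ))) :
    Timed (Node n S × List (JointAction m × ℝ) × (Fin n → ℝ)) := do
  let L ← stageLP c Q
  let σ ← LP.solve L
  let dist ← Timed.mapList (fun v : Fin Q.length => Timed.ops 2 (Q[v].1, σ v))
    (List.finRange Q.length)
  let val ← Timed.tabulate fun i =>
    Timed.sumList (fun v : Fin Q.length => Timed.ops 3 (σ v * Q[v].2 i))
      (List.finRange Q.length)
  Timed.ops 1 (x, dist, val)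

/-- Build and solve the stage game of one state. -/
def solveEntry (LP : LPSolver) (c : EqConcept) (vals : List (Node n S × (Fin n → ℝ)))
    (e : Node n S × List (JointAction m × (Fin n → ℝ) × List (Node n S × ℝ))) :
    Timed (Node n S × List (JointAction m × ℝ) × (Fin n → ℝ)) := do
  let Q ← stageUtilities vals e.2
  solveStage LP c e.1 Q

/-- Solve the stage games of one time step. -/
def solveLevel (LP : LPSolver) (c : EqConcept)
    (st : PolicyTable n S m H × List (Node n S × (Fin n → ℝ)))
    (lev : Fin H × List (Node n S × List (JointAction m × (Fin n → ℝ) × List (Node n S × ℝ)))) :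
    Timed (PolicyTable n S m H × List (Node n S × (Fin n → ℝ))) := do
  let out ← Timed.mapList (solveEntry LP c st.2) lev.2
  let pol ← Timed.mapList (fun o => Timed.ops 2 (o.1, o.2.1)) out
  let vals ← Timed.mapList (fun o => Timed.ops 2 (o.1, o.2.2)) out
  Timed.ops 1 ((lev.1, pol) :: st.1, vals)

theorem constrainedSolver_eq (LP : LPSolver) (c : EqConcept) (M : ActionConstrainedMG n S m H) :
    constrainedSolver LP c M = (do
      let rev ← Timed.fold (fun acc lev => Timed.ops 1 (lev :: acc)) [] M
      let res ← Timed.fold (solveLevel LP c) ([], []) rev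
      Timed.ops 1 res.1) := rfl

theorem val_constrainedSolver (LP : LPSolver) (c : EqConcept) (M : ActionConstrainedMG n S m H) :
    (constrainedSolver LP c M).val =
      (M.foldr (fun lev st => (solveLevel LP c st lev).val) ([], [])).1 := by
  rw [constrainedSolver_eq]
  simp only [Timed.val_bind, Timed.val_fold, Timed.val_ops, List.foldl_flip_cons_eq_append,
    List.append_nil, List.map_id', List.foldl_reverse]

theorem isStageGame_map {l : List (JointAction m)} (hl : l.Nodup) {A : JointAction m → Prop}
    (hA : ∀ a, a ∈ l ↔ A a) (hne : l ≠ []) (q : JointAction m → Fin n → ℝ) :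
    IsStageGame (l.map fun a => (a, q a)) A q := by
  have hlt : ∀ v : Fin (l.map fun a => (a, q a)).length, v.val < l.length := fun v => by
    simpa using v.isLt
  constructor
  · intro v w h
    refine Fin.ext ((hl.getElem_inj_iff (hi := hlt v) (hj := hlt w)).mp ?_)
    simpa using h
  · intro a
    rw [← hA]
    constructor
    · intro ha
      obtain ⟨k, hk, he⟩ := List.getElem_of_mem ha
      exact ⟨⟨k, by simpa using hk⟩, by simpa using he⟩
    · rintro ⟨v, rfl⟩
      simp
  · intro v
    simp
  · simpa [List.length_pos_iff] using hne

/-- The weights that a list assigns to the joint actions. -/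
def listWeight (dist : List (JointAction m × ℝ)) (a : JointAction m) : ℝ :=
  (dist.lookup a).getD 0

namespace FiniteGame

variable (F : FiniteGame n S m H)

/-- The expected utility of a joint action, given the values of the next nodes. -/
def actionValue (t : Fin H) (x : Node n S) (W : Node n S → Fin n → ℝ) (a : JointAction m)
    (i : Fin n) : ℝ :=
  F.reward t x.1 a i + ((F.successors t x a).val.map fun y => y.2 * W y.1 i).sum

theorem isStageGame (t : Fin H) (x : Node n S) (hx : F.Good t x) [DecidablePred (F.GoodAct t x)]
    (q : JointAction m → Fin n → ℝ) :
    IsStageGame (((jointActions m).filter fun a => F.GoodAct t x a).map fun a => (a, q a))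
      (F.GoodAct t x) q := by
  refine isStageGame_map (nodup_jointActions.filter _) (fun a => ?_) ?_ q
  · simp [mem_jointActions]
  · obtain ⟨a, ha⟩ := (F.good_iff t x).mp hx
    exact List.ne_nil_of_mem (a := a) (by simpa [mem_jointActions] using ha)

/-- A table has finitely many entries and a failed lookup gives zero. The bound later makes node
values integrable. -/
theorem exists_bound_lookup (l : List (Node n S × (Fin n → ℝ))) :
    ∃ C, ∀ x i, |(l.lookup x).getD 0 i| ≤ C := by
  induction l with
  | nil => exact ⟨0, by simp⟩
  | cons y l ih =>
    obtain ⟨y, v⟩ := y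
    obtain ⟨C, hC⟩ := ih
    refine ⟨max C (∑ i, |v i|), fun x i => ?_⟩
    by_cases h : x = y
    · subst h
      refine le_trans ?_ (le_max_right _ _)
      simpa using Finset.single_le_sum (f := fun i => |v i|) (fun i _ => abs_nonneg _)
        (Finset.mem_univ i)
    · have h' : (x == y) = false := by simpa using h
      rw [List.lookup_cons, h']
      exact (hC x i).trans (le_max_left _ _)

/-- The policy `σ` at a TRUE node `x` is an equilibrium with value `v` of its stage game. -/
def SolvedNode (c : EqConcept) (t : Fin H) (x : Node n S) (W : Node n S → Fin n → ℝ)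
    (σ : JointAction m → ℝ) (v : Fin n → ℝ) : Prop :=
  IsStageEquilibrium c (F.GoodAct t x) (F.actionValue t x W) σ ∧
    ∀ i, v i = ∑ a, σ a * F.actionValue t x W a i

theorem stageUtilities_val (vals : List (Node n S × (Fin n → ℝ))) (t : Fin H) (x : Node n S)
    (l : List (JointAction m)) :
    (stageUtilities vals (l.map fun a => (a, F.reward t x.1 a, (F.successors t x a).val))).val =
      l.map fun a => (a, F.actionValue t x (fun y => (vals.lookup y).getD 0) a) := by
  simp only [stageUtilities, Timed.val_bind, Timed.val_mapList, Timed.val_tabulate, Timed.val_ops,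
    Timed.val_sumList, List.map_map, Function.comp_def, val_lookupValue]
  rfl

theorem solveStage_spec (LP : LPSolver) (hLP : LP.Correct) (c : EqConcept) (t : Fin H)
    (x : Node n S) (W : Node n S → Fin n → ℝ) (Q : List (JointAction m × (Fin n → ℝ)))
    (hQ : IsStageGame Q (F.GoodAct t x) (F.actionValue t x W)) :
    F.SolvedNode c t x W (listWeight (solveStage LP c x Q).val.2.1)
      (solveStage LP c x Q).val.2.2 := by
  have hsol := hQ.solver_solution LP hLP c
  simp only [solveStage, Timed.val_bind, Timed.val_mapList, Timed.val_tabulate, Timed.val_ops,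
    Timed.val_sumList]
  refine ⟨hQ.equilibrium_of_isSolution c _ hsol, fun i => ?_⟩
  refine Eq.trans ?_ (hQ.sum_extend (LP.solve (stageLP c Q).val).val
    (fun a y => y * F.actionValue t x W a i) fun a => zero_mul _)
  dsimp only
  rw [← List.ofFn_eq_map, List.sum_ofFn]
  exact Finset.sum_congr rfl fun v _ => congrArg _ (congrFun (hQ.util v) i)

theorem solveEntry_spec (LP : LPSolver) (hLP : LP.Correct) (c : EqConcept)
    (vals : List (Node n S × (Fin n → ℝ))) (t : Fin H) (x : Node n S) (hx : F.Good t x)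
    [DecidablePred (F.GoodAct t x)] :
    F.SolvedNode c t x (fun y => (vals.lookup y).getD 0)
      (listWeight (solveEntry LP c vals (x, ((jointActions m).filter fun a => F.GoodAct t x a).map
        fun a => (a, F.reward t x.1 a, (F.successors t x a).val))).val.2.1)
      (solveEntry LP c vals (x, ((jointActions m).filter fun a => F.GoodAct t x a).map
        fun a => (a, F.reward t x.1 a, (F.successors t x a).val))).val.2.2 := by
  simp only [solveEntry, Timed.val_bind, stageUtilities_val]
  exact F.solveStage_spec LP hLP c t x _ _ (F.isStageGame t x hx _)

/-- The policy at time `t` solves the stage games of all TRUE nodes for the values `V`. -/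
def SolvedLevel (c : EqConcept) (V : ℕ → Node n S → Fin n → ℝ) (t : Fin H)
    (pol : List (Node n S × List (JointAction m × ℝ))) : Prop :=
  ∀ x, F.Reach t x → F.Good t x →
    F.SolvedNode c t x (V (t + 1)) (listWeight ((pol.lookup x).getD [])) (V t x)

/-- The values `V` are read off from the tables that the algorithm builds: the new table replaces
`V` at time `t`. The levels already solved refer to `V` only after `t` and stay solved. -/
theorem solveLevel_spec (LP : LPSolver) (hLP : LP.Correct) (c : EqConcept) (t : Fin H)
    (lev : List (Node n S × List (JointAction m × (Fin n → ℝ) × List (Node n S × ℝ))))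
    (hlev : F.KeptLevel (fun t x a => (a, F.reward t x.1 a, (F.successors t x a).val)) t lev)
    (st : PolicyTable n S m H × List (Node n S × (Fin n → ℝ)))
    (hst : ∃ V : ℕ → Node n S → Fin n → ℝ, V H = 0 ∧
      (∀ t, ∃ C, ∀ x i, |V t x i| ≤ C) ∧ AscLevels (F.SolvedLevel c V) (t + 1) st.1 ∧
      V (t + 1) = fun y => (st.2.lookup y).getD 0) :
    ∃ V : ℕ → Node n S → Fin n → ℝ, V H = 0 ∧ (∀ t, ∃ C, ∀ x i, |V t x i| ≤ C) ∧
      AscLevels (F.SolvedLevel c V) t (solveLevel LP c st (t, lev)).val.1 ∧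
      V t = fun y => ((solveLevel LP c st (t, lev)).val.2.lookup y).getD 0 := by
  classical
  obtain ⟨V, hVH, hVb, hV, hVt⟩ := hst
  obtain ⟨nodes, -, hnodes, rfl⟩ := hlev
  simp only [solveLevel, Timed.val_bind, Timed.val_mapList, Timed.val_ops]
  set g := solveEntry LP c st.2 with hg
  set ent : Node n S → _ := fun x => (x, ((jointActions m).filter fun a => F.GoodAct t x a).map
        fun a => (a, F.reward t x.1 a, (F.successors t x a).val)) with hent
  simp only [List.map_map, Function.comp_def]
  have hkey : ∀ x, (g (ent x)).val.1 = x := fun x => rfl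
  simp only [hkey]
  refine ⟨Function.update V t fun y =>
      ((nodes.map fun x => (x, (g (ent x)).val.2.2)).lookup y).getD 0,
    ?_, fun t' => ?_, .cons (hV.mono ?_) ?_, ?_⟩
  · rw [Function.update_of_ne t.isLt.ne', hVH]
  · by_cases h : t' = t
    · rw [h, Function.update_self]
      exact exists_bound_lookup _
    · rw [Function.update_of_ne h]
      exact hVb t'
  · intro t' ht' pol hpol x hr hx
    rw [Function.update_of_ne (by omega), Function.update_of_ne (by omega)]
    exact hpol x hr hx
  · intro x hr hx
    have hxn : x ∈ nodes := (hnodes x).mpr ⟨hr, hx⟩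
    rw [Function.update_of_ne (by omega), Function.update_self,
      lookup_map_of_injective nodes (fun x => x) Function.injective_id _ x hxn,
      lookup_map_of_injective nodes (fun x => x) Function.injective_id _ x hxn, hVt]
    exact F.solveEntry_spec LP hLP c st.2 t x hx
  · rw [Function.update_self]

theorem constrainedSolver_spec (LP : LPSolver) (hLP : LP.Correct) (c : EqConcept)
    (M : ActionConstrainedMG n S m H)
    (hM : AscLevels (F.KeptLevel fun t x a =>
      (a, F.reward t x.1 a, (F.successors t x a).val)) 0 M) :
    ∃ V : ℕ → Node n S → Fin n → ℝ, V H = 0 ∧ (∀ t, ∃ C, ∀ x i, |V t x i| ≤ C) ∧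
      AscLevels (F.SolvedLevel c V) 0 (constrainedSolver LP c M).val := by
  rw [val_constrainedSolver]
  suffices ∀ k, AscLevels (F.KeptLevel fun t x a =>
      (a, F.reward t x.1 a, (F.successors t x a).val)) k M →
      ∃ V : ℕ → Node n S → Fin n → ℝ, V H = 0 ∧ (∀ t, ∃ C, ∀ x i, |V t x i| ≤ C) ∧
      AscLevels (F.SolvedLevel c V) k
        (M.foldr (fun lev st => (solveLevel LP c st lev).val) ([], [])).1 ∧
      V k = fun y =>
        ((M.foldr (fun lev st => (solveLevel LP c st lev).val) ([], [])).2.lookup y).getD 0 by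
    obtain ⟨V, h1, hb, h2, -⟩ := this 0 hM
    exact ⟨V, h1, hb, h2⟩
  intro k hk
  clear hM
  induction hk with
  -- At the horizon the table is empty, and the default of a failed lookup is the terminal value
  -- zero.
  | nil => exact ⟨0, rfl, fun t => ⟨0, by simp⟩, .nil, by funext y; simp⟩
  | cons h1 h2 ih => exact F.solveLevel_spec LP hLP c _ _ h2 _ ih

theorem reducedGame_spec {R : List (Fin H × List (Node n S × List (JointAction m)))}
    (hR : AscLevels (F.KeptLevel fun _ _ a => a) 0 R) :
    AscLevels (F.KeptLevel fun t x a => (a, F.reward t x.1 a, (F.successors t x a).val)) 0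
      (F.reducedGame R).val := by
  simp only [reducedGame, Timed.val_bind, Timed.val_mapList, Timed.val_ops]
  refine hR.map (fun t lev => lev.map fun e => (e.1, e.2.map fun a =>
    (a, F.reward t e.1.1 a, (F.successors t e.1 a).val))) ?_
  rintro t - _ ⟨nodes, hnd, hn, rfl⟩
  refine ⟨nodes, hnd, hn, ?_⟩
  simp [Function.comp_def]

theorem reduction_none (LP : LPSolver) (c : EqConcept) (h : (F.reduction LP c).val = none) :
    ¬ F.Good 0 (F.start, 0) := by
  refine F.feasibility_none ?_
  unfold reduction at h
  rw [Timed.val_bind] at h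
  cases hf : F.feasibility.val with
  | none => rfl
  | some R =>
    rw [hf] at h
    simp at h

theorem reduction_some (LP : LPSolver) (hLP : LP.Correct) (c : EqConcept)
    {T : PolicyTable n S m H} (h : (F.reduction LP c).val = some T) :
    F.Good 0 (F.start, 0) ∧ ∃ V : ℕ → Node n S → Fin n → ℝ, V H = 0 ∧
      (∀ t, ∃ C, ∀ x i, |V t x i| ≤ C) ∧
      AscLevels (F.SolvedLevel c V) 0 T := by
  unfold reduction at h
  rw [Timed.val_bind] at h
  cases hf : F.feasibility.val with
  | none =>
    rw [hf] at h
    simp at h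
  | some R =>
    rw [hf] at h
    simp only [Timed.val_bind, Timed.val_ops, Option.some_inj] at h
    subst h
    obtain ⟨h1, h2⟩ := F.feasibility_some hf
    exact ⟨h1, F.constrainedSolver_spec LP hLP c _ (F.reducedGame_spec h2)⟩

end FiniteGame

end Algorithms

namespace MarkovGame

variable {n : ℕ} {G : MarkovGame n}

/-! ## Laws of histories -/

/-- Extend a history by one step. -/
def extend {k : ℕ} (ω : G.Hist k) (p : G.Action × (Fin n → ℝ) × G.State) : G.Hist (k + 1) :=
  Fin.snoc ω p

/-- The first `j` steps of a history. -/
def prefixOf {j k : ℕ} (h : j ≤ k) (ω : G.Hist k) : G.Hist j := fun x => ω (x.castLE h)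

@[simp] theorem extend_last {k : ℕ} (ω : G.Hist k) (p : G.Action × (Fin n → ℝ) × G.State) :
    extend ω p (Fin.last k) = p := by simp [extend]

@[simp] theorem extend_castSucc {k : ℕ} (ω : G.Hist k) (p : G.Action × (Fin n → ℝ) × G.State)
    (x : Fin k) : extend ω p x.castSucc = ω x := by simp [extend]

@[simp] theorem prefixOf_extend {k : ℕ} (ω : G.Hist k)
    (p : G.Action × (Fin n → ℝ) × G.State) : prefixOf (Nat.le_succ k) (extend ω p) = ω := by
  funext x
  exact extend_castSucc ω p x

@[simp] theorem lastState_extend {k : ℕ} (ω : G.Hist k)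
    (p : G.Action × (Fin n → ℝ) × G.State) : lastState (extend ω p) = p.2.2 := by
  have : (extend ω p) ⟨k, Nat.lt_succ_self k⟩ = p := extend_last ω p
  simp only [lastState, stateAt, this]

theorem stateAt_prefixOf {j k : ℕ} (h : j ≤ k) (ω : G.Hist k) (x : ℕ) (hx : x ≤ j) :
    stateAt (prefixOf h ω) x hx = stateAt ω x (hx.trans h) := by
  cases x <;> rfl

theorem measurable_extend {k : ℕ} : Measurable fun p : G.Hist k ×
    (G.Action × (Fin n → ℝ) × G.State) => extend p.1 p.2 := by
  refine measurable_pi_lambda _ fun x => ?_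
  refine Fin.lastCases ?_ (fun x => ?_) x
  · simpa using measurable_snd
  · simp only [extend_castSucc]
    exact (measurable_pi_apply x).comp measurable_fst

theorem measurable_prefixOf {j k : ℕ} (h : j ≤ k) :
    Measurable fun ω : G.Hist k => prefixOf h ω :=
  measurable_pi_lambda _ fun _ => measurable_pi_apply _

instance (t : ℕ) : IsMarkovKernel (G.env t) := by
  have : IsMarkovKernel (Kernel.ofFunOfCountable fun sa : G.State × G.Action =>
      (G.cost t sa.1 sa.2).prod (G.trans t sa.1 sa.2).toMeasure) :=
    ⟨fun sa => by
      have := PMF.toMeasure.isProbabilityMeasure (G.trans t sa.1 sa.2)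
      change IsProbabilityMeasure ((G.cost t sa.1 sa.2).prod (G.trans t sa.1 sa.2).toMeasure)
      infer_instance⟩
  unfold env
  infer_instance

theorem env_apply (t : ℕ) (ω : G.Hist t) (a : G.Action) : G.env t (ω, a) =
    (G.cost t (lastState ω) a).prod (G.trans t (lastState ω) a).toMeasure := rfl

namespace Policy

variable (π : G.Policy)

theorem lawGiven_succ_of_le {t : ℕ} (τ : G.Hist t) {k : ℕ} (h : t ≤ k) :
    π.lawGiven τ (k + 1) = ((π.lawGiven τ k).compProd ((π.act k).compProd (G.env k))).map
      fun p => extend p.1 p.2 := by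
  rw [lawGiven, dif_neg (by omega)]
  rfl

theorem lawGiven_of_le {t : ℕ} (τ : G.Hist t) {k : ℕ} (h : k ≤ t) :
    π.lawGiven τ k = Measure.dirac (prefixOf h τ) := by
  cases k with
  | zero =>
    rw [lawGiven]
    congr 1
    exact Subsingleton.elim _ _
  | succ k =>
    rw [lawGiven, dif_pos h]
    rfl

theorem lawGiven_self {t : ℕ} (τ : G.Hist t) : π.lawGiven τ t = Measure.dirac τ :=
  π.lawGiven_of_le τ le_rfl

instance isProbabilityMeasure_lawGiven {t : ℕ} (τ : G.Hist t) (k : ℕ) :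
    IsProbabilityMeasure (π.lawGiven τ k) := by
  induction k with
  | zero => rw [π.lawGiven_of_le τ (Nat.zero_le t)]; infer_instance
  | succ k ih =>
    by_cases h : k + 1 ≤ t
    · rw [π.lawGiven_of_le τ h]; infer_instance
    · rw [π.lawGiven_succ_of_le τ (by omega)]
      exact Measure.isProbabilityMeasure_map measurable_extend.aemeasurable

theorem ae_lawGiven_succ {t : ℕ} (τ : G.Hist t) {k : ℕ} (h : t ≤ k) {P : G.Hist (k + 1) → Prop}
    (hP : MeasurableSet {ω | P ω}) : (∀ᵐ ω ∂(π.lawGiven τ (k + 1)), P ω) ↔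
      ∀ᵐ ω ∂(π.lawGiven τ k), ∀ᵐ a ∂(π.act k ω), ∀ᵐ p ∂(G.env k (ω, a)), P (extend ω (a, p)) := by
  rw [π.lawGiven_succ_of_le τ h, ae_map_iff measurable_extend.aemeasurable hP,
    Measure.ae_compProd_iff (p := fun x => P (extend x.1 x.2)) (measurable_extend hP)]
  refine Filter.eventually_congr (Filter.Eventually.of_forall fun ω => ?_)
  rw [Kernel.ae_compProd_iff]
  exact (measurable_extend.comp (measurable_const.prodMk measurable_id)) hP

/-- Forgetting the last step takes the first marginal of a composition product, or shortens a point
mass while the conditioning history lasts. Iterate. -/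
theorem map_prefixOf_lawGiven {t : ℕ} (τ : G.Hist t) {j k : ℕ} (h : j ≤ k) :
    (π.lawGiven τ k).map (prefixOf h) = π.lawGiven τ j := by
  induction k, h using Nat.le_induction with
  | base => exact Measure.map_id
  | succ k h ih =>
    have hstep : (π.lawGiven τ (k + 1)).map (prefixOf (Nat.le_succ k)) = π.lawGiven τ k := by
      by_cases hk : k + 1 ≤ t
      · rw [π.lawGiven_of_le τ hk, π.lawGiven_of_le τ (by omega : k ≤ t),
          Measure.map_dirac' (measurable_prefixOf _)]
        rfl
      · rw [π.lawGiven_succ_of_le τ (by omega),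
          Measure.map_map (measurable_prefixOf _) measurable_extend]
        have : (prefixOf (Nat.le_succ k) ∘ fun p : G.Hist k × _ => extend p.1 p.2) = Prod.fst := by
          funext p
          exact prefixOf_extend p.1 p.2
        rw [this]
        exact Measure.fst_compProd _ _
    rw [← ih, ← hstep, Measure.map_map (measurable_prefixOf _) (measurable_prefixOf _)]
    rfl

theorem ae_prefixOf {t : ℕ} (τ : G.Hist t) {j k : ℕ} (h : j ≤ k) {P : G.Hist j → Prop}
    (hP : MeasurableSet {ω | P ω}) : (∀ᵐ ω ∂(π.lawGiven τ k), P (prefixOf h ω)) ↔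
      ∀ᵐ ω ∂(π.lawGiven τ j), P ω := by
  rw [← π.map_prefixOf_lawGiven τ h, ae_map_iff (measurable_prefixOf h).aemeasurable hP]

theorem integral_prefixOf {t : ℕ} (τ : G.Hist t) {j k : ℕ} (h : j ≤ k) {f : G.Hist j → ℝ}
    (hf : Measurable f) : ∫ ω, f (prefixOf h ω) ∂(π.lawGiven τ k) =
      ∫ ω, f ω ∂(π.lawGiven τ j) := by
  rw [← π.map_prefixOf_lawGiven τ h, integral_map (measurable_prefixOf h).aemeasurable
    hf.aestronglyMeasurable]

theorem _root_.MeasureTheory.integrable_of_bounded {α : Type*} [MeasurableSpace α] {μ : Measure α}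
    [IsFiniteMeasure μ] {f : α → ℝ} (hf : Measurable f) {C : ℝ} (hC : ∀ x, |f x| ≤ C) :
    Integrable f μ :=
  Integrable.of_bound hf.aestronglyMeasurable C (Filter.Eventually.of_forall hC)

theorem integral_lawGiven_succ {t : ℕ} (τ : G.Hist t) {k : ℕ} (h : t ≤ k)
    {f : G.Hist (k + 1) → ℝ} (hf : Measurable f) {C : ℝ} (hC : ∀ ω, |f ω| ≤ C) :
    ∫ ω, f ω ∂(π.lawGiven τ (k + 1)) =
      ∫ ω, (∑ a, (π.act k ω).real {a} * ∫ p, f (extend ω (a, p)) ∂(G.env k (ω, a)))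
        ∂(π.lawGiven τ k) := by
  rw [π.lawGiven_succ_of_le τ h, integral_map measurable_extend.aemeasurable
    hf.aestronglyMeasurable, Measure.integral_compProd (f := fun x => f (extend x.1 x.2))
      (integrable_of_bounded (hf.comp measurable_extend) fun _ => hC _)]
  refine integral_congr_ae (Filter.Eventually.of_forall fun ω => ?_)
  have hm : Measurable fun p : G.Action × (Fin n → ℝ) × G.State => f (extend ω p) :=
    hf.comp (measurable_extend.comp (measurable_const.prodMk measurable_id))
  dsimp only
  rw [ProbabilityTheory.integral_compProd (integrable_of_bounded hm fun _ => hC _)]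
  rw [integral_fintype Integrable.of_finite]
  rfl

theorem law_eq (k : ℕ) : π.law k = π.lawGiven (t := 0) (fun x => x.elim0) k := rfl

theorem feasible_iff (b : Fin n → ℝ) :
    π.Feasible b ↔ π.FeasibleGiven b (t := 0) (fun x => x.elim0) := Iff.rfl

end Policy

/-- The cost of player `i` accumulated in a history. -/
def totalCost {k : ℕ} (ω : G.Hist k) (i : Fin n) : ℝ := ∑ x, (ω x).2.1 i

theorem measurable_cost {k : ℕ} (x : Fin k) (i : Fin n) :
    Measurable fun ω : G.Hist k => (ω x).2.1 i :=
  (measurable_pi_apply i).comp ((measurable_fst.comp measurable_snd).comp (measurable_pi_apply x))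

theorem measurable_totalCost {k : ℕ} (i : Fin n) :
    Measurable fun ω : G.Hist k => totalCost ω i :=
  Finset.measurable_sum _ fun x _ => measurable_cost x i

theorem cumCost_eq {j k : ℕ} (h : j ≤ k) (ω : G.Hist k) (i : Fin n) :
    cumCost ω j i = totalCost (prefixOf h ω) i := by
  rw [cumCost, totalCost, ← Finset.sum_filter]
  symm
  refine Finset.sum_bij (fun x _ => x.castLE h) (fun x _ => by simp) (fun x _ y _ h => ?_)
    (fun y hy => ?_) (fun x _ => rfl)
  · simpa using h
  · exact ⟨⟨y, by simpa using hy⟩, by simp, by simp⟩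

/-- The cost up to time `j` depends only on the first `j` steps, so every time can be tested under
its own marginal law. This is the form in which inductions on time use feasibility. -/
theorem Policy.feasibleGiven_iff (π : G.Policy) (b : Fin n → ℝ) {t : ℕ} (τ : G.Hist t) :
    π.FeasibleGiven b τ ↔ ∀ j, 1 ≤ j → j ≤ G.horizon →
      ∀ᵐ ω ∂(π.lawGiven τ j), ∀ i, totalCost ω i ≤ b i := by
  rw [Policy.FeasibleGiven, ae_all_iff]
  refine forall_congr' fun j => ?_
  by_cases h1 : 1 ≤ j
  · by_cases h2 : j ≤ G.horizon
    · have hm : MeasurableSet {ω : G.Hist j | ∀ i, totalCost ω i ≤ b i} := by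
        rw [Set.ofPred_forall]
        exact MeasurableSet.iInter fun i =>
          measurableSet_le (measurable_totalCost i) measurable_const
      rw [← π.ae_prefixOf τ h2 hm]
      simp [h1, h2, cumCost_eq h2]
    · simp [h2]
  · simp [h1]

end MarkovGame

namespace MarkovGame

variable {n : ℕ} (G : MarkovGame n) (ℓ : Fin n → ℝ)

/-! ## The approximate game -/

/-- The approximate game, without the construction steps. -/
def approx : FiniteGame n G.numStates G.numActions G.horizon := (G.approxGame ℓ).val

/-- The rounded cost vectors, in multiples of the rounding units. -/
def costBox : Finset (Fin n → ℤ) :=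
  Fintype.piFinset fun i => Finset.Icc (G.loIdx ℓ i) (G.hiIdx ℓ i)

/-- The probability of a rounded cost vector. -/
def boxProb (t : ℕ) (s : G.State) (a : G.Action) (k : Fin n → ℤ) : ℝ :=
  ∏ i, G.cellProb ℓ t s a i (k i)

theorem approx_trans (t : Fin G.horizon) (s : G.State) (a : G.Action) (s' : G.State) :
    (G.approx ℓ).trans t s a s' = (G.trans t s a s').toReal := rfl

theorem approx_costs (t : Fin G.horizon) (s : G.State) (a : G.Action) :
    (G.approx ℓ).costs t s a =
      (((G.costBox ℓ).toList.filter fun k => ¬ ¬ 0 < G.boxProb ℓ t s a k).map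
        fun k => (fun i => (k i : ℝ) * ℓ i, G.boxProb ℓ t s a k)).reverse := by
  have : (G.approx ℓ).costs t s a = (G.costBox ℓ).toList.foldl
      (fun acc k => if ¬ 0 < G.boxProb ℓ t s a k then acc else
        (fun i => (k i : ℝ) * ℓ i, G.boxProb ℓ t s a k) :: acc) [] := by
    simp only [approx, approxGame, Timed.val_bind, Timed.val_tabulate, Timed.val_ops,
      Timed.val_fold, ite_not]
    refine congrArg (fun f => List.foldl f [] _) (funext₂ fun b k => ?_)
    by_cases h : 0 < G.boxProb ℓ t s a k
    · rw [if_pos h]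
      exact congrArg Timed.val (if_pos h)
    · rw [if_neg h]
      exact congrArg Timed.val (if_neg h)
  rw [this, foldl_keep (fun k => ¬ 0 < G.boxProb ℓ t s a k), List.append_nil]

theorem mem_approx_costs (t : Fin G.horizon) (s : G.State) (a : G.Action)
    (c : (Fin n → ℝ) × ℝ) : c ∈ (G.approx ℓ).costs t s a ↔
      ∃ k ∈ G.costBox ℓ, 0 < G.boxProb ℓ t s a k ∧
        c = (fun i => (k i : ℝ) * ℓ i, G.boxProb ℓ t s a k) := by
  rw [approx_costs]
  simp only [List.mem_reverse, List.mem_map, List.mem_filter, Finset.mem_toList, not_not,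
    decide_eq_true_eq, and_assoc, eq_comm (a := c)]

theorem sum_approx_costs (t : Fin G.horizon) (s : G.State) (a : G.Action)
    (h0 : ∀ k ∈ G.costBox ℓ, 0 ≤ G.boxProb ℓ t s a k) (f : (Fin n → ℝ) → ℝ) :
    (((G.approx ℓ).costs t s a).map fun c => c.2 * f c.1).sum =
      ∑ k ∈ G.costBox ℓ, G.boxProb ℓ t s a k * f fun i => (k i : ℝ) * ℓ i := by
  rw [approx_costs, List.map_reverse, List.sum_reverse, List.map_map, ← Finset.sum_map_toList]
  simp only [← Finset.mem_toList] at h0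
  generalize (G.costBox ℓ).toList = l at h0
  induction l with
  | nil => simp
  | cons k l ih =>
    replace ih := ih fun k hk => h0 k (List.mem_cons_of_mem _ hk)
    by_cases h : 0 < G.boxProb ℓ t s a k
    · simp only [not_not] at ih
      simp [h, ih]
    · have h' : G.boxProb ℓ t s a k = 0 := le_antisymm (not_lt.mp h) (h0 k List.mem_cons_self)
      simp only [not_not] at ih
      simp [h', ih]

/-- Componentwise rounding of a cost vector. -/
def roundVec (c : Fin n → ℝ) : Fin n → ℤ := fun i => G.roundIdx ℓ i (c i)

theorem measurable_roundIdx (i : Fin n) : Measurable (G.roundIdx ℓ i) :=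
  measurable_const.max (measurable_id.div_const _).floor

theorem measurable_roundVec : Measurable (G.roundVec ℓ) :=
  measurable_pi_lambda _ fun i => (G.measurable_roundIdx ℓ i).comp (measurable_pi_apply i)

variable {G ℓ}

/-- The support of a measure on the line has full measure, and boundedness makes the supremum of the
supported costs an upper bound. -/
theorem Standing.cost_le (hG : G.Standing) {t : ℕ} (ht : t < G.horizon) (s : G.State)
    (a : G.Action) : ∀ᵐ c ∂(G.cost t s a), ∀ i, c i ≤ G.maxCost i := by
  refine ae_all_iff.mpr fun i => ?_
  have h : ∀ᵐ x ∂((G.cost t s a).map fun c => c i), x ≤ G.maxCost i := by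
    filter_upwards [Measure.support_mem_ae (μ := (G.cost t s a).map fun c => c i)] with x hx
    exact le_csSup (hG.bounded i) ⟨t, ht, s, a, hx⟩
  exact (ae_map_iff (measurable_pi_apply i).aemeasurable measurableSet_Iic).mp h

theorem Standing.loIdx_neg (hG : G.Standing) (hℓ : ∀ i, 0 < ℓ i) (i : Fin n) :
    G.loIdx ℓ i < 0 := by
  rw [loIdx, Int.floor_lt, Int.cast_zero]
  exact div_neg_of_neg_of_pos (by linarith [hG.budget_lt i]) (hℓ i)

theorem Standing.hiIdx_nonneg (hG : G.Standing) (hℓ : ∀ i, 0 < ℓ i) (i : Fin n) :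
    0 ≤ G.hiIdx ℓ i :=
  Int.floor_nonneg.mpr (div_nonneg (hG.maxCost_pos i).le (hℓ i).le)

theorem roundIdx_le_hiIdx (hG : G.Standing) (hℓ : ∀ i, 0 < ℓ i) (i : Fin n) {x : ℝ}
    (hx : x ≤ G.maxCost i) : G.roundIdx ℓ i x ≤ G.hiIdx ℓ i :=
  max_le ((hG.loIdx_neg hℓ i).le.trans (hG.hiIdx_nonneg hℓ i))
    (Int.floor_le_floor (div_le_div_of_nonneg_right hx (hℓ i).le))

theorem roundIdx_eq_iff (hℓ : ∀ i, 0 < ℓ i) (i : Fin n) (x : ℝ) {k : ℤ} (hk : G.loIdx ℓ i < k) :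
    G.roundIdx ℓ i x = k ↔ k * ℓ i ≤ x ∧ x < (k + 1) * ℓ i := by
  have h : G.roundIdx ℓ i x = k ↔ ⌊x / ℓ i⌋ = k := by
    rw [roundIdx]
    omega
  rw [h, Int.floor_eq_iff, le_div_iff₀ (hℓ i), div_lt_iff₀ (hℓ i)]

theorem roundIdx_eq_loIdx_iff (hℓ : ∀ i, 0 < ℓ i) (i : Fin n) (x : ℝ) :
    G.roundIdx ℓ i x = G.loIdx ℓ i ↔ x < (G.loIdx ℓ i + 1) * ℓ i := by
  rw [roundIdx, max_eq_left_iff, ← Int.lt_add_one_iff, Int.floor_lt, div_lt_iff₀ (hℓ i)]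
  push_cast
  rfl

/-- Cells are half-open intervals `[k ℓ, (k + 1) ℓ)`, measured by a difference of values of the
strict distribution function. The lowest cell also absorbs everything below it, so nothing is
subtracted there. -/
theorem cellProb_eq (hℓ : ∀ i, 0 < ℓ i) (t : ℕ) (s : G.State) (a : G.Action) (i : Fin n) {k : ℤ}
    (hk : G.loIdx ℓ i ≤ k) :
    G.cellProb ℓ t s a i k = (G.cost t s a).real {c | G.roundIdx ℓ i (c i) = k} := by
  unfold cellProb
  split_ifs with h
  · subst h
    simp only [roundIdx_eq_loIdx_iff hℓ]
    rfl
  · have hlt : G.loIdx ℓ i < k := lt_of_le_of_ne hk (Ne.symm h)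
    have hset : {c : Fin n → ℝ | G.roundIdx ℓ i (c i) = k} =
        {c : Fin n → ℝ | c i < (k + 1) * ℓ i} \ {c : Fin n → ℝ | c i < k * ℓ i} := by
      ext c
      rw [Set.mem_sdiff]
      simp only [Set.mem_ofPred_eq, roundIdx_eq_iff hℓ i _ hlt, not_lt, and_comm]
    rw [hset, measureReal_sdiff]
    · rfl
    · intro c hc
      have hc' : c i < k * ℓ i := hc
      have := hℓ i
      change c i < (k + 1) * ℓ i
      linarith
    · exact measurableSet_lt (measurable_pi_apply i) measurable_const

/-- The product assumption enters here: rounding acts coordinatewise, so it maps a product law to a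
product law. -/
theorem cost_roundVec_singleton (hG : G.Standing) (hℓ : ∀ i, 0 < ℓ i) {t : ℕ}
    (ht : t < G.horizon) (s : G.State) (a : G.Action) {k : Fin n → ℤ} (hk : k ∈ G.costBox ℓ) :
    ((G.cost t s a).map (G.roundVec ℓ)).real {k} = G.boxProb ℓ t s a k := by
  rw [costBox, Fintype.mem_piFinset] at hk
  have hmarg : ∀ i, IsProbabilityMeasure ((G.cost t s a).map fun c => c i) := fun i =>
    Measure.isProbabilityMeasure_map (measurable_pi_apply i).aemeasurable
  have h1 : (G.cost t s a).map (G.roundVec ℓ) =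
      Measure.pi fun i => ((G.cost t s a).map fun c => c i).map (G.roundIdx ℓ i) := by
    conv_lhs => rw [hG.product t ht s a]
    exact Measure.pi_map_pi fun i => (G.measurable_roundIdx ℓ i).aemeasurable
  rw [h1, measureReal_def, Measure.pi_singleton, ENNReal.toReal_prod, boxProb]
  refine Finset.prod_congr rfl fun i _ => ?_
  rw [cellProb_eq hℓ t s a i (Finset.mem_Icc.mp (hk i)).1, Measure.map_map
    (G.measurable_roundIdx ℓ i) (measurable_pi_apply i), Measure.map_apply
    ((G.measurable_roundIdx ℓ i).comp (measurable_pi_apply i)) (measurableSet_singleton _)]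
  rfl

theorem roundVec_mem_costBox (hG : G.Standing) (hℓ : ∀ i, 0 < ℓ i) {t : ℕ}
    (ht : t < G.horizon) (s : G.State) (a : G.Action) :
    ∀ᵐ c ∂(G.cost t s a), G.roundVec ℓ c ∈ G.costBox ℓ := by
  filter_upwards [hG.cost_le ht s a] with c hc
  rw [costBox, Fintype.mem_piFinset]
  exact fun i => Finset.mem_Icc.mpr ⟨le_max_left _ _, roundIdx_le_hiIdx hG hℓ i (hc i)⟩

/-- The law of the rounded cost and the next state. -/
def roundedEnv (G : MarkovGame n) (ℓ : Fin n → ℝ) (t : ℕ) (s : G.State) (a : G.Action) :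
    Measure ((Fin n → ℤ) × G.State) :=
  ((G.cost t s a).map (G.roundVec ℓ)).prod (G.trans t s a).toMeasure

instance (t : ℕ) (s : G.State) (a : G.Action) : IsProbabilityMeasure (G.roundedEnv ℓ t s a) := by
  have := PMF.toMeasure.isProbabilityMeasure (G.trans t s a)
  have : IsProbabilityMeasure ((G.cost t s a).map (G.roundVec ℓ)) :=
    Measure.isProbabilityMeasure_map (G.measurable_roundVec ℓ).aemeasurable
  unfold roundedEnv
  infer_instance

theorem measurable_round_prod : Measurable fun p : (Fin n → ℝ) × G.State =>
    (G.roundVec ℓ p.1, p.2) :=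
  ((G.measurable_roundVec ℓ).comp measurable_fst).prodMk measurable_snd

theorem map_env (t : ℕ) (ω : G.Hist t) (a : G.Action) :
    (G.env t (ω, a)).map (fun p => (G.roundVec ℓ p.1, p.2)) =
      G.roundedEnv ℓ t (lastState ω) a := by
  have := PMF.toMeasure.isProbabilityMeasure (G.trans t (lastState ω) a)
  rw [env_apply, roundedEnv]
  have := Measure.map_prod_map (G.cost t (lastState ω) a) (G.trans t (lastState ω) a).toMeasure
    (G.measurable_roundVec ℓ) (measurable_id)
  rw [Measure.map_id] at this
  exact this.symm

theorem roundedEnv_singleton (hG : G.Standing) (hℓ : ∀ i, 0 < ℓ i) {t : ℕ}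
    (ht : t < G.horizon) (s : G.State) (a : G.Action) {k : Fin n → ℤ} (hk : k ∈ G.costBox ℓ)
    (s' : G.State) : (G.roundedEnv ℓ t s a).real {(k, s')} =
      G.boxProb ℓ t s a k * (G.trans t s a s').toReal := by
  have := PMF.toMeasure.isProbabilityMeasure (G.trans t s a)
  rw [roundedEnv, ← Set.singleton_prod_singleton, measureReal_prod_prod,
    cost_roundVec_singleton hG hℓ ht s a hk, measureReal_def,
    PMF.toMeasure_apply_singleton _ _ (measurableSet_singleton _)]

theorem roundedEnv_mem_costBox (hG : G.Standing) (hℓ : ∀ i, 0 < ℓ i) {t : ℕ}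
    (ht : t < G.horizon) (s : G.State) (a : G.Action) :
    ∀ᵐ p ∂(G.roundedEnv ℓ t s a), p.1 ∈ G.costBox ℓ := by
  have := PMF.toMeasure.isProbabilityMeasure (G.trans t s a)
  have : IsProbabilityMeasure ((G.cost t s a).map (G.roundVec ℓ)) :=
    Measure.isProbabilityMeasure_map (G.measurable_roundVec ℓ).aemeasurable
  have h : ∀ᵐ k ∂((G.cost t s a).map (G.roundVec ℓ)), k ∈ G.costBox ℓ :=
    (ae_map_iff (G.measurable_roundVec ℓ).aemeasurable (Set.to_countable _).measurableSet).mpr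
      (roundVec_mem_costBox hG hℓ ht s a)
  exact Measure.quasiMeasurePreserving_fst.ae h

theorem boxProb_nonneg (hG : G.Standing) (hℓ : ∀ i, 0 < ℓ i) {t : ℕ}
    (ht : t < G.horizon) (s : G.State) (a : G.Action) {k : Fin n → ℤ} (hk : k ∈ G.costBox ℓ) :
    0 ≤ G.boxProb ℓ t s a k := by
  rw [← cost_roundVec_singleton hG hℓ ht s a hk]
  exact measureReal_nonneg

/-- On a countable space, almost surely means at every atom. Points outside the box have mass zero,
and inside it the mass is a product of a cost and a transition probability. -/
theorem ae_roundedEnv_iff (hG : G.Standing) (hℓ : ∀ i, 0 < ℓ i) {t : ℕ}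
    (ht : t < G.horizon) (s : G.State) (a : G.Action) (P : (Fin n → ℤ) × G.State → Prop) :
    (∀ᵐ p ∂(G.roundedEnv ℓ t s a), P p) ↔ ∀ k ∈ G.costBox ℓ, 0 < G.boxProb ℓ t s a k →
      ∀ s', 0 < (G.trans t s a s').toReal → P (k, s') := by
  constructor
  · intro h k hk hpos s' hs'
    refine ae_iff_of_countable.mp h (k, s') fun h0 => ?_
    have := roundedEnv_singleton hG hℓ ht s a hk s'
    rw [measureReal_def, h0, ENNReal.toReal_zero] at this
    exact (mul_pos hpos hs').ne this
  · intro h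
    filter_upwards [roundedEnv_mem_costBox hG hℓ ht s a,
      (ae_iff_of_countable (p := fun p => (G.roundedEnv ℓ t s a) {p} ≠ 0)).mpr fun _ hx => hx]
      with p hp hp0
    have h1 := roundedEnv_singleton hG hℓ ht s a hp p.2
    have h2 : 0 < (G.roundedEnv ℓ t s a).real {p} :=
      ENNReal.toReal_pos hp0 (measure_ne_top _ _)
    rw [h1] at h2
    have h3 := boxProb_nonneg hG hℓ ht s a hp
    exact h p.1 hp (pos_of_mul_pos_left h2 ENNReal.toReal_nonneg) p.2 (pos_of_mul_pos_right h2 h3)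

theorem integral_roundedEnv (hG : G.Standing) (hℓ : ∀ i, 0 < ℓ i) {t : ℕ}
    (ht : t < G.horizon) (s : G.State) (a : G.Action) (f : (Fin n → ℤ) × G.State → ℝ) :
    ∫ p, f p ∂(G.roundedEnv ℓ t s a) = ∑ k ∈ G.costBox ℓ, G.boxProb ℓ t s a k *
      ∑ s', (G.trans t s a s').toReal * f (k, s') := by
  have h : (G.roundedEnv ℓ t s a).restrict ((G.costBox ℓ ×ˢ Finset.univ :
      Finset ((Fin n → ℤ) × G.State)) : Set ((Fin n → ℤ) × G.State)) = G.roundedEnv ℓ t s a := by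
    refine Measure.restrict_eq_self_of_ae_mem ?_
    filter_upwards [roundedEnv_mem_costBox hG hℓ ht s a] with p hp
    simpa using hp
  rw [← h, setIntegral_finset _ (IntegrableOn.of_finite (Finset.finite_toSet _)),
    Finset.sum_product]
  refine Finset.sum_congr rfl fun k hk => ?_
  rw [Finset.mul_sum]
  refine Finset.sum_congr rfl fun s' _ => ?_
  rw [roundedEnv_singleton hG hℓ ht s a hk, smul_eq_mul, mul_assoc]

end MarkovGame

namespace MarkovGame

variable {n : ℕ} {G : MarkovGame n} {ℓ : Fin n → ℝ}

/-! ## Nodes of histories -/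

/-- The node of the approximate game that a history reaches. -/
def nodeOf (ℓ : Fin n → ℝ) {k : ℕ} (ω : G.Hist k) : Node n G.numStates :=
  ((roundedNode ℓ ω).1, fun i => ((roundedNode ℓ ω).2 i : ℝ) * ℓ i)

theorem nodeOf_extend {k : ℕ} (ω : G.Hist k) (a : G.Action) (p : (Fin n → ℝ) × G.State) :
    nodeOf ℓ (extend ω (a, p)) =
      (p.2, fun i => (nodeOf ℓ ω).2 i + (G.roundVec ℓ p.1 i : ℝ) * ℓ i) := by
  refine Prod.ext (lastState_extend ω (a, p)) (funext fun i => ?_)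
  simp only [nodeOf, roundedNode, Fin.sum_univ_castSucc, extend_castSucc, extend_last]
  push_cast
  rw [add_mul]
  rfl

theorem nodeOf_zero (ω : G.Hist 0) : nodeOf ℓ ω = ((G.approx ℓ).start, 0) := by
  refine Prod.ext rfl (funext fun i => ?_)
  simp [nodeOf, roundedNode]

theorem measurableSet_nodeOf {k : ℕ} (P : Node n G.numStates → Prop) :
    MeasurableSet {ω : G.Hist k | P (nodeOf ℓ ω)} := by
  have : MeasurableSet {y : G.State × (Fin n → ℤ) | P (y.1, fun i => (y.2 i : ℝ) * ℓ i)} :=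
    (Set.to_countable _).measurableSet
  exact measurable_roundedNode ℓ this

theorem measurable_comp_nodeOf {k : ℕ} (f : Node n G.numStates → ℝ) :
    Measurable fun ω : G.Hist k => f (nodeOf ℓ ω) :=
  (measurable_of_countable fun y : G.State × (Fin n → ℤ) =>
    f (y.1, fun i => (y.2 i : ℝ) * ℓ i)).comp (measurable_roundedNode ℓ)

theorem isSuccessor_iff (t : Fin G.horizon) (x : Node n G.numStates) (a : G.Action)
    (y : Node n G.numStates) : (G.approx ℓ).IsSuccessor t x a y ↔
      ∃ k ∈ G.costBox ℓ, 0 < G.boxProb ℓ t x.1 a k ∧ 0 < (G.trans t x.1 a y.1).toReal ∧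
        y.2 = fun i => x.2 i + (k i : ℝ) * ℓ i := by
  simp only [FiniteGame.IsSuccessor, mem_approx_costs, approx_trans]
  constructor
  · rintro ⟨c, ⟨k, hk, hp, rfl⟩, hy, h⟩
    exact ⟨k, hk, hp, hy, h⟩
  · rintro ⟨k, hk, hp, hy, h⟩
    exact ⟨_, ⟨k, hk, hp, rfl⟩, hy, h⟩

/-- A transition distribution has nonempty support, so every supported cost occurs in some successor
and the budget test can be read off from the successors. -/
theorem withinBudget_iff (t : Fin G.horizon) (x : Node n G.numStates) (a : G.Action) :
    (G.approx ℓ).WithinBudget t x a ↔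
      ∀ y, (G.approx ℓ).IsSuccessor t x a y → ∀ i, y.2 i ≤ G.budget i := by
  constructor
  · rintro h y ⟨c, hc, -, hy⟩ i
    rw [hy]
    exact h c hc i
  · intro h c hc i
    obtain ⟨s', hs'⟩ := (G.trans t x.1 a).support_nonempty
    have := h (s', fun i => x.2 i + c.1 i) ⟨c, hc, ENNReal.toReal_pos
      ((PMF.mem_support_iff _ _).mp hs') (PMF.apply_ne_top _ _), rfl⟩ i
    exact this

theorem goodAct_iff_successor (t : Fin G.horizon) (x : Node n G.numStates) (a : G.Action) :
    (G.approx ℓ).GoodAct t x a ↔ ∀ y, (G.approx ℓ).IsSuccessor t x a y →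
      (G.approx ℓ).Good (t + 1) y ∧ ∀ i, y.2 i ≤ G.budget i := by
  rw [FiniteGame.GoodAct, withinBudget_iff]
  exact ⟨fun h y hy => ⟨h.2 y hy, h.1 y hy⟩, fun h => ⟨fun y hy => (h y hy).2,
    fun y hy => (h y hy).1⟩⟩

/-! ### Transfer between true and rounded costs -/

section Rounding

variable (hG : G.Standing) (hℓ : ∀ i, 0 < ℓ i)

include hG hℓ

/-- The next node depends on the reaction of the environment only through the rounded cost and the
next state, and the atoms of their joint law yield the successors. -/
theorem ae_env_nodeOf (t : Fin G.horizon) (ω : G.Hist t) (a : G.Action)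
    (P : Node n G.numStates → Prop) :
    (∀ᵐ p ∂(G.env t (ω, a)), P (nodeOf ℓ (extend ω (a, p)))) ↔
      ∀ y, (G.approx ℓ).IsSuccessor t (nodeOf ℓ ω) a y → P y := by
  have h := ae_map_iff (μ := G.env t (ω, a)) (measurable_round_prod (ℓ := ℓ)).aemeasurable
    (p := fun q => P (q.2, fun i => (nodeOf ℓ ω).2 i + (q.1 i : ℝ) * ℓ i))
    (Set.to_countable _).measurableSet
  simp only [nodeOf_extend]
  rw [← h, map_env, ae_roundedEnv_iff hG hℓ t.isLt]
  simp only [isSuccessor_iff]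
  constructor
  · rintro h y ⟨k, hk, hp, hs, hy⟩
    have := h k hk hp y.1 hs
    rwa [← hy] at this
  · intro h k hk hp s' hs
    exact h _ ⟨k, hk, hp, hs, rfl⟩

/-- The same push-forward for expectations: an integral over arbitrary costs becomes the finite
weighted sum that the algorithm computes. -/
theorem integral_env_nodeOf (t : Fin G.horizon) (ω : G.Hist t) (a : G.Action)
    (W : Node n G.numStates → ℝ) :
    ∫ p, W (nodeOf ℓ (extend ω (a, p))) ∂(G.env t (ω, a)) =
      (((G.approx ℓ).successors t (nodeOf ℓ ω) a).val.map fun y => y.2 * W y.1).sum := by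
  have h := integral_map (μ := G.env t (ω, a)) (measurable_round_prod (ℓ := ℓ)).aemeasurable
    (f := fun q : (Fin n → ℤ) × G.State =>
      W (q.2, fun i => (nodeOf ℓ ω).2 i + (q.1 i : ℝ) * ℓ i))
    (measurable_of_countable _).aestronglyMeasurable
  simp only [nodeOf_extend]
  rw [← h, map_env, integral_roundedEnv hG hℓ t.isLt, FiniteGame.sum_successors _ _ _ _ _
    (fun s => ENNReal.toReal_nonneg), sum_approx_costs G ℓ t _ a
      (fun k hk => boxProb_nonneg hG hℓ t.isLt _ a hk) (fun c => ∑ s,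
        (G.approx ℓ).trans t (nodeOf ℓ ω).1 a s * W (s, fun i => (nodeOf ℓ ω).2 i + c i))]
  rfl

/-- If some cost was clipped, its rounded value is at most `B - H c^max`, and each of the other `k -
1 ≤ H` rounded costs is at most `c^max`, so the total is at most `B`. If none was clipped, all costs
were rounded down and the rounded total is at most the true one. -/
theorem nodeOf_le_budget {k : ℕ} (hk : k ≤ G.horizon) (ω : G.Hist k) (i : Fin n)
    (hc : ∀ x, (ω x).2.1 i ≤ G.maxCost i) (h : totalCost ω i ≤ G.budget i) :
    (nodeOf ℓ ω).2 i ≤ G.budget i := by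
  have hpos := hG.maxCost_pos i
  have hsum : (nodeOf ℓ ω).2 i = ∑ x, (G.roundIdx ℓ i ((ω x).2.1 i) : ℝ) * ℓ i := by
    simp only [nodeOf, roundedNode]
    push_cast
    rw [Finset.sum_mul]
  have hle : ∀ x, (G.roundIdx ℓ i ((ω x).2.1 i) : ℝ) * ℓ i ≤ G.maxCost i := fun x => by
    have h1 : (G.roundIdx ℓ i ((ω x).2.1 i) : ℝ) ≤ G.hiIdx ℓ i := by
      exact_mod_cast roundIdx_le_hiIdx hG hℓ i (hc x)
    have h2 : (G.hiIdx ℓ i : ℝ) ≤ G.maxCost i / ℓ i := Int.floor_le _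
    rw [← le_div_iff₀ (hℓ i)]
    exact h1.trans h2
  rw [hsum]
  by_cases hlow : ∃ x, G.roundIdx ℓ i ((ω x).2.1 i) = G.loIdx ℓ i
  · obtain ⟨x₀, hx₀⟩ := hlow
    have hlo : (G.loIdx ℓ i : ℝ) * ℓ i ≤ G.budget i - G.horizon * G.maxCost i := by
      rw [← le_div_iff₀ (hℓ i)]
      exact Int.floor_le _
    have hcard : (Finset.univ.erase x₀).card = k - 1 := by simp
    have hk1 : 1 ≤ k := by have := x₀.isLt; omega
    have hrest : ∑ x ∈ Finset.univ.erase x₀, (G.roundIdx ℓ i ((ω x).2.1 i) : ℝ) * ℓ i ≤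
        (k - 1 : ℕ) * G.maxCost i := by
      refine (Finset.sum_le_card_nsmul _ _ _ fun x _ => hle x).trans_eq ?_
      rw [hcard, nsmul_eq_mul]
    rw [← Finset.add_sum_erase _ _ (Finset.mem_univ x₀), hx₀]
    have hkH : ((k - 1 : ℕ) : ℝ) * G.maxCost i ≤ G.horizon * G.maxCost i := by
      refine mul_le_mul_of_nonneg_right ?_ hpos.le
      exact_mod_cast (by omega : k - 1 ≤ G.horizon)
    linarith
  · push Not at hlow
    refine le_trans (Finset.sum_le_sum fun x _ => ?_) h
    have : G.roundIdx ℓ i ((ω x).2.1 i) = ⌊(ω x).2.1 i / ℓ i⌋ :=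
      max_eq_right_of_lt (lt_of_not_ge fun h' => hlow x (max_eq_left h'))
    rw [this, ← le_div_iff₀ (hℓ i)]
    exact Int.floor_le _

-- Rounding down loses less than one unit per step, and clipping only increases the rounded cost.
omit hG in
theorem totalCost_le_nodeOf {k : ℕ} (ω : G.Hist k) (i : Fin n) :
    totalCost ω i ≤ (nodeOf ℓ ω).2 i + k * ℓ i := by
  have hsum : (nodeOf ℓ ω).2 i + k * ℓ i =
      ∑ x, ((G.roundIdx ℓ i ((ω x).2.1 i) : ℝ) * ℓ i + ℓ i) := by
    simp only [nodeOf, roundedNode]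
    push_cast
    rw [Finset.sum_add_distrib, Finset.sum_mul]
    simp
  rw [hsum]
  refine Finset.sum_le_sum fun x _ => ?_
  have h1 : (⌊(ω x).2.1 i / ℓ i⌋ : ℝ) ≤ G.roundIdx ℓ i ((ω x).2.1 i) := by
    exact_mod_cast le_max_right _ _
  have h2 := (Int.lt_floor_add_one ((ω x).2.1 i / ℓ i)).le
  have h3 : (ω x).2.1 i / ℓ i ≤ G.roundIdx ℓ i ((ω x).2.1 i) + 1 := by linarith
  rw [div_le_iff₀ (hℓ i)] at h3
  linarith

variable (π : G.Policy) {t : ℕ} (τ : G.Hist t)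

-- The costs recorded in `τ` need a separate assumption, because `τ` is arbitrary and might have
-- probability zero; later costs obey the bound almost surely.
omit hℓ in
theorem ae_cost_le_maxCost (hτ : ∀ x i, (τ x).2.1 i ≤ G.maxCost i) {k : ℕ} (hk : k ≤ G.horizon) :
    ∀ᵐ ω ∂(π.lawGiven τ k), ∀ x i, (ω x).2.1 i ≤ G.maxCost i := by
  have hm : ∀ k, MeasurableSet {ω : G.Hist k | ∀ x i, (ω x).2.1 i ≤ G.maxCost i} := fun k => by
    simp only [Set.ofPred_forall]
    exact MeasurableSet.iInter fun x => MeasurableSet.iInter fun i =>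
      measurableSet_le (measurable_cost x i) measurable_const
  induction k with
  | zero => exact Filter.Eventually.of_forall fun ω x => x.elim0
  | succ k ih =>
    by_cases h : k + 1 ≤ t
    · rw [π.lawGiven_of_le τ h, ae_dirac_iff (hm _)]
      exact fun x i => hτ _ i
    · rw [π.ae_lawGiven_succ τ (by omega) (hm _)]
      filter_upwards [ih (by omega)] with ω hω
      refine Filter.Eventually.of_forall fun a => ?_
      have := PMF.toMeasure.isProbabilityMeasure (G.trans k (lastState ω) a)
      have h1 : ∀ᵐ p ∂(G.env k (ω, a)), ∀ i, p.1 i ≤ G.maxCost i := by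
        rw [env_apply]
        exact Measure.quasiMeasurePreserving_fst.ae (hG.cost_le (by omega) (lastState ω) a)
      filter_upwards [h1] with p hp
      intro x
      refine Fin.lastCases ?_ (fun x => ?_) x
      · simpa using hp
      · simpa using hω x

/-- Under a policy that is feasible given `τ`, almost surely only TRUE actions are played. -/
theorem ae_goodAct_of_good (hfeas : π.FeasibleGiven G.budget τ)
    (hτ : ∀ x i, (τ x).2.1 i ≤ G.maxCost i) (k : Fin G.horizon) (htk : t ≤ k)
    (hgood : ∀ᵐ ω ∂(π.lawGiven τ (k + 1)), (G.approx ℓ).Good (k + 1) (nodeOf ℓ ω)) :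
    ∀ᵐ ω ∂(π.lawGiven τ k), ∀ᵐ a ∂(π.act k ω), (G.approx ℓ).GoodAct k (nodeOf ℓ ω) a := by
  have h1 := (π.feasibleGiven_iff G.budget τ).mp hfeas (k + 1) (by omega) (by omega)
  -- Feasibility bounds the true cost and hence the rounded one. Together with goodness of the next
  -- node this is the successor criterion for TRUE actions.
  have h2 : ∀ᵐ ω ∂(π.lawGiven τ (k + 1)), (G.approx ℓ).Good (k + 1) (nodeOf ℓ ω) ∧
      ∀ i, (nodeOf ℓ ω).2 i ≤ G.budget i := by
    filter_upwards [hgood, h1, ae_cost_le_maxCost hG π τ hτ (k := k + 1) (by omega)]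
      with ω h3 h4 h5
    exact ⟨h3, fun i => nodeOf_le_budget hG hℓ (by omega) ω i (fun x => h5 x i) (h4 i)⟩
  rw [π.ae_lawGiven_succ τ htk (measurableSet_nodeOf fun x => (G.approx ℓ).Good (k + 1) x ∧
    ∀ i, x.2 i ≤ G.budget i)] at h2
  filter_upwards [h2] with ω hω
  filter_upwards [hω] with a ha
  rw [goodAct_iff_successor]
  exact (ae_env_nodeOf hG hℓ k ω a _).mp ha

/-- Induction backward from the horizon, where every node is TRUE. If only TRUE actions are played
almost surely, then one exists, because the action law is a probability measure. -/
theorem ae_good (hfeas : π.FeasibleGiven G.budget τ)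
    (hτ : ∀ x i, (τ x).2.1 i ≤ G.maxCost i) {k : ℕ} (htk : t ≤ k) (hk : k ≤ G.horizon) :
    ∀ᵐ ω ∂(π.lawGiven τ k), (G.approx ℓ).Good k (nodeOf ℓ ω) := by
  induction hk using Nat.decreasingInduction with
  | self => exact Filter.Eventually.of_forall fun ω => FiniteGame.good_horizon _ _
  | of_succ k hk ih =>
    filter_upwards [ae_goodAct_of_good hG hℓ π τ hfeas hτ ⟨k, hk⟩ htk (ih (by omega))] with ω hω
    exact ((G.approx ℓ).good_iff ⟨k, hk⟩ _).mpr hω.exists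

theorem ae_goodAct (hfeas : π.FeasibleGiven G.budget τ)
    (hτ : ∀ x i, (τ x).2.1 i ≤ G.maxCost i) (k : Fin G.horizon) (htk : t ≤ k) :
    ∀ᵐ ω ∂(π.lawGiven τ k), ∀ᵐ a ∂(π.act k ω), (G.approx ℓ).GoodAct k (nodeOf ℓ ω) a :=
  ae_goodAct_of_good hG hℓ π τ hfeas hτ k htk (ae_good hG hℓ π τ hfeas hτ (by omega) (by omega))

/-- If only TRUE actions are played, then only TRUE nodes within the budget are reached. -/
theorem ae_reach (hr : (G.approx ℓ).Reach t (nodeOf ℓ τ)) (hg : (G.approx ℓ).Good t (nodeOf ℓ τ))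
    (hact : ∀ k : Fin G.horizon, t ≤ k → ∀ᵐ ω ∂(π.lawGiven τ k),
      (G.approx ℓ).Reach k (nodeOf ℓ ω) → (G.approx ℓ).Good k (nodeOf ℓ ω) →
        ∀ᵐ a ∂(π.act k ω), (G.approx ℓ).GoodAct k (nodeOf ℓ ω) a)
    {k : ℕ} (htk : t ≤ k) (hk : k ≤ G.horizon) :
    ∀ᵐ ω ∂(π.lawGiven τ k), (G.approx ℓ).Reach k (nodeOf ℓ ω) ∧
      (G.approx ℓ).Good k (nodeOf ℓ ω) ∧ (t < k → ∀ i, (nodeOf ℓ ω).2 i ≤ G.budget i) := by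
  induction k, htk using Nat.le_induction with
  | base =>
    rw [π.lawGiven_self, ae_dirac_iff (measurableSet_nodeOf fun x => (G.approx ℓ).Reach t x ∧
      (G.approx ℓ).Good t x ∧ (t < t → ∀ i, x.2 i ≤ G.budget i))]
    -- No budget bound is claimed at time `t` itself; afterwards it comes from the TRUE action just
    -- played.
    exact ⟨hr, hg, fun h => absurd h (lt_irrefl t)⟩
  | succ k htk ih =>
    rw [π.ae_lawGiven_succ τ htk (measurableSet_nodeOf fun x => (G.approx ℓ).Reach (k + 1) x ∧
      (G.approx ℓ).Good (k + 1) x ∧ (t < k + 1 → ∀ i, x.2 i ≤ G.budget i))]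
    filter_upwards [ih (by omega), hact ⟨k, by omega⟩ htk] with ω h1 h2
    filter_upwards [h2 h1.1 h1.2.1] with a ha
    refine (ae_env_nodeOf hG hℓ ⟨k, by omega⟩ ω a (fun x => (G.approx ℓ).Reach (k + 1) x ∧
      (G.approx ℓ).Good (k + 1) x ∧ (t < k + 1 → ∀ i, x.2 i ≤ G.budget i))).mpr fun y hy => ?_
    have hy' := (goodAct_iff_successor _ _ _).mp ha y hy
    exact ⟨.step (t := ⟨k, by omega⟩) h1.1 ha.1 hy, hy'.1, fun _ => hy'.2⟩

end Rounding

end MarkovGame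

/-! ### Mixed deviations from a stage equilibrium -/

section StageDeviations

variable {n : ℕ} {m : Fin n → ℕ} {A : JointAction m → Prop} {q : JointAction m → Fin n → ℝ}
  {σ : JointAction m → ℝ}

/-- No independent deviation within the allowed actions improves on a coarse correlated
equilibrium. -/
theorem IsStageEquilibrium.deviate_le (h : IsStageEquilibrium .cce A q σ) (i : Fin n)
    (ν : Fin (m i) → ℝ) (hν : ∀ b, 0 ≤ ν b) (hν1 : ∑ b, ν b = 1)
    (hA : ∀ a b, σ a ≠ 0 → ν b ≠ 0 → A (Function.update a i b)) :
    ∑ a, σ a * ∑ b, ν b * q (Function.update a i b) i ≤ ∑ a, σ a * q a i := by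
  -- Average the stability inequalities over the deviating action. Actions of probability zero may
  -- be forbidden, but contribute nothing.
  have key : 0 ≤ ∑ b, ν b * ∑ a, σ a * (q a i - q (Function.update a i b) i) := by
    refine Finset.sum_nonneg fun b _ => ?_
    by_cases hb : ν b = 0
    · simp [hb]
    · have := h.stable i none rfl b fun a ha _ => hA a b ha hb
      simp only [Option.mem_def, reduceCtorEq, false_implies, implies_true, if_true] at this
      exact mul_nonneg (hν b) this
  have heq : ∑ b, ν b * ∑ a, σ a * (q a i - q (Function.update a i b) i) =
      ∑ a, σ a * q a i - ∑ a, σ a * ∑ b, ν b * q (Function.update a i b) i := by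
    simp_rw [Finset.mul_sum]
    rw [Finset.sum_comm, ← Finset.sum_sub_distrib]
    refine Finset.sum_congr rfl fun a _ => ?_
    calc _ = (∑ b, ν b) * (σ a * q a i) - ∑ b, σ a * (ν b * q (Function.update a i b) i) := by
          rw [Finset.sum_mul, ← Finset.sum_sub_distrib]
          exact Finset.sum_congr rfl fun b _ => by ring
      _ = _ := by rw [hν1, one_mul]
  linarith

/-- No modification of the recommendations within the allowed actions improves on a correlated
equilibrium. -/
theorem IsStageEquilibrium.modify_le (h : IsStageEquilibrium .ce A q σ) (i : Fin n)
    (ν : Fin (m i) → Fin (m i) → ℝ) (hν : ∀ b₀ b, 0 ≤ ν b₀ b) (hν1 : ∀ b₀, ∑ b, ν b₀ b = 1)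
    (hA : ∀ a b, σ a ≠ 0 → ν (a i) b ≠ 0 → A (Function.update a i b)) :
    ∑ a, σ a * ∑ b, ν (a i) b * q (Function.update a i b) i ≤ ∑ a, σ a * q a i := by
  -- Here every pair of a recommendation and a replacement has its own inequality, weighted by the
  -- conditional probability of the replacement.
  have key : 0 ≤ ∑ b₀, ∑ b, ν b₀ b * ∑ a, if a i = b₀ then
      σ a * (q a i - q (Function.update a i b) i) else 0 := by
    refine Finset.sum_nonneg fun b₀ _ => Finset.sum_nonneg fun b _ => ?_
    by_cases hb : ν b₀ b = 0
    · simp [hb]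
    · have := h.stable i (some b₀) (by simp [EqConcept.Distinguishes]) b fun a ha h0 =>
        hA a b ha (by rwa [h0 b₀ rfl])
      simp only [Option.mem_def, Option.some_inj, forall_eq'] at this
      exact mul_nonneg (hν b₀ b) this
  have heq : ∑ b₀, ∑ b, ν b₀ b * ∑ a, (if a i = b₀ then
      σ a * (q a i - q (Function.update a i b) i) else 0) =
      ∑ a, σ a * q a i - ∑ a, σ a * ∑ b, ν (a i) b * q (Function.update a i b) i := by
    have h1 : ∀ b₀, ∑ b, ν b₀ b * ∑ a, (if a i = b₀ then
        σ a * (q a i - q (Function.update a i b) i) else 0) =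
        ∑ a, if a i = b₀ then
          ∑ b, ν b₀ b * (σ a * (q a i - q (Function.update a i b) i)) else 0 := by
      intro b₀
      simp_rw [Finset.mul_sum]
      rw [Finset.sum_comm]
      refine Finset.sum_congr rfl fun a _ => ?_
      split_ifs <;> simp
    simp_rw [h1]
    rw [Finset.sum_comm, ← Finset.sum_sub_distrib]
    refine Finset.sum_congr rfl fun a _ => ?_
    rw [Finset.sum_ite_eq, if_pos (Finset.mem_univ _)]
    calc _ = (∑ b, ν (a i) b) * (σ a * q a i) -
          σ a * ∑ b, ν (a i) b * q (Function.update a i b) i := by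
          rw [Finset.sum_mul, Finset.mul_sum, ← Finset.sum_sub_distrib]
          exact Finset.sum_congr rfl fun b _ => by ring
      _ = _ := by rw [hν1, one_mul]
  linarith

end StageDeviations

namespace MarkovGame

variable {n : ℕ} {G : MarkovGame n}

theorem sum_real_singleton {α : Type*} [Fintype α] [MeasurableSpace α] [MeasurableSingletonClass α]
    (μ : Measure α) [IsProbabilityMeasure μ] : ∑ a, μ.real {a} = 1 := by
  have := integral_fintype (μ := μ) (f := fun _ : α => (1 : ℝ)) Integrable.of_finite
  simp_all

theorem real_singleton_ne_zero {α : Type*} [MeasurableSpace α]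
    {μ : Measure α} [IsFiniteMeasure μ] {a : α} (h : μ.real {a} ≠ 0) : μ {a} ≠ 0 := fun h0 => by
  rw [measureReal_def, h0] at h
  exact h rfl

theorem integral_deviate (π : G.Policy) (i : Fin n) (ρ : G.PlayerPolicy i) {t : ℕ} (ω : G.Hist t)
    (f : G.Action → ℝ) : ∑ a, ((π.deviate i ρ).act t ω).real {a} * f a =
      ∑ a, (π.act t ω).real {a} * ∑ b, (ρ.act t ω).real {b} * f (Function.update a i b) := by
  have h1 : (π.deviate i ρ).act t ω = ((π.act t ω).prod (ρ.act t ω)).map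
      fun p => Function.update p.1 i p.2 := by
    simp only [Policy.deviate]
    rw [Kernel.map_apply _ Measurable.of_discrete, Kernel.prod_apply]
  have h2 := integral_fintype (μ := (π.deviate i ρ).act t ω) (f := f) Integrable.of_finite
  simp only [smul_eq_mul] at h2
  rw [← h2, h1, integral_map Measurable.of_discrete.aemeasurable
    (measurable_of_countable f).aestronglyMeasurable, integral_prod _ Integrable.of_finite,
    integral_fintype Integrable.of_finite]
  refine Finset.sum_congr rfl fun a _ => ?_
  rw [integral_fintype Integrable.of_finite]
  rfl

theorem ae_deviate (π : G.Policy) (i : Fin n) (ρ : G.PlayerPolicy i) {t : ℕ} (ω : G.Hist t)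
    {A : G.Action → Prop} (h : ∀ᵐ a ∂((π.deviate i ρ).act t ω), A a) (a : G.Action)
    (b : Fin (G.numActions i)) (ha : (π.act t ω).real {a} ≠ 0) (hb : (ρ.act t ω).real {b} ≠ 0) :
    A (Function.update a i b) := by
  have h1 : (π.deviate i ρ).act t ω = ((π.act t ω).prod (ρ.act t ω)).map
      fun p => Function.update p.1 i p.2 := by
    simp only [Policy.deviate]
    rw [Kernel.map_apply _ Measurable.of_discrete, Kernel.prod_apply]
  rw [h1, ae_map_iff Measurable.of_discrete.aemeasurable (Set.to_countable _).measurableSet] at h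
  have h2 := Measure.ae_ae_of_ae_prod h
  exact ae_iff_of_countable.mp (ae_iff_of_countable.mp h2 a (real_singleton_ne_zero ha)) b
    (real_singleton_ne_zero hb)

theorem modify_act (π : G.Policy) (i : Fin n) (φ : G.Modification i) {t : ℕ} (ω : G.Hist t) :
    (π.modify i φ).act t ω = (((π.act t).compProd ((φ.act t).comap
      (fun p : G.Hist t × G.Action => (p.1, p.2 i)) (measurable_fst.prodMk
        ((measurable_pi_apply i).comp measurable_snd)))) ω).map
          fun p => Function.update p.1 i p.2 := by
  simp only [Policy.modify]
  rw [Kernel.map_apply _ Measurable.of_discrete]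

theorem integral_modify (π : G.Policy) (i : Fin n) (φ : G.Modification i) {t : ℕ} (ω : G.Hist t)
    (f : G.Action → ℝ) : ∑ a, ((π.modify i φ).act t ω).real {a} * f a =
      ∑ a, (π.act t ω).real {a} *
        ∑ b, (φ.act t (ω, a i)).real {b} * f (Function.update a i b) := by
  have h2 := integral_fintype (μ := (π.modify i φ).act t ω) (f := f) Integrable.of_finite
  simp only [smul_eq_mul] at h2
  rw [← h2, modify_act, integral_map Measurable.of_discrete.aemeasurable
    (measurable_of_countable f).aestronglyMeasurable,
    ProbabilityTheory.integral_compProd Integrable.of_finite,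
    integral_fintype Integrable.of_finite]
  refine Finset.sum_congr rfl fun a _ => ?_
  rw [integral_fintype Integrable.of_finite]
  rfl

theorem ae_modify (π : G.Policy) (i : Fin n) (φ : G.Modification i) {t : ℕ} (ω : G.Hist t)
    {A : G.Action → Prop} (h : ∀ᵐ a ∂((π.modify i φ).act t ω), A a) (a : G.Action)
    (b : Fin (G.numActions i)) (ha : (π.act t ω).real {a} ≠ 0)
    (hb : (φ.act t (ω, a i)).real {b} ≠ 0) : A (Function.update a i b) := by
  rw [modify_act, ae_map_iff Measurable.of_discrete.aemeasurable
    (Set.to_countable _).measurableSet] at h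
  have h2 := Kernel.ae_ae_of_ae_compProd h
  exact ae_iff_of_countable.mp (ae_iff_of_countable.mp h2 a (real_singleton_ne_zero ha)) b
    (real_singleton_ne_zero hb)

/-- A deviation from a stage equilibrium that plays only allowed actions is not profitable. -/
theorem deviation_le {π π' : G.Policy} {i : Fin n} {c : EqConcept} (hπ' : π' ∈ π.deviations i c)
    {t : ℕ} (ω : G.Hist t) {A : G.Action → Prop} {q : G.Action → Fin n → ℝ}
    (hσ : IsStageEquilibrium c A q fun a => (π.act t ω).real {a})
    (hA : ∀ᵐ a ∂(π'.act t ω), A a) :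
    ∑ a, (π'.act t ω).real {a} * q a i ≤ ∑ a, (π.act t ω).real {a} * q a i := by
  cases c with
  | cce =>
    obtain ⟨ρ, rfl⟩ := hπ'
    rw [integral_deviate π i ρ ω fun a => q a i]
    exact hσ.deviate_le i _ (fun b => measureReal_nonneg) (sum_real_singleton _)
      fun a b ha hb => ae_deviate π i ρ ω hA a b ha hb
  | ce =>
    obtain ⟨φ, rfl⟩ := hπ'
    rw [integral_modify π i φ ω fun a => q a i]
    exact hσ.modify_le i (fun b₀ b => (φ.act t (ω, b₀)).real {b}) (fun b₀ b => measureReal_nonneg)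
      (fun b₀ => sum_real_singleton _) fun a b ha hb => ae_modify π i φ ω hA a b ha hb

/-! ## Values -/

/-- The expected reward of player `i` at time `k`. -/
def stepReward (π : G.Policy) (i : Fin n) {t : ℕ} (τ : G.Hist t) (k : ℕ) : ℝ :=
  ∫ ω, (∑ a, (π.act k ω).real {a} * G.meanReward k (lastState ω) a i) ∂(π.lawGiven τ k)

theorem exists_bound_meanReward (k : ℕ) (i : Fin n) :
    ∃ C, ∀ s a, |G.meanReward k s a i| ≤ C := by
  refine ⟨∑ p : G.State × G.Action, |G.meanReward k p.1 p.2 i|, fun s a => ?_⟩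
  exact Finset.single_le_sum (f := fun p : G.State × G.Action => |G.meanReward k p.1 p.2 i|)
    (fun _ _ => abs_nonneg _) (Finset.mem_univ (s, a))

/-- The reward at time `k` involves only the first `k + 1` steps, so its expectation can be taken
under that marginal. It ignores the reaction of the environment at step `k`, which integrates to
one. -/
theorem value_eq_sum (π : G.Policy) (i : Fin n) {t : ℕ} (τ : G.Hist t) :
    π.value i τ = ∑ k ∈ Finset.range G.horizon, if t ≤ k then stepReward π i τ k else 0 := by
  have hm : ∀ (k K : ℕ) (h : k < K), Measurable fun ω : G.Hist K =>
      G.meanReward k (stateAt ω k h.le) (ω ⟨k, h⟩).1 i := fun k K h =>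
    (measurable_of_countable fun p : G.State × G.Action => G.meanReward k p.1 p.2 i).comp
      ((measurable_stateAt k h.le).prodMk (measurable_fst.comp (measurable_pi_apply _)))
  rw [Policy.value, integral_finsetSum, ← Fin.sum_univ_eq_sum_range
    (fun k => if t ≤ k then stepReward π i τ k else 0)]
  · refine Finset.sum_congr rfl fun x _ => ?_
    split_ifs with hx
    · obtain ⟨C, hC⟩ := G.exists_bound_meanReward x.val i
      have h1 : ∀ ω : G.Hist G.horizon, G.meanReward x.val (stateAt ω x.val x.isLt.le) (ω x).1 i =
          (fun ω' : G.Hist (x.val + 1) => G.meanReward x.val (stateAt ω' x.val (Nat.le_succ _))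
            (ω' ⟨x.val, Nat.lt_succ_self _⟩).1 i) (prefixOf x.isLt ω) := by
        intro ω
        simp only [stateAt_prefixOf]
        rfl
      simp_rw [h1]
      rw [π.integral_prefixOf τ x.isLt (hm _ _ _), π.integral_lawGiven_succ τ hx (hm _ _ _)
        (fun ω => hC _ _), stepReward]
      refine integral_congr_ae (Filter.Eventually.of_forall fun ω => ?_)
      refine Finset.sum_congr rfl fun a _ => ?_
      have h2 : ∀ p, G.meanReward x.val (stateAt (extend ω (a, p)) x.val (Nat.le_succ _))
          (extend ω (a, p) ⟨x.val, Nat.lt_succ_self _⟩).1 i =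
            G.meanReward x.val (lastState ω) a i := by
        intro p
        have h3 : extend ω (a, p) ⟨x.val, Nat.lt_succ_self _⟩ = (a, p) := extend_last ω (a, p)
        have h4 : stateAt (extend ω (a, p)) x.val (Nat.le_succ _) = lastState ω := by
          conv_rhs => rw [← prefixOf_extend ω (a, p)]
          exact (stateAt_prefixOf (Nat.le_succ _) (extend ω (a, p)) x.val le_rfl).symm
        rw [h3, h4]
      simp_rw [h2]
      simp
    · simp
  · intro x _
    split_ifs with hx
    · obtain ⟨C, hC⟩ := G.exists_bound_meanReward x.val i
      exact integrable_of_bounded (hm _ _ x.isLt) fun ω => hC _ _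
    · exact integrable_zero _ _ _

theorem integrable_policy_sum (π : G.Policy) {t k : ℕ} (τ : G.Hist t) (h : G.Hist k → G.Action → ℝ)
    (hm : ∀ a, Measurable fun ω => h ω a) {C : ℝ} (hC : ∀ ω a, |h ω a| ≤ C) :
    Integrable (fun ω => ∑ a, (π.act k ω).real {a} * h ω a) (π.lawGiven τ k) := by
  refine integrable_of_bounded (C := C) ?_ fun ω => ?_
  · refine Finset.measurable_sum _ fun a _ => ?_
    exact ((Kernel.measurable_coe (π.act k) (measurableSet_singleton a)).ennreal_toReal).mul (hm a)
  · refine (Finset.abs_sum_le_sum_abs _ _).trans ?_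
    calc _ ≤ ∑ a, (π.act k ω).real {a} * C := Finset.sum_le_sum fun a _ => by
          rw [abs_mul, abs_of_nonneg measureReal_nonneg]
          exact mul_le_mul_of_nonneg_left (hC ω a) measureReal_nonneg
      _ = C := by rw [← Finset.sum_mul, sum_real_singleton, one_mul]

/-! ### Telescoping of node values along the law of a policy -/

section Telescope

variable {ℓ : Fin n → ℝ} (hG : G.Standing) (hℓ : ∀ i, 0 < ℓ i) (π : G.Policy) {t : ℕ} (τ : G.Hist t)
  {V : ℕ → Node n G.numStates → Fin n → ℝ} (hV : ∀ t, ∃ C, ∀ x i, |V t x i| ≤ C)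

/-- The expectation of player `i`'s value of the node at time `k`. -/
def expectedValue (ℓ : Fin n → ℝ) (π : G.Policy) {t : ℕ} (τ : G.Hist t)
    (V : ℕ → Node n G.numStates → Fin n → ℝ) (i : Fin n) (k : ℕ) : ℝ :=
  ∫ ω, V k (nodeOf ℓ ω) i ∂(π.lawGiven τ k)

include hG hℓ hV

/-- One Bellman step in expectation: conditioning on the history at time `k` replaces the value of
the next node by the weighted sum over the successors. -/
theorem stepReward_add_expectedValue (i : Fin n) (k : Fin G.horizon) (htk : t ≤ k) :
    stepReward π i τ k + expectedValue ℓ π τ V i (k + 1) =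
      ∫ ω, (∑ a, (π.act k ω).real {a} *
        (G.approx ℓ).actionValue k (nodeOf ℓ ω) (V (k + 1)) a i) ∂(π.lawGiven τ k) ∧
    Integrable (fun ω => ∑ a, (π.act k ω).real {a} *
        (G.approx ℓ).actionValue k (nodeOf ℓ ω) (V (k + 1)) a i) (π.lawGiven τ k) := by
  obtain ⟨C, hC⟩ := hV (k + 1)
  obtain ⟨C', hC'⟩ := G.exists_bound_meanReward k i
  have h1 : expectedValue ℓ π τ V i (k + 1) = ∫ ω, (∑ a, (π.act k ω).real {a} *
      (((G.approx ℓ).successors k (nodeOf ℓ ω) a).val.map fun y => y.2 * V (k + 1) y.1 i).sum)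
        ∂(π.lawGiven τ k) := by
    rw [expectedValue, π.integral_lawGiven_succ τ htk
        (measurable_comp_nodeOf fun x => V (k + 1) x i)
      fun ω => hC _ _]
    simp_rw [integral_env_nodeOf hG hℓ k _ _ fun x => V (k + 1) x i]
  have i1 : Integrable (fun ω => ∑ a, (π.act k ω).real {a} *
      G.meanReward k (lastState ω) a i) (π.lawGiven τ k) :=
    integrable_policy_sum π τ _ (fun a => (measurable_of_countable fun s : G.State =>
      G.meanReward k s a i).comp measurable_lastState) fun ω a => hC' _ _
  have i2 : Integrable (fun ω => ∑ a, (π.act k ω).real {a} *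
      (((G.approx ℓ).successors k (nodeOf ℓ ω) a).val.map fun y => y.2 * V (k + 1) y.1 i).sum)
        (π.lawGiven τ k) := by
    refine integrable_policy_sum π τ _ (fun a => measurable_comp_nodeOf fun x =>
      (((G.approx ℓ).successors k x a).val.map fun y => y.2 * V (k + 1) y.1 i).sum)
      (C := C) fun ω a => ?_
    rw [← integral_env_nodeOf hG hℓ k ω a fun x => V (k + 1) x i]
    refine (norm_integral_le_of_norm_le_const (C := C)
      (f := fun p => V (k + 1) (nodeOf ℓ (extend ω (a, p))) i)
      (Filter.Eventually.of_forall fun p => hC (nodeOf ℓ (extend ω (a, p))) i)).trans_eq ?_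
    simp
  have h3 : (fun ω : G.Hist k => ∑ a, (π.act k ω).real {a} *
      (G.approx ℓ).actionValue k (nodeOf ℓ ω) (V (k + 1)) a i) = fun ω =>
      (∑ a, (π.act k ω).real {a} * G.meanReward k (lastState ω) a i) +
        ∑ a, (π.act k ω).real {a} * (((G.approx ℓ).successors k (nodeOf ℓ ω) a).val.map
          fun y => y.2 * V (k + 1) y.1 i).sum := by
    funext ω
    rw [← Finset.sum_add_distrib]
    exact Finset.sum_congr rfl fun a _ => mul_add _ _ _
  rw [h3]
  exact ⟨by rw [stepReward, h1, integral_add i1 i2], i1.add i2⟩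

/-- The rewards collected before time `j` plus the expected node value at `j` do not increase with
`j`. They start at the value of the node of `τ` and end at the value of the policy, as `V` vanishes
at the horizon. -/
theorem value_le_of_step (i : Fin n) (ht : t ≤ G.horizon) (hVH : V G.horizon = 0)
    (hstep : ∀ k : Fin G.horizon, t ≤ k → ∀ᵐ ω ∂(π.lawGiven τ k), ∑ a, (π.act k ω).real {a} *
      (G.approx ℓ).actionValue k (nodeOf ℓ ω) (V (k + 1)) a i ≤ V k (nodeOf ℓ ω) i) :
    π.value i τ ≤ V t (nodeOf ℓ τ) i := by
  have hdec : ∀ k : Fin G.horizon, t ≤ k →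
      stepReward π i τ k + expectedValue ℓ π τ V i (k + 1) ≤ expectedValue ℓ π τ V i k := by
    intro k hk
    obtain ⟨h1, h2⟩ := stepReward_add_expectedValue hG hℓ π τ hV i k hk
    obtain ⟨C, hC⟩ := hV k
    rw [h1]
    exact integral_mono_ae h2 (integrable_of_bounded (measurable_comp_nodeOf fun x => V k x i)
      fun ω => hC _ _) (hstep k hk)
  have hsum : ∀ j, t ≤ j → j ≤ G.horizon → (∑ k ∈ Finset.range j,
      if t ≤ k then stepReward π i τ k else 0) + expectedValue ℓ π τ V i j ≤
        expectedValue ℓ π τ V i t := by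
    intro j htj
    induction j, htj using Nat.le_induction with
    | base =>
      intro _
      rw [Finset.sum_eq_zero fun k hk => if_neg (by have := Finset.mem_range.mp hk; omega),
        zero_add]
    | succ j htj ih =>
      intro hj
      rw [Finset.sum_range_succ, if_pos htj]
      have := hdec ⟨j, hj⟩ htj
      have := ih (by omega)
      simp only at *
      linarith
  have h0 := hsum G.horizon ht le_rfl
  have h1 : expectedValue ℓ π τ V i G.horizon = 0 := by simp [expectedValue, hVH]
  have h2 : expectedValue ℓ π τ V i t = V t (nodeOf ℓ τ) i := by
    rw [expectedValue, π.lawGiven_self, integral_dirac' _ _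
      (measurable_comp_nodeOf fun x => V t x i).stronglyMeasurable]
  rw [h1, h2, add_zero, ← value_eq_sum] at h0
  exact h0

/-- The same telescoping sum with the opposite monotonicity. -/
theorem le_value_of_step (i : Fin n) (ht : t ≤ G.horizon) (hVH : V G.horizon = 0)
    (hstep : ∀ k : Fin G.horizon, t ≤ k → ∀ᵐ ω ∂(π.lawGiven τ k), V k (nodeOf ℓ ω) i ≤
      ∑ a, (π.act k ω).real {a} * (G.approx ℓ).actionValue k (nodeOf ℓ ω) (V (k + 1)) a i) :
    V t (nodeOf ℓ τ) i ≤ π.value i τ := by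
  have hdec : ∀ k : Fin G.horizon, t ≤ k →
      expectedValue ℓ π τ V i k ≤ stepReward π i τ k + expectedValue ℓ π τ V i (k + 1) := by
    intro k hk
    obtain ⟨h1, h2⟩ := stepReward_add_expectedValue hG hℓ π τ hV i k hk
    obtain ⟨C, hC⟩ := hV k
    rw [h1]
    exact integral_mono_ae (integrable_of_bounded (measurable_comp_nodeOf fun x => V k x i)
      fun ω => hC _ _) h2 (hstep k hk)
  have hsum : ∀ j, t ≤ j → j ≤ G.horizon → expectedValue ℓ π τ V i t ≤ (∑ k ∈ Finset.range j,
      if t ≤ k then stepReward π i τ k else 0) + expectedValue ℓ π τ V i j := by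
    intro j htj
    induction j, htj using Nat.le_induction with
    | base =>
      intro _
      rw [Finset.sum_eq_zero fun k hk => if_neg (by have := Finset.mem_range.mp hk; omega),
        zero_add]
    | succ j htj ih =>
      intro hj
      rw [Finset.sum_range_succ, if_pos htj]
      have := hdec ⟨j, hj⟩ htj
      have := ih (by omega)
      simp only at *
      linarith
  have h0 := hsum G.horizon ht le_rfl
  have h1 : expectedValue ℓ π τ V i G.horizon = 0 := by simp [expectedValue, hVH]
  have h2 : expectedValue ℓ π τ V i t = V t (nodeOf ℓ τ) i := by
    rw [expectedValue, π.lawGiven_self, integral_dirac' _ _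
      (measurable_comp_nodeOf fun x => V t x i).stronglyMeasurable]
  rw [h1, h2, add_zero, ← value_eq_sum] at h0
  exact h0

end Telescope

end MarkovGame

namespace MarkovGame

variable {n : ℕ} {G : MarkovGame n}

/-! ## Correctness of the approximation algorithm -/

theorem tablePolicy_act (ℓ : Fin n → ℝ) (T : PolicyTable n G.numStates G.numActions G.horizon)
    (t : ℕ) (ω : G.Hist t) : (tablePolicy ℓ T).act t ω =
      (toPMF (tableWeight T t (nodeOf ℓ ω))).toMeasure := rfl

theorem toPMF_real_singleton {w : G.Action → ℝ} (h0 : ∀ a, 0 ≤ w a) (h1 : ∑ a, w a = 1)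
    (a : G.Action) : (toPMF w).toMeasure.real {a} = w a := by
  have h : ∑ a, ENNReal.ofReal (w a) = 1 := by
    rw [← ENNReal.ofReal_sum_of_nonneg fun a _ => h0 a, h1, ENNReal.ofReal_one]
  rw [measureReal_def, PMF.toMeasure_apply_singleton _ _ (measurableSet_singleton _), toPMF,
    dif_pos h, PMF.ofFintype_apply, ENNReal.toReal_ofReal (h0 a)]

section Table

variable {ℓ : Fin n → ℝ} {c : EqConcept} {T : PolicyTable n G.numStates G.numActions G.horizon}
  {V : ℕ → Node n G.numStates → Fin n → ℝ}

/-- At a reached TRUE node the tabulated weights form a probability vector, so the fallback of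
`toPMF` is not used there. -/
theorem solvedNode_tablePolicy (hT : AscLevels ((G.approx ℓ).SolvedLevel c V) 0 T)
    (k : Fin G.horizon) (ω : G.Hist k) (hr : (G.approx ℓ).Reach k (nodeOf ℓ ω))
    (hg : (G.approx ℓ).Good k (nodeOf ℓ ω)) :
    (G.approx ℓ).SolvedNode c k (nodeOf ℓ ω) (V (k + 1))
      (fun a => ((tablePolicy ℓ T).act k ω).real {a}) (V k (nodeOf ℓ ω)) := by
  obtain ⟨pol, hpol, hs⟩ := hT.lookup k (Nat.zero_le _)
  have h := hs _ hr hg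
  have hw : tableWeight T k (nodeOf ℓ ω) = listWeight ((pol.lookup (nodeOf ℓ ω)).getD []) := by
    funext a
    rw [tableWeight, dif_pos k.isLt, hpol]
    rfl
  have : (fun a => ((tablePolicy ℓ T).act k ω).real {a}) =
      listWeight ((pol.lookup (nodeOf ℓ ω)).getD []) := by
    funext a
    rw [tablePolicy_act, hw, toPMF_real_singleton h.1.nonneg h.1.sum_eq_one]
  rw [this]
  exact h

theorem tablePolicy_ae_goodAct (hT : AscLevels ((G.approx ℓ).SolvedLevel c V) 0 T)
    (k : Fin G.horizon) (ω : G.Hist k) (hr : (G.approx ℓ).Reach k (nodeOf ℓ ω))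
    (hg : (G.approx ℓ).Good k (nodeOf ℓ ω)) :
    ∀ᵐ a ∂((tablePolicy ℓ T).act k ω), (G.approx ℓ).GoodAct k (nodeOf ℓ ω) a := by
  refine ae_iff_of_countable.mpr fun a ha => ?_
  refine (solvedNode_tablePolicy hT k ω hr hg).1.allowed a ?_
  exact (ENNReal.toReal_pos ha (measure_ne_top _ _)).ne'

variable (hG : G.Standing) (hℓ : ∀ i, 0 < ℓ i)

include hG hℓ

/-- Times up to `t` are settled by `τ`. Afterwards only TRUE actions are played, which keeps the
rounded cost within budget, and the true cost exceeds it by at most `ℓ` per step. -/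
theorem tablePolicy_feasibleGiven (hT : AscLevels ((G.approx ℓ).SolvedLevel c V) 0 T)
    {t : ℕ} (τ : G.Hist t) (hr : (G.approx ℓ).Reach t (nodeOf ℓ τ))
    (hg : (G.approx ℓ).Good t (nodeOf ℓ τ)) (b : Fin n → ℝ)
    (hb : ∀ i, G.budget i + G.horizon * ℓ i ≤ b i)
    (hτ : ∀ j, 1 ≤ j → ∀ h : j ≤ t, ∀ i, totalCost (prefixOf h τ) i ≤ b i) :
    (tablePolicy ℓ T).FeasibleGiven b τ := by
  rw [Policy.feasibleGiven_iff]
  intro j hj1 hj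
  by_cases hjt : j ≤ t
  · have hm : MeasurableSet {ω : G.Hist j | ∀ i, totalCost ω i ≤ b i} := by
      rw [Set.ofPred_forall]
      exact MeasurableSet.iInter fun i => measurableSet_le (measurable_totalCost i) measurable_const
    rw [Policy.lawGiven_of_le _ τ hjt, ae_dirac_iff hm]
    exact hτ j hj1 hjt
  · filter_upwards [ae_reach hG hℓ (tablePolicy ℓ T) τ hr hg (fun k _ =>
      Filter.Eventually.of_forall fun ω => tablePolicy_ae_goodAct hT k ω) (le_of_not_ge hjt) hj]
      with ω hω i
    have h1 := hω.2.2 (lt_of_not_ge hjt) i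
    have h2 := totalCost_le_nodeOf hℓ ω i
    have h3 : (j : ℝ) * ℓ i ≤ G.horizon * ℓ i :=
      mul_le_mul_of_nonneg_right (by exact_mod_cast hj) (hℓ i).le
    linarith [hb i]

theorem tablePolicy_le_value (hT : AscLevels ((G.approx ℓ).SolvedLevel c V) 0 T)
    (hV : ∀ t, ∃ C, ∀ x i, |V t x i| ≤ C) (hVH : V G.horizon = 0)
    {t : ℕ} (ht : t ≤ G.horizon) (τ : G.Hist t) (hr : (G.approx ℓ).Reach t (nodeOf ℓ τ))
    (hg : (G.approx ℓ).Good t (nodeOf ℓ τ)) (i : Fin n) :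
    V t (nodeOf ℓ τ) i ≤ (tablePolicy ℓ T).value i τ := by
  refine le_value_of_step hG hℓ _ τ hV i ht hVH fun k hk => ?_
  filter_upwards [ae_reach hG hℓ (tablePolicy ℓ T) τ hr hg (fun k _ =>
    Filter.Eventually.of_forall fun ω => tablePolicy_ae_goodAct hT k ω) hk k.isLt.le] with ω hω
  exact ((solvedNode_tablePolicy hT k ω hω.1 hω.2.1).2 i).le

/-- A deviation that is feasible in `G` almost surely plays TRUE actions and hence visits only
reached TRUE nodes. There each of its steps is an admissible deviation from the stage equilibrium
and cannot beat `V`. -/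
theorem value_deviation_le (hT : AscLevels ((G.approx ℓ).SolvedLevel c V) 0 T)
    (hV : ∀ t, ∃ C, ∀ x i, |V t x i| ≤ C) (hVH : V G.horizon = 0)
    {t : ℕ} (ht : t ≤ G.horizon) (τ : G.Hist t) (hr : (G.approx ℓ).Reach t (nodeOf ℓ τ))
    (hg : (G.approx ℓ).Good t (nodeOf ℓ τ)) (hτ : ∀ x i, (τ x).2.1 i ≤ G.maxCost i) (i : Fin n)
    {π' : G.Policy} (hπ' : π' ∈ (tablePolicy ℓ T).deviations i c)
    (hfeas : π'.FeasibleGiven G.budget τ) : π'.value i τ ≤ V t (nodeOf ℓ τ) i := by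
  refine value_le_of_step hG hℓ _ τ hV i ht hVH fun k hk => ?_
  have hact := ae_goodAct hG hℓ π' τ hfeas hτ
  filter_upwards [hact k hk, ae_reach hG hℓ π' τ hr hg
    (fun k hk => (hact k hk).mono fun ω h _ _ => h) hk k.isLt.le] with ω h1 h2
  have hs := solvedNode_tablePolicy hT k ω h2.1 h2.2.1
  rw [hs.2 i]
  exact deviation_le hπ' ω hs.1 h1

/-- The history is an atom of the law of some feasible policy, so whatever holds almost surely under
that policy holds at the history itself. -/
theorem feasiblyRealizable_spec {t : ℕ} (ht : t ≤ G.horizon) {τ : G.Hist t}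
    (hτ : τ ∈ G.FeasiblyRealizable t) :
    (G.approx ℓ).Reach t (nodeOf ℓ τ) ∧ (G.approx ℓ).Good t (nodeOf ℓ τ) ∧
      (∀ x i, (τ x).2.1 i ≤ G.maxCost i) ∧
      ∀ j, 1 ≤ j → ∀ h : j ≤ t, ∀ i, totalCost (prefixOf h τ) i ≤ G.budget i := by
  obtain ⟨π, hπ, hpos⟩ := hτ
  rw [π.feasible_iff] at hπ
  rw [π.law_eq] at hpos
  set τ₀ : G.Hist 0 := fun x => x.elim0 with hτ₀
  have h0 : ∀ x i, (τ₀ x).2.1 i ≤ G.maxCost i := fun x => x.elim0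
  have hatom : ∀ P : G.Hist t → Prop, (∀ᵐ ω ∂(π.lawGiven τ₀ t), P ω) → P τ := by
    intro P hP
    by_contra hne
    refine hpos.ne' (measure_mono_null ?_ (ae_iff.mp hP))
    rintro _ rfl
    exact hne
  have hgood0 : (G.approx ℓ).Good 0 (nodeOf ℓ τ₀) := by
    have := ae_good hG hℓ π τ₀ hπ h0 le_rfl (Nat.zero_le _)
    rwa [π.lawGiven_self, ae_dirac_iff (measurableSet_nodeOf fun x => (G.approx ℓ).Good 0 x)]
      at this
  have hreach0 : (G.approx ℓ).Reach 0 (nodeOf ℓ τ₀) := by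
    rw [nodeOf_zero]
    exact .start
  have h1 := hatom _ (ae_reach hG hℓ π τ₀ hreach0 hgood0 (fun k hk =>
    (ae_goodAct hG hℓ π τ₀ hπ h0 k hk).mono fun ω h _ _ => h) (Nat.zero_le t) ht)
  refine ⟨h1.1, h1.2.1, hatom _ (ae_cost_le_maxCost hG π τ₀ h0 ht), fun j hj h => ?_⟩
  have hm : MeasurableSet {ω : G.Hist j | ∀ i, totalCost ω i ≤ G.budget i} := by
    rw [Set.ofPred_forall]
    exact MeasurableSet.iInter fun i => measurableSet_le (measurable_totalCost i) measurable_const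
  exact hatom _ ((π.ae_prefixOf τ₀ h hm).mpr
    ((π.feasibleGiven_iff G.budget τ₀).mp hπ j hj (h.trans ht)))

/-- The law of the empty history is a point mass, so a feasible policy would make the root TRUE. -/
theorem not_feasible_of_not_good (h : ¬ (G.approx ℓ).Good 0 ((G.approx ℓ).start, 0)) :
    ¬ ∃ π : G.Policy, π.Feasible G.budget := by
  rintro ⟨π, hπ⟩
  have := ae_good hG hℓ π (fun x => x.elim0) hπ (fun x => x.elim0) le_rfl (Nat.zero_le _)
  rw [π.lawGiven_self, ae_dirac_iff (measurableSet_nodeOf fun x => (G.approx ℓ).Good 0 x),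
    nodeOf_zero] at this
  exact h this

end Table

theorem Standing.relUnit_pos (hG : G.Standing) {ε : ℝ} (hε : 0 < ε) (i : Fin n) :
    0 < G.relUnit ε i :=
  div_pos (mul_pos hε (abs_pos.mpr (hG.budget_ne i))) (by exact_mod_cast G.horizon_pos)

/-- The `H` units that rounding can lose amount to `ε |B|`, which is the relaxation of the budget
for either sign. -/
theorem budget_add_relUnit (G : MarkovGame n) (ε : ℝ) (i : Fin n) :
    G.budget i + G.horizon * G.relUnit ε i = G.relBudget ε i := by
  have h : (G.horizon : ℝ) ≠ 0 := by exact_mod_cast G.horizon_pos.ne'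
  rw [relUnit, relBudget, mul_div_cancel₀ _ h]
  rcases lt_trichotomy (G.budget i) 0 with hb | hb | hb
  · rw [Real.sign_of_neg hb, abs_of_neg hb]
    ring
  · simp [hb]
  · rw [Real.sign_of_pos hb, abs_of_pos hb]
    ring

/-- The approximation algorithm is correct. -/
theorem approximation_correct (hG : G.Standing) {ε : ℝ} (hε : 0 < ε) (LP : LPSolver)
    (hLP : LP.Correct) (c : EqConcept) :
    ((G.approximation (G.relUnit ε) LP c).val = none →
      ¬ ∃ π : G.Policy, π.Feasible G.budget) ∧
    (∀ T, (G.approximation (G.relUnit ε) LP c).val = some T →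
      (tablePolicy (G.relUnit ε) T).Feasible (G.relBudget ε) ∧
      (tablePolicy (G.relUnit ε) T).IsRelApproxACSPE c ε) := by
  have hℓ := hG.relUnit_pos hε
  refine ⟨fun h => not_feasible_of_not_good hG hℓ
    ((G.approx (G.relUnit ε)).reduction_none LP c h), fun T hT => ?_⟩
  obtain ⟨hroot, V, hVH, hV, hsol⟩ := (G.approx (G.relUnit ε)).reduction_some LP hLP c hT
  have hb : ∀ i, G.budget i + G.horizon * G.relUnit ε i ≤ G.relBudget ε i := fun i =>
    (G.budget_add_relUnit ε i).le
  have hle : ∀ i, G.budget i ≤ G.relBudget ε i := fun i => by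
    have := mul_nonneg (Nat.cast_nonneg G.horizon : (0 : ℝ) ≤ _) (hℓ i).le
    linarith [hb i]
  constructor
  · rw [Policy.feasible_iff]
    refine tablePolicy_feasibleGiven hG hℓ hsol _ ?_ ?_ _ hb fun j h1 h2 => by omega
    · rw [nodeOf_zero]
      exact .start
    · rw [nodeOf_zero]
      exact hroot
  · intro t ht τ hτ
    obtain ⟨hr, hg, hc, hbud⟩ := feasiblyRealizable_spec hG hℓ ht hτ
    refine ⟨tablePolicy_feasibleGiven hG hℓ hsol τ hr hg _ hb fun j h1 h2 i =>
      (hbud j h1 h2 i).trans (hle i), fun i π' hπ' => ?_⟩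
    by_cases hf : π'.FeasibleGiven G.budget τ
    · exact .inr ((value_deviation_le hG hℓ hsol hV hVH ht τ hr hg hc i hπ' hf).trans
        (tablePolicy_le_value hG hℓ hsol hV hVH ht τ hr hg i))
    · exact .inl hf

end MarkovGame

/-! ## Running time of the reduction -/

/-- The number of steps of a loop of `N` rounds with `K` steps each. -/
def loopSteps (N K : ℕ) : ℕ := N * (K + 1) + 1

theorem loopSteps_mono {N N' K K' : ℕ} (hN : N ≤ N') (hK : K ≤ K') :
    loopSteps N K ≤ loopSteps N' K' := by
  unfold loopSteps
  gcongr

theorem add_loopSteps_le {N K s : ℕ} (hs : s ≤ K) :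
    s + (loopSteps N K + 1) ≤ loopSteps (N + 1) K := by
  unfold loopSteps
  nlinarith

namespace Timed

variable {α β : Type} {N K : ℕ}

theorem steps_mapList_le (f : α → Timed β) {l : List α} (hl : l.length ≤ N)
    (h : ∀ a ∈ l, (f a).steps ≤ K) : (mapList f l).steps ≤ loopSteps N K := by
  refine le_trans ?_ (loopSteps_mono hl le_rfl)
  clear hl
  induction l with
  | nil => simp [mapList, loopSteps]
  | cons a l ih =>
    refine le_trans ?_ (add_loopSteps_le (h a (by simp)))
    exact Nat.add_le_add_left (Nat.add_le_add_right (ih fun a ha => h a (by simp [ha])) 1) _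

theorem steps_filterList_le (f : α → Timed Bool) {l : List α} (hl : l.length ≤ N)
    (h : ∀ a ∈ l, (f a).steps ≤ K) : (filterList f l).steps ≤ loopSteps N K := by
  refine le_trans ?_ (loopSteps_mono hl le_rfl)
  clear hl
  induction l with
  | nil => simp [filterList, loopSteps]
  | cons a l ih =>
    refine le_trans ?_ (add_loopSteps_le (h a (by simp)))
    exact Nat.add_le_add_left (Nat.add_le_add_right (ih fun a ha => h a (by simp [ha])) 1) _

theorem steps_allList_le (f : α → Timed Bool) {l : List α} (hl : l.length ≤ N)
    (h : ∀ a ∈ l, (f a).steps ≤ K) : (allList f l).steps ≤ loopSteps N K := by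
  refine le_trans ?_ (loopSteps_mono hl le_rfl)
  clear hl
  induction l with
  | nil => simp [allList, loopSteps]
  | cons a l ih =>
    refine le_trans ?_ (add_loopSteps_le (h a (by simp)))
    exact Nat.add_le_add_left (Nat.add_le_add_right (ih fun a ha => h a (by simp [ha])) 1) _

theorem steps_sumList_le (f : α → Timed ℝ) {l : List α} (hl : l.length ≤ N)
    (h : ∀ a ∈ l, (f a).steps ≤ K) : (sumList f l).steps ≤ loopSteps N K := by
  refine le_trans ?_ (loopSteps_mono hl le_rfl)
  clear hl
  induction l with
  | nil => simp [sumList, loopSteps]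
  | cons a l ih =>
    refine le_trans ?_ (add_loopSteps_le (h a (by simp)))
    exact Nat.add_le_add_left (Nat.add_le_add_right (ih fun a ha => h a (by simp [ha])) 1) _

theorem steps_fold_cons (f : β → α → Timed β) (b : β) (a : α) (l : List α) :
    (fold f b (a :: l)).steps = (f b a).steps + ((fold f (f b a).val l).steps + 1) := rfl

/-- The steps of a round may depend on the accumulator; the invariant `I` is what keeps them
bounded. -/
theorem steps_fold_le (f : β → α → Timed β) (I : β → Prop) {l : List α} {b : β}
    (hl : l.length ≤ N) (hb : I b)
    (h : ∀ b, ∀ a ∈ l, I b → I (f b a).val ∧ (f b a).steps ≤ K) :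
    (fold f b l).steps ≤ loopSteps N K := by
  refine le_trans ?_ (loopSteps_mono hl le_rfl)
  clear hl
  induction l generalizing b with
  | nil => simp [fold, loopSteps]
  | cons a l ih =>
    obtain ⟨h1, h2⟩ := h b a (by simp) hb
    rw [steps_fold_cons]
    refine le_trans ?_ (add_loopSteps_le h2)
    exact Nat.add_le_add_left (Nat.add_le_add_right
      (ih h1 fun b a ha => h b a (by simp [ha])) 1) _

theorem steps_fold_finRange_le {H : ℕ} (f : β → Fin H → Timed β) (I : ℕ → β → Prop) {b : β}
    (hH : H ≤ N) (hb : I 0 b)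
    (h : ∀ (t : Fin H) b, I t b → I (t + 1) (f b t).val ∧ (f b t).steps ≤ K) :
    (fold f b (List.finRange H)).steps ≤ loopSteps N K := by
  refine le_trans ?_ (loopSteps_mono hH le_rfl)
  suffices ∀ k t, t + k = H → ∀ b, I t b →
      (fold f b ((List.finRange H).drop t)).steps ≤ loopSteps k K by
    simpa using this H 0 (by simp) b hb
  intro k
  induction k with
  | zero =>
    intro t ht b _
    rw [List.drop_of_length_le (by simp; omega)]
    simp [fold, loopSteps]
  | succ k ih =>
    intro t ht b hb
    rw [List.drop_eq_getElem_cons (by simp; omega), steps_fold_cons, List.getElem_finRange]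
    obtain ⟨h1, h2⟩ := h ⟨t, by omega⟩ b hb
    refine le_trans ?_ (add_loopSteps_le h2)
    exact Nat.add_le_add_left (Nat.add_le_add_right (ih (t + 1) (by omega) _ h1) 1) _

theorem steps_tabulate_le {ι : Type} [Fintype ι] {β : ι → Type} (f : ∀ x, Timed (β x))
    (hι : Fintype.card ι ≤ N) (h : ∀ x, (f x).steps ≤ K) :
    (tabulate f).steps ≤ loopSteps N K := by
  refine le_trans ?_ (loopSteps_mono hι le_rfl)
  have : ∑ x, ((f x).steps + 1) ≤ ∑ _x : ι, (K + 1) :=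
    Finset.sum_le_sum fun x _ => Nat.add_le_add_right (h x) 1
  simp only [Finset.sum_const, Finset.card_univ, smul_eq_mul] at this
  simp only [tabulate, loopSteps]
  omega

end Timed

section Algorithms

variable {n S H N : ℕ} {m : Fin n → ℕ}

/-- The number of steps of looking up a node in a list of length `N`, in dimension at most `N`. -/
def scanSteps (N : ℕ) : ℕ := loopSteps N (N + 2) + N

theorem steps_insertNode_le (x : Node n S) {l : List (Node n S)} (hn : n ≤ N)
    (hl : l.length ≤ N) : (insertNode x l).steps ≤ scanSteps N := by
  refine le_trans (?_ : _ ≤ loopSteps l.length (n + 2) + n)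
    (Nat.add_le_add (loopSteps_mono hl (by omega)) hn)
  clear hl
  induction l with
  | nil => simp [insertNode, loopSteps]
  | cons y l ih =>
    unfold loopSteps at *
    by_cases h : x = y
    · simp [insertNode, nodeEq, h, Timed.steps_bind]
      nlinarith
    · simp [insertNode, nodeEq, h, Timed.steps_bind]
      nlinarith

theorem steps_memNode_le (x : Node n S) {l : List (Node n S)} (hn : n ≤ N)
    (hl : l.length ≤ N) : (memNode x l).steps ≤ scanSteps N := by
  refine le_trans (?_ : _ ≤ loopSteps l.length (n + 2) + n)
    (Nat.add_le_add (loopSteps_mono hl (by omega)) hn)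
  clear hl
  induction l with
  | nil => simp [memNode, loopSteps]
  | cons y l ih =>
    unfold loopSteps at *
    by_cases h : x = y
    · simp [memNode, nodeEq, h, Timed.steps_bind]
      nlinarith
    · simp [memNode, nodeEq, h, Timed.steps_bind]
      nlinarith

theorem steps_lookupValue_le (x : Node n S) {l : List (Node n S × (Fin n → ℝ))} (hn : n ≤ N)
    (hl : l.length ≤ N) : (lookupValue x l).steps ≤ scanSteps N := by
  refine le_trans (?_ : _ ≤ loopSteps l.length (n + 2) + n)
    (Nat.add_le_add (loopSteps_mono hl (by omega)) hn)
  clear hl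
  induction l with
  | nil => simp [lookupValue, loopSteps]
  | cons y l ih =>
    unfold loopSteps at *
    by_cases h : x = y.1
    · simp [lookupValue, nodeEq, h, Timed.steps_bind]
      nlinarith
    · simp [lookupValue, nodeEq, h, Timed.steps_bind]
      nlinarith

namespace FiniteGame

/-- All size parameters of the game, and the number of nodes at every time, are at most `N`. -/
structure SizeBound (F : FiniteGame n S m H) (N : ℕ) : Prop where
  players : n ≤ N
  states : S ≤ N
  horizon : H ≤ N
  ownActions : ∑ i, m i ≤ N
  jointActions : Fintype.card (JointAction m) ≤ N
  costs : ∀ t s a, (F.costs t s a).length ≤ N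
  nodes : ∀ l : List (Node n S), ∀ t, l.Nodup → (∀ x ∈ l, F.Reach t x) → l.length ≤ N

variable {F : FiniteGame n S m H}

theorem length_jointActions : (_root_.jointActions m).length = Fintype.card (JointAction m) := by
  simp [_root_.jointActions]

theorem SizeBound.length_filter (hF : F.SizeBound N) (p : JointAction m → Bool) :
    ((_root_.jointActions m).filter p).length ≤ N :=
  (List.length_filter_le _ _).trans (length_jointActions.trans_le hF.jointActions)

/-- The number of steps of finding the successors of a node. -/
def succSteps (N : ℕ) : ℕ := loopSteps N (loopSteps N (N + 6))

theorem SizeBound.steps_successors (hF : F.SizeBound N) (t : Fin H) (x : Node n S)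
    (a : JointAction m) : (F.successors t x a).steps ≤ succSteps N := by
  refine Timed.steps_fold_le _ (fun _ => True) (hF.costs _ _ _) trivial fun b c _ _ =>
    ⟨trivial, Timed.steps_fold_le _ (fun _ => True) (by simpa using hF.states) trivial
      fun b s _ _ => ⟨trivial, ?_⟩⟩
  have := hF.players
  split_ifs
  · simpa using this
  · simp

theorem SizeBound.length_successors (hF : F.SizeBound N) (t : Fin H) (x : Node n S)
    (a : JointAction m) : (F.successors t x a).val.length ≤ N * N := by
  rw [successors_val, List.length_reverse, List.length_flatMap]
  refine (List.sum_le_card_nsmul _ N fun k hk => ?_).trans ?_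
  · obtain ⟨c, -, rfl⟩ := List.mem_map.mp hk
    rw [List.length_map]
    exact (List.length_filter_le _ _).trans (by simpa using hF.states)
  · rw [List.length_map, smul_eq_mul]
    exact Nat.mul_le_mul_right _ (hF.costs _ _ _)

/-- The number of steps of expanding a node. -/
def expandSteps (N : ℕ) : ℕ :=
  loopSteps N (loopSteps N (3 * N + 1)) + loopSteps N (succSteps N + 1)

theorem SizeBound.steps_expand (hF : F.SizeBound N) (t : Fin H) (x : Node n S) :
    (F.expand t x).steps ≤ expandSteps N := by
  have hn := hF.players
  rw [expand, Timed.steps_bind]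
  refine Nat.add_le_add (Timed.steps_filterList_le _ (length_jointActions.trans_le hF.jointActions)
    fun a _ => Timed.steps_allList_le _ (hF.costs _ _ _) fun c _ => by simp; omega) ?_
  rw [Timed.val_filterList]
  exact Timed.steps_mapList_le _ (hF.length_filter _) fun a _ =>
    Nat.add_le_add (hF.steps_successors t x a) le_rfl

/-- The number of steps of constructing one level of the feasibility graph. -/
def treeStepSteps (N : ℕ) : ℕ :=
  loopSteps N (expandSteps N + 1)
    + (loopSteps N (loopSteps N (loopSteps (N * N) (scanSteps N))) + 1)

/-- Every insertion scans the list of next nodes, so its length has to be controlled during the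
loop. The invariant `I` says that it is free of repetitions and consists of reached nodes, so
`SizeBound.nodes` also bounds the partial lists. -/
theorem SizeBound.steps_treeStep (hF : F.SizeBound N) (t : Fin H)
    (st : List (Fin H × Level n S m) × List (Node n S)) (hst : F.Constructed t st) :
    (F.treeStep st t).steps ≤ treeStepSteps N := by
  classical
  obtain ⟨-, h2, h3⟩ := hst
  have hlen : st.2.length ≤ N := hF.nodes _ t h2 fun x hx => (h3 x).mp hx
  simp only [treeStep, Timed.steps_bind]
  refine Nat.add_le_add (Timed.steps_mapList_le _ hlen fun x _ =>
    Nat.add_le_add (hF.steps_expand t x) le_rfl) (Nat.add_le_add ?_ le_rfl)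
  rw [Timed.val_mapList]
  simp only [Timed.val_bind, expand_val, Timed.val_ops]
  set I : List (Node n S) → Prop := fun l => l.Nodup ∧ ∀ y ∈ l, F.Reach (t + 1) y
  have hI : ∀ l, I l → l.length ≤ N :=
    fun l hl => hF.nodes l _ hl.1 hl.2
  refine Timed.steps_fold_le _ I (by simpa using hlen)
    ⟨List.nodup_nil, by simp⟩ fun l e he hl => ?_
  obtain ⟨x, hx, rfl⟩ := List.mem_map.mp he
  have hstep : ∀ l, I l →
      ∀ b ∈ ((_root_.jointActions m).filter fun a => F.WithinBudget t x a).map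
        (fun a => (a, (F.successors t x a).val)), ∀ y ∈ b.2,
      I (insertNode y.1 l).val ∧ (insertNode y.1 l).steps ≤ scanSteps N := by
    intro l hl b hb y hy
    refine ⟨⟨nodup_val_insertNode _ _ hl.1, fun z hz => ?_⟩,
      steps_insertNode_le _ hF.players (hI l hl)⟩
    rcases (mem_val_insertNode _ _ _).mp hz with rfl | hz
    · obtain ⟨a, ha, rfl⟩ := List.mem_map.mp hb
      exact .step ((h3 x).mp hx) (by simpa using (List.mem_filter.mp ha).2)
        ((F.exists_mem_successors _ _ _ _).mp ⟨y.2, hy⟩)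
    · exact hl.2 z hz
  refine ⟨?_, Timed.steps_fold_le _ I
    (by simpa using hF.length_filter _) hl fun l b hb hl => ⟨?_,
      Timed.steps_fold_le _ I ?_ hl fun l y hy hl =>
      hstep l hl b hb y hy⟩⟩
  · rw [Timed.val_fold]
    refine foldl_induction _ I _ _ hl fun l b hb hl => ?_
    rw [Timed.val_fold]
    exact foldl_induction _ I _ _ hl fun l y hy hl => (hstep l hl b hb y hy).1
  · rw [Timed.val_fold]
    exact foldl_induction _ I _ _ hl fun l y hy hl => (hstep l hl b hb y hy).1
  · obtain ⟨a, -, rfl⟩ := List.mem_map.mp hb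
    exact hF.length_successors t x a

theorem SizeBound.steps_feasibilityTree (hF : F.SizeBound N) :
    F.feasibilityTree.steps ≤ loopSteps N (treeStepSteps N) := by
  rw [feasibilityTree_eq]
  exact Timed.steps_fold_finRange_le _ F.Constructed hF.horizon F.constructed_zero fun t st hst =>
    ⟨F.treeStep_spec t st hst, hF.steps_treeStep t st hst⟩

/-- The number of steps of evaluating one level of the feasibility graph. -/
def evalStepSteps (N : ℕ) : ℕ :=
  loopSteps N (loopSteps N (loopSteps (N * N) (scanSteps N)) + 1) + (loopSteps N 1 + 1)

theorem SizeBound.length_kept (hF : F.SizeBound N) {γ : Type}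
    {g : Fin H → Node n S → JointAction m → γ}
    {t : Fin H} {kept : List (Node n S × List γ)} (h : F.KeptLevel g t kept) :
    kept.length ≤ N ∧ ∀ e ∈ kept, e.2.length ≤ N := by
  obtain ⟨nodes, h1, h2, rfl⟩ := h
  refine ⟨by simpa using hF.nodes nodes t h1 fun x hx => ((h2 x).mp hx).1, fun e he => ?_⟩
  obtain ⟨x, -, rfl⟩ := List.mem_map.mp he
  simpa using hF.length_filter _

theorem SizeBound.steps_evalStep (hF : F.SizeBound N) (t : Fin H) (level : Level n S m)
    (hl : F.TreeLevel t level) (st : List (Fin H × Level n S m) × List (Node n S))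
    (hst : F.Evaluated (t + 1) st) : (evalStep st (t, level)).steps ≤ evalStepSteps N := by
  have hkept := F.evalStep_spec t level hl st hst
  obtain ⟨nodes, h1, h2, rfl⟩ := hl
  have hlen : nodes.length ≤ N := hF.nodes _ t h1 fun x hx => (h2 x).mp hx
  have hlen' : st.2.length ≤ N := hF.nodes _ (t + 1) hst.2.1 fun x hx => ((hst.2.2 x).mp hx).1
  have hkl : (evalStep st (t, nodes.map fun x => (x, _))).val.2.length ≤ N :=
    hF.nodes _ t hkept.2.1 fun x hx => ((hkept.2.2 x).mp hx).1
  simp only [evalStep, Timed.val_bind, Timed.val_mapList, Timed.val_ops, List.length_map] at hkl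
  simp only [evalStep, Timed.steps_bind]
  refine Nat.add_le_add (Timed.steps_fold_le _ (fun _ => True) (by simpa using hlen) trivial
    fun b e he _ => ⟨trivial, ?_⟩) (Nat.add_le_add
      (Timed.steps_mapList_le _ hkl fun _ _ => le_rfl) le_rfl)
  obtain ⟨x, -, rfl⟩ := List.mem_map.mp he
  rw [Timed.steps_bind]
  refine Nat.add_le_add (Timed.steps_filterList_le _ (by simpa using hF.length_filter _)
    fun b hb => Timed.steps_allList_le _ ?_ fun y _ =>
      steps_memNode_le _ hF.players hlen') ?_
  · obtain ⟨a, -, rfl⟩ := List.mem_map.mp hb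
    exact hF.length_successors t x a
  · split_ifs <;> exact le_rfl

theorem SizeBound.steps_evalTree (hF : F.SizeBound N) :
    (evalTree F.feasibilityTree.val).steps ≤ loopSteps N (evalStepSteps N) := by
  obtain ⟨hT, hnd, hN⟩ := F.feasibilityTree_spec
  rw [evalTree_eq]
  suffices ∀ k l, DescLevels F.TreeLevel k l → ∀ st, F.Evaluated k st →
      (Timed.fold evalStep st l).steps ≤ loopSteps k (evalStepSteps N) from
    (this _ _ hT ([], _) ⟨.nil, hnd, fun x => by rw [hN, and_iff_left (F.good_horizon x)]⟩).trans
      (loopSteps_mono hF.horizon le_rfl)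
  intro k l hl
  induction hl with
  | nil => intro st _; simp [Timed.fold, loopSteps]
  | cons h1 h2 ih =>
    intro st hst
    rw [Timed.steps_fold_cons]
    exact le_trans (Nat.add_le_add_left (Nat.add_le_add_right
      (ih _ (F.evalStep_spec _ _ h2 _ hst)) 1) _)
      (add_loopSteps_le (hF.steps_evalStep _ _ h2 _ hst))

end FiniteGame

theorem AscLevels.length_le {α : Type*} {P : Fin H → α → Prop} {k : ℕ} {l : List (Fin H × α)}
    (h : AscLevels P k l) : l.length ≤ H := by
  suffices k + l.length = H by omega
  induction h with
  | nil => simp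
  | cons h1 h2 ih => simp; omega

theorem AscLevels.forall_mem {α : Type*} {P : Fin H → α → Prop} {k : ℕ} {l : List (Fin H × α)}
    (h : AscLevels P k l) : ∀ x ∈ l, P x.1 x.2 := by
  induction h with
  | nil => simp
  | cons h1 h2 ih => simpa using ⟨h2, by simpa using ih⟩

namespace FiniteGame

variable {F : FiniteGame n S m H}

/-- The number of steps of the feasibility algorithm. -/
def feasibilitySteps (N : ℕ) : ℕ :=
  loopSteps N (treeStepSteps N) + (loopSteps N (evalStepSteps N) + (scanSteps N +
    (loopSteps N (loopSteps N (loopSteps N 1 + 1) + 1) + 1)))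

theorem SizeBound.steps_feasibility (hF : F.SizeBound N) :
    F.feasibility.steps ≤ feasibilitySteps N := by
  obtain ⟨h1, h2, h3⟩ := F.evalTree_spec
  simp only [feasibility, Timed.steps_bind]
  refine Nat.add_le_add hF.steps_feasibilityTree (Nat.add_le_add hF.steps_evalTree
    (Nat.add_le_add (steps_memNode_le _ hF.players
      (hF.nodes _ 0 h2 fun x hx => ((h3 x).mp hx).1)) ?_))
  split_ifs
  · rw [Timed.steps_bind]
    refine Nat.add_le_add (Timed.steps_mapList_le _ (h1.length_le.trans hF.horizon)
      fun lev hlev => ?_) le_rfl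
    obtain ⟨h4, h5⟩ := hF.length_kept (h1.forall_mem _ hlev)
    refine Nat.add_le_add (Timed.steps_mapList_le _ h4 fun e he => ?_) le_rfl
    exact Nat.add_le_add (Timed.steps_mapList_le _ (h5 e he) fun _ _ => le_rfl) le_rfl
  · simp

/-- The number of steps of constructing the reduced game. -/
def reducedGameSteps (N : ℕ) : ℕ :=
  loopSteps N (loopSteps N (loopSteps N (succSteps N + (N + 1)) + 1) + 1)

theorem SizeBound.steps_reducedGame (hF : F.SizeBound N)
    {R : List (Fin H × List (Node n S × List (JointAction m)))}
    (hR : AscLevels (F.KeptLevel fun _ _ a => a) 0 R) :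
    (F.reducedGame R).steps ≤ reducedGameSteps N := by
  have hn := hF.players
  refine Timed.steps_mapList_le _ (hR.length_le.trans hF.horizon) fun lev hlev => ?_
  obtain ⟨h4, h5⟩ := hF.length_kept (hR.forall_mem _ hlev)
  refine Nat.add_le_add (Timed.steps_mapList_le _ h4 fun e he => ?_) le_rfl
  refine Nat.add_le_add (Timed.steps_mapList_le _ (h5 e he) fun a _ => ?_) le_rfl
  exact Nat.add_le_add (hF.steps_successors _ _ _) (by simp; omega)

end FiniteGame

end Algorithms

theorem eval_nat_mono (p : Polynomial ℕ) {x y : ℕ} (h : x ≤ y) : p.eval x ≤ p.eval y := by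
  rw [Polynomial.eval_eq_sum, Polynomial.eval_eq_sum]
  exact Finset.sum_le_sum fun i _ => Nat.mul_le_mul_left _ (Nat.pow_le_pow_left h i)

section Algorithms

variable {n S H N : ℕ} {m : Fin n → ℕ} {F : FiniteGame n S m H}

theorem steps_utility_le (i : Fin n) (a : JointAction m) {l : List (JointAction m × (Fin n → ℝ))}
    (hn : n ≤ N) (hl : l.length ≤ N) : (utility i a l).steps ≤ (N + 1) * (N + 1) := by
  refine le_trans (?_ : _ ≤ (l.length + 1) * (n + 1)) (by gcongr)
  clear hl
  induction l with
  | nil => simp [utility]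
  | cons y l ih =>
    by_cases h : a = y.1
    · simp [utility, h]
    · simp [utility, h, Timed.steps_bind]
      nlinarith

/-- The number of steps of computing one coefficient of the linear program. -/
def lossSteps (N : ℕ) : ℕ := (N + 1) * (N + 1) + ((N + 1) * (N + 1) + (N + 1))

theorem steps_utilityLoss_le {Q : List (JointAction m × (Fin n → ℝ))} (hn : n ≤ N)
    (hQ : Q.length ≤ N) (i : Fin n) (b : Fin (m i)) (v : Fin Q.length) :
    (utilityLoss Q i b v).steps ≤ lossSteps N := by
  simp only [utilityLoss, Timed.steps_bind]
  exact Nat.add_le_add (steps_utility_le _ _ hn hQ) (Nat.add_le_add (steps_utility_le _ _ hn hQ)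
    (by simpa using hn))

/-- One bound serves both concepts: the coarse program has `∑ m i ≤ N` deviation rows, the
correlated one `∑ (m i)² ≤ N * N`. -/
theorem steps_deviationRows_le {Q : List (JointAction m × (Fin n → ℝ))} (hn : n ≤ N)
    (hm : ∑ i, m i ≤ N) (hQ : Q.length ≤ N) (c : EqConcept) :
    (deviationRows Q c).steps ≤ loopSteps (N * N + N) (loopSteps N (lossSteps N) + 1) ∧
      (deviationRows Q c).val.length ≤ N * N + N := by
  have hQ' : Fintype.card (Fin Q.length) ≤ N := by simpa using hQ
  cases c with
  | cce =>
    have hlen : (Finset.univ : Finset (Σ i, Fin (m i))).toList.length ≤ N * N + N := by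
      simp
      omega
    simp only [deviationRows, Timed.val_mapList, List.length_map]
    exact ⟨Timed.steps_mapList_le _ hlen fun d _ => Nat.add_le_add (Timed.steps_tabulate_le _ hQ'
      fun v => steps_utilityLoss_le hn hQ _ _ _) le_rfl, hlen⟩
  | ce =>
    have hlen : (Finset.univ : Finset (Σ i, Fin (m i) × Fin (m i))).toList.length
        ≤ N * N + N := by
      simp only [Finset.length_toList, Finset.card_univ, Fintype.card_sigma, Fintype.card_prod,
        Fintype.card_fin]
      calc ∑ i, m i * m i ≤ ∑ i, N * m i := Finset.sum_le_sum fun i _ =>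
            Nat.mul_le_mul_right _ ((Finset.single_le_sum (fun _ _ => Nat.zero_le _)
              (Finset.mem_univ i)).trans hm)
        _ ≤ N * N + N := by rw [← Finset.mul_sum]; nlinarith
    simp only [deviationRows, Timed.val_mapList, List.length_map]
    refine ⟨Timed.steps_mapList_le _ hlen fun d _ => Nat.add_le_add (Timed.steps_tabulate_le _ hQ'
      fun v => ?_) le_rfl, hlen⟩
    split_ifs
    · exact steps_utilityLoss_le hn hQ _ _ _
    · simp [lossSteps]
      nlinarith

/-- The number of steps of solving one stage game. -/
def solveStageSteps (p : Polynomial ℕ) (N : ℕ) : ℕ :=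
  loopSteps (N * N + N) (loopSteps N (lossSteps N) + 1) + (2 * N + 2) +
    (p.eval (N + (N * N + N + 2)) + (loopSteps N 2 + (loopSteps N (loopSteps N 3) + 1)))

theorem steps_solveStage_le {LP : LPSolver} {p : Polynomial ℕ} (hLP : LP.PolyTime p)
    (hn : n ≤ N) (hm : ∑ i, m i ≤ N) (c : EqConcept) (x : Node n S)
    {Q : List (JointAction m × (Fin n → ℝ))} (hQ : Q.length ≤ N) :
    (solveStage LP c x Q).steps ≤ solveStageSteps p N := by
  obtain ⟨h1, h2⟩ := steps_deviationRows_le hn hm hQ c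
  have hlen : (List.finRange Q.length).length ≤ N := by simpa using hQ
  simp only [solveStage, Timed.steps_bind]
  refine Nat.add_le_add (Nat.add_le_add h1 (by simpa using hQ)) (Nat.add_le_add
    ((hLP _).trans (eval_nat_mono p ?_)) (Nat.add_le_add
      (Timed.steps_mapList_le _ hlen fun _ _ => le_rfl) (Nat.add_le_add
        (Timed.steps_tabulate_le _ (by simpa using hn) fun i =>
          Timed.steps_sumList_le _ hlen fun _ _ => le_rfl) le_rfl)))
  -- The two rows beyond the deviation rows force the probabilities to sum to one.
  simp [stageLP]
  omega

/-- The number of steps of building one stage game. -/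
def stageUtilitiesSteps (N : ℕ) : ℕ :=
  loopSteps N (loopSteps N (loopSteps (N * N) (scanSteps N + 2) + 2) + 1)

theorem steps_stageUtilities_le {vals : List (Node n S × (Fin n → ℝ))}
    {acts : List (JointAction m × (Fin n → ℝ) × List (Node n S × ℝ))} (hn : n ≤ N)
    (hv : vals.length ≤ N) (ha : acts.length ≤ N) (hs : ∀ a ∈ acts, a.2.2.length ≤ N * N) :
    (stageUtilities vals acts).steps ≤ stageUtilitiesSteps N :=
  Timed.steps_mapList_le _ ha fun a ha => Nat.add_le_add (Timed.steps_tabulate_le _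
    (by simpa using hn) fun i => Nat.add_le_add (Timed.steps_sumList_le _ (hs a ha) fun y _ =>
      Nat.add_le_add (steps_lookupValue_le _ hn hv) le_rfl) le_rfl) le_rfl

/-- The number of steps of solving the stage games of one time step. -/
def solveLevelSteps (p : Polynomial ℕ) (N : ℕ) : ℕ :=
  loopSteps N (stageUtilitiesSteps N + solveStageSteps p N) +
    (loopSteps N 2 + (loopSteps N 2 + 1))

/-- The number of steps of backward induction. -/
def solverSteps (p : Polynomial ℕ) (N : ℕ) : ℕ :=
  loopSteps N 1 + (loopSteps N (solveLevelSteps p N) + 1)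

namespace FiniteGame

/-- The value table passed to the next round has one entry per node of its level, so its length is
at most `N`. This invariant bounds all lookups. -/
theorem SizeBound.steps_constrainedSolver (hF : F.SizeBound N) {LP : LPSolver}
    {p : Polynomial ℕ} (hLP : LP.PolyTime p) (c : EqConcept) {M : ActionConstrainedMG n S m H}
    (hM : AscLevels (F.KeptLevel fun t x a =>
      (a, F.reward t x.1 a, (F.successors t x a).val)) 0 M) :
    (constrainedSolver LP c M).steps ≤ solverSteps p N := by
  have hlen := hM.length_le.trans hF.horizon
  rw [constrainedSolver_eq]
  simp only [Timed.steps_bind]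
  refine Nat.add_le_add (Timed.steps_fold_le _ (fun _ => True) hlen trivial fun _ _ _ _ =>
    ⟨trivial, le_rfl⟩) (Nat.add_le_add ?_ le_rfl)
  simp only [Timed.val_fold, Timed.val_ops, List.foldl_flip_cons_eq_append, List.append_nil,
    List.map_id']
  refine Timed.steps_fold_le _ (fun st => st.2.length ≤ N) (by simpa using hlen) (by simp)
    fun st lev hlev hst => ?_
  have hk := hM.forall_mem lev (by simpa using hlev)
  obtain ⟨h1, h2⟩ := hF.length_kept hk
  have h3 : ∀ e ∈ lev.2, ∀ a ∈ e.2, a.2.2.length ≤ N * N := by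
    obtain ⟨nodes, -, -, hk⟩ := hk
    rw [hk]
    intro e he a ha
    obtain ⟨x, -, rfl⟩ := List.mem_map.mp he
    obtain ⟨a, -, rfl⟩ := List.mem_map.mp ha
    exact hF.length_successors _ _ _
  refine ⟨by simpa [solveLevel] using h1, ?_⟩
  simp only [solveLevel, Timed.steps_bind]
  refine Nat.add_le_add (Timed.steps_mapList_le _ h1 fun e he => Nat.add_le_add
    (steps_stageUtilities_le hF.players hst (h2 e he) (h3 e he))
    (steps_solveStage_le hLP hF.players hF.ownActions c _ ?_)) (Nat.add_le_add
      (Timed.steps_mapList_le _ (by simpa using h1) fun _ _ => le_rfl) (Nat.add_le_add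
        (Timed.steps_mapList_le _ (by simpa using h1) fun _ _ => le_rfl) le_rfl))
  simpa [stageUtilities] using h2 e he

/-- The number of steps of the reduction. -/
def reductionSteps (p : Polynomial ℕ) (N : ℕ) : ℕ :=
  feasibilitySteps N + (reducedGameSteps N + (solverSteps p N + 1))

theorem SizeBound.steps_reduction (hF : F.SizeBound N) {LP : LPSolver} {p : Polynomial ℕ}
    (hLP : LP.PolyTime p) (c : EqConcept) : (F.reduction LP c).steps ≤ reductionSteps p N := by
  unfold reduction
  rw [Timed.steps_bind]
  refine Nat.add_le_add hF.steps_feasibility ?_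
  cases hf : F.feasibility.val with
  | none =>
    simp
    omega
  | some R =>
    obtain ⟨-, hR⟩ := F.feasibility_some hf
    simp only [Timed.steps_bind]
    exact Nat.add_le_add (hF.steps_reducedGame hR) (Nat.add_le_add
      (hF.steps_constrainedSolver hLP c (F.reducedGame_spec hR)) le_rfl)

end FiniteGame

end Algorithms

/-! ### Step count of the approximation algorithm -/

namespace MarkovGame

variable {n N : ℕ} {G : MarkovGame n} {ℓ : Fin n → ℝ}

/-- The number of steps of constructing the approximate game. -/
def approxGameSteps (N : ℕ) : ℕ :=
  loopSteps N 7 + (loopSteps N 4 + (loopSteps N (loopSteps N (loopSteps N (loopSteps N 1))) +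
    (loopSteps N (loopSteps N (loopSteps N (loopSteps N 1))) +
      (loopSteps N (loopSteps N (loopSteps N (loopSteps N
        (loopSteps N 10 + ((N + 1) + (2 * N + 2)))))) + (loopSteps N 1 + 1)))))

theorem steps_approxGame_le (hn : n ≤ N) (hS : G.numStates ≤ N) (hH : G.horizon ≤ N)
    (hA : Fintype.card G.Action ≤ N) (hbox : (G.costBox ℓ).card ≤ N) :
    (G.approxGame ℓ).steps ≤ approxGameSteps N := by
  have hn' : Fintype.card (Fin n) ≤ N := by simpa using hn
  have hS' : Fintype.card G.State ≤ N := by simpa using hS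
  have hH' : Fintype.card (Fin G.horizon) ≤ N := by simpa using hH
  simp only [approxGame, Timed.steps_bind]
  refine Nat.add_le_add (Timed.steps_tabulate_le _ hn' fun i => le_rfl) (Nat.add_le_add
    (Timed.steps_tabulate_le _ hn' fun i => le_rfl) (Nat.add_le_add
    (Timed.steps_tabulate_le _ hH' fun t => Timed.steps_tabulate_le _ hS' fun s =>
      Timed.steps_tabulate_le _ hA fun a => Timed.steps_tabulate_le _ hS' fun s' => le_rfl)
    (Nat.add_le_add
    (Timed.steps_tabulate_le _ hH' fun t => Timed.steps_tabulate_le _ hS' fun s =>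
      Timed.steps_tabulate_le _ hA fun a => Timed.steps_tabulate_le _ hn' fun i => le_rfl)
    (Nat.add_le_add
    (Timed.steps_tabulate_le _ hH' fun t => Timed.steps_tabulate_le _ hS' fun s =>
      Timed.steps_tabulate_le _ hA fun a => Timed.steps_fold_le _ (fun _ => True) ?_ trivial
        fun acc k _ _ => ⟨trivial, ?_⟩)
    (Nat.add_le_add (Timed.steps_tabulate_le _ hn' fun i => le_rfl) le_rfl)))))
  · rw [Finset.length_toList]
    exact hbox
  · refine Nat.add_le_add (Timed.steps_tabulate_le _ hn' fun i => le_rfl)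
      (Nat.add_le_add (by simpa using hn) ?_)
    beta_reduce
    split_ifs
    · simpa using hn
    · simp

/-- The number of steps of the approximation algorithm. -/
def approximationSteps (p : Polynomial ℕ) (N : ℕ) : ℕ :=
  approxGameSteps N + FiniteGame.reductionSteps p N

theorem steps_approximation_le (hF : (G.approx ℓ).SizeBound N) (hbox : (G.costBox ℓ).card ≤ N)
    {LP : LPSolver} {p : Polynomial ℕ} (hLP : LP.PolyTime p) (c : EqConcept) :
    (G.approximation ℓ LP c).steps ≤ approximationSteps p N :=
  Nat.add_le_add (steps_approxGame_le hF.players hF.states hF.horizon hF.jointActions hbox)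
    (hF.steps_reduction hLP c)

end MarkovGame

/-! ## Polynomial bounds -/

/-- A function on the natural numbers that is given by a polynomial. -/
def IsPolyFun (f : ℕ → ℕ) : Prop := ∃ Q : Polynomial ℕ, ∀ N, f N = Q.eval N

namespace IsPolyFun

variable {f g : ℕ → ℕ}

theorem const (k : ℕ) : IsPolyFun fun _ => k := ⟨.C k, by simp⟩

theorem id : IsPolyFun fun N => N := ⟨.X, by simp⟩

theorem add (hf : IsPolyFun f) (hg : IsPolyFun g) : IsPolyFun fun N => f N + g N := by
  obtain ⟨P, hP⟩ := hf
  obtain ⟨Q, hQ⟩ := hg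
  exact ⟨P + Q, by simp [hP, hQ]⟩

theorem mul (hf : IsPolyFun f) (hg : IsPolyFun g) : IsPolyFun fun N => f N * g N := by
  obtain ⟨P, hP⟩ := hf
  obtain ⟨Q, hQ⟩ := hg
  exact ⟨P * Q, by simp [hP, hQ]⟩

theorem eval (p : Polynomial ℕ) (hf : IsPolyFun f) : IsPolyFun fun N => p.eval (f N) := by
  obtain ⟨P, hP⟩ := hf
  exact ⟨p.comp P, by simp [hP]⟩

theorem loopSteps (hf : IsPolyFun f) (hg : IsPolyFun g) :
    IsPolyFun fun N => _root_.loopSteps (f N) (g N) :=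
  (hf.mul (hg.add (const 1))).add (const 1)

end IsPolyFun

theorem isPolyFun_scanSteps : IsPolyFun scanSteps := by
  unfold scanSteps
  apply_rules [IsPolyFun.const, IsPolyFun.id, IsPolyFun.add, IsPolyFun.mul, IsPolyFun.loopSteps]

theorem isPolyFun_approximationSteps (p : Polynomial ℕ) :
    IsPolyFun (MarkovGame.approximationSteps p) := by
  unfold MarkovGame.approximationSteps MarkovGame.approxGameSteps FiniteGame.reductionSteps
    FiniteGame.feasibilitySteps FiniteGame.treeStepSteps FiniteGame.evalStepSteps
    FiniteGame.expandSteps FiniteGame.reducedGameSteps FiniteGame.succSteps solverSteps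
    solveLevelSteps stageUtilitiesSteps solveStageSteps lossSteps
  repeat' first
    | exact IsPolyFun.const _
    | exact IsPolyFun.id
    | exact isPolyFun_scanSteps
    | apply IsPolyFun.add
    | apply IsPolyFun.mul
    | apply IsPolyFun.loopSteps
    | apply IsPolyFun.eval

/-- A pure power without a constant factor survives the `n`-th power uniformly in `n`, as `(z ^ d) ^
n = (z ^ n) ^ d`. Coefficients are absorbed by `a ≤ 2 ^ a ≤ z ^ a`. -/
theorem eval_le_pow (p : Polynomial ℕ) : ∃ d, ∀ z, 2 ≤ z → p.eval z ≤ z ^ d := by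
  induction p using Polynomial.induction_on' with
  | add p q hp hq =>
    obtain ⟨d, hd⟩ := hp
    obtain ⟨e, he⟩ := hq
    refine ⟨d + e + 1, fun z hz => ?_⟩
    rw [Polynomial.eval_add]
    have h1 : z ^ d ≤ z ^ (d + e) := Nat.pow_le_pow_right (by omega) (by omega)
    have h2 : z ^ e ≤ z ^ (d + e) := Nat.pow_le_pow_right (by omega) (by omega)
    calc p.eval z + q.eval z ≤ z ^ (d + e) * 2 := by
          have := hd z hz
          have := he z hz
          omega
      _ ≤ z ^ (d + e + 1) := by rw [pow_succ]; gcongr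
  | monomial k a =>
    refine ⟨a + k, fun z hz => ?_⟩
    rw [Polynomial.eval_monomial, pow_add]
    gcongr
    exact (Nat.lt_two_pow_self).le.trans (Nat.pow_le_pow_left hz a)

theorem aeval_le_aeval (Q : Polynomial ℕ) {x y : ℝ} (hx : 0 ≤ x) (h : x ≤ y) :
    Polynomial.aeval x Q ≤ Polynomial.aeval y Q := by
  rw [Polynomial.aeval_eq_sum_range, Polynomial.aeval_eq_sum_range]
  exact Finset.sum_le_sum fun i _ => by gcongr

/-- Removes the mixed powers of `1 / ε`: the sum is at most twice the larger of `1` and `y`. The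
factor `2 ^ n` is later absorbed by the `n`-th power of the size. -/
theorem one_add_pow_le {y : ℝ} (hy : 0 ≤ y) (n : ℕ) : (1 + y) ^ n ≤ 2 ^ n * (1 + y ^ n) := by
  rcases le_total y 1 with h | h
  · calc (1 + y) ^ n ≤ 2 ^ n := by gcongr; linarith
      _ ≤ 2 ^ n * (1 + y ^ n) := le_mul_of_one_le_right (by positivity)
          (by linarith [pow_nonneg hy n])
  · calc (1 + y) ^ n ≤ (2 * y) ^ n := by gcongr; linarith
      _ = 2 ^ n * y ^ n := mul_pow _ _ _
      _ ≤ 2 ^ n * (1 + y ^ n) := by gcongr; linarith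

/-! ### Counting rounded costs and nodes -/

namespace MarkovGame

variable {n : ℕ} {G : MarkovGame n} {ℓ : Fin n → ℝ}

/-- The number of rounded costs of player `i`, up to one. -/
def spread (G : MarkovGame n) (ℓ : Fin n → ℝ) (i : Fin n) : ℕ :=
  (G.hiIdx ℓ i - G.loIdx ℓ i).toNat

/-- A bound for the numbers of nodes and supported rounded costs. -/
def gridSize (G : MarkovGame n) (ℓ : Fin n → ℝ) : ℕ :=
  ∏ i, (G.horizon * G.spread ℓ i + 1)

theorem card_costBox_le : (G.costBox ℓ).card ≤ G.gridSize ℓ := by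
  rw [costBox, Fintype.card_piFinset]
  refine Finset.prod_le_prod' fun i _ => ?_
  rw [Int.card_Icc]
  have := Nat.le_mul_of_pos_left (G.spread ℓ i) G.horizon_pos
  simp only [spread] at *
  omega

theorem le_size (G : MarkovGame n) : n ≤ G.size ∧ G.numStates ≤ G.size ∧ G.horizon ≤ G.size ∧
    ∑ i, G.numActions i ≤ G.size ∧ Fintype.card G.Action ≤ G.size ∧ 2 ≤ G.size := by
  have hS : 0 < G.numStates := G.start.pos
  have hH := G.horizon_pos
  have hA : ∏ i, G.numActions i ≤ G.horizon * G.numStates * (∏ i, G.numActions i) *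
      (G.numStates + 2 * n) := by
    calc ∏ i, G.numActions i = 1 * 1 * (∏ i, G.numActions i) * 1 := by ring
      _ ≤ _ := by gcongr <;> omega
  rw [Fintype.card_pi]
  simp only [Fintype.card_fin, size]
  refine ⟨?_, ?_, ?_, ?_, ?_, ?_⟩ <;> omega

/-- Indices add up along a path, and each step contributes between the lowest and the highest index.
-/
theorem reach_approx {t : ℕ} {x : Node n G.numStates} (hx : (G.approx ℓ).Reach t x) :
    t ≤ G.horizon ∧ ∃ k : Fin n → ℤ, (∀ i, t * G.loIdx ℓ i ≤ k i ∧ k i ≤ t * G.hiIdx ℓ i) ∧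
      x.2 = fun i => (k i : ℝ) * ℓ i := by
  induction hx with
  | start => exact ⟨Nat.zero_le _, 0, by simp, by funext i; simp⟩
  | @step t x y a h1 h2 h3 ih =>
    obtain ⟨-, k, hk, hx⟩ := ih
    obtain ⟨c, hc, -, hy⟩ := h3
    obtain ⟨k', hk', -, rfl⟩ := (mem_approx_costs _ _ _ _ _ _).mp hc
    refine ⟨t.isLt, k + k', fun i => ?_, ?_⟩
    · have := Finset.mem_Icc.mp (Fintype.mem_piFinset.mp hk' i)
      push_cast
      simp only [Pi.add_apply, add_mul, one_mul]
      exact ⟨add_le_add (hk i).1 this.1, add_le_add (hk i).2 this.2⟩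
    · rw [hy, hx]
      funext i
      simp [add_mul]

theorem length_le_of_reach {l : List (Node n G.numStates)} {t : ℕ} (hl : l.Nodup)
    (h : ∀ x ∈ l, (G.approx ℓ).Reach t x) : l.length ≤ G.numStates * G.gridSize ℓ := by
  classical
  -- An element of the list shows that `t` is at most the horizon, which the count below needs; the
  -- empty list is trivial.
  rcases l.eq_nil_or_concat with rfl | ⟨l', x, rfl⟩
  · simp
  have ht : t ≤ G.horizon := (reach_approx (h x (by simp))).1
  generalize l'.concat x = l at *
  set box : Finset (Fin n → ℤ) := Fintype.piFinset fun i =>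
    Finset.Icc (t * G.loIdx ℓ i) (t * G.hiIdx ℓ i)
  have hsub : l.toFinset ⊆ (Finset.univ : Finset G.State) ×ˢ
      box.image fun k i => (k i : ℝ) * ℓ i := by
    intro x hx
    obtain ⟨-, k, hk, hx'⟩ := reach_approx (h x (List.mem_toFinset.mp hx))
    refine Finset.mem_product.mpr ⟨Finset.mem_univ _, Finset.mem_image.mpr ⟨k, ?_, hx'.symm⟩⟩
    exact Fintype.mem_piFinset.mpr fun i => Finset.mem_Icc.mpr (hk i)
  rw [← List.toFinset_card_of_nodup hl]
  refine (Finset.card_le_card hsub).trans ?_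
  rw [Finset.card_product, Finset.card_univ, Fintype.card_fin]
  refine Nat.mul_le_mul_left _ (Finset.card_image_le.trans ?_)
  rw [Fintype.card_piFinset]
  refine Finset.prod_le_prod' fun i _ => ?_
  rw [Int.card_Icc]
  have h1 : (t : ℤ) * (G.hiIdx ℓ i - G.loIdx ℓ i) ≤ t * G.spread ℓ i :=
    mul_le_mul_of_nonneg_left (Int.self_le_toNat _) (by positivity)
  have h2 : (t : ℤ) * G.spread ℓ i ≤ G.horizon * G.spread ℓ i := by gcongr
  rw [Int.toNat_le]
  push_cast
  linarith

theorem sizeBound_approx (G : MarkovGame n) (ℓ : Fin n → ℝ) :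
    (G.approx ℓ).SizeBound (G.size * G.gridSize ℓ) := by
  obtain ⟨h1, h2, h3, h4, h5, h6⟩ := G.le_size
  have hgrid : 1 ≤ G.gridSize ℓ := Finset.prod_pos fun i _ => Nat.succ_pos _
  have hle : ∀ {k}, k ≤ G.size → k ≤ G.size * G.gridSize ℓ := fun hk =>
    hk.trans (Nat.le_mul_of_pos_right _ hgrid)
  refine ⟨hle h1, hle h2, hle h3, hle h4, hle h5, fun t s a => ?_, fun l t hl h => ?_⟩
  · rw [approx_costs, List.length_reverse, List.length_map]
    refine (List.length_filter_le _ _).trans ?_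
    rw [Finset.length_toList]
    exact card_costBox_le.trans (Nat.le_mul_of_pos_left _ (by omega))
  · exact (length_le_of_reach hl h).trans (Nat.mul_le_mul_right _ h2)

theorem steps_approximation_le_gridSize (G : MarkovGame n) (ℓ : Fin n → ℝ) {LP : LPSolver}
    {p : Polynomial ℕ} (hLP : LP.PolyTime p) (c : EqConcept) :
    (G.approximation ℓ LP c).steps ≤ approximationSteps p (G.size * G.gridSize ℓ) := by
  refine steps_approximation_le (G.sizeBound_approx ℓ) ?_ hLP c
  exact card_costBox_le.trans (Nat.le_mul_of_pos_left _ (by have := G.le_size; omega))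

/-- The numbers of rounded costs are polynomial in the size of the game and `1 / ε`. -/
theorem Standing.spread_le (hG : G.Standing) {ε : ℝ} (hε : 0 < ε) (i : Fin n) {κ : ℕ}
    (hκ : G.maxCost i ≤ κ * |G.budget i|) :
    (G.spread (G.relUnit ε) i : ℝ) ≤
      ((G.horizon + 1) * κ + 1) * G.horizon * (1 / ε) + 1 := by
  have hB : 0 < |G.budget i| := abs_pos.mpr (hG.budget_ne i)
  have hH : (0 : ℝ) < G.horizon := Nat.cast_pos.mpr G.horizon_pos
  have hℓ := hG.relUnit_pos hε
  have hnn : 0 ≤ G.hiIdx (G.relUnit ε) i - G.loIdx (G.relUnit ε) i := by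
    have := hG.loIdx_neg hℓ i
    have := hG.hiIdx_nonneg hℓ i
    omega
  have h1 : (G.hiIdx (G.relUnit ε) i : ℝ) ≤ G.maxCost i / G.relUnit ε i := Int.floor_le _
  -- Rounding the lower end down costs less than one unit; this is the final `+ 1` of the bound.
  have h2 : (G.budget i - G.horizon * G.maxCost i) / G.relUnit ε i - 1 <
      (G.loIdx (G.relUnit ε) i : ℝ) := Int.sub_one_lt_floor _
  have h3 : (G.spread (G.relUnit ε) i : ℝ) =
      G.hiIdx (G.relUnit ε) i - G.loIdx (G.relUnit ε) i := by
    rw [spread, ← Int.cast_natCast, Int.toNat_of_nonneg hnn]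
    push_cast
    ring
  have h4 : G.maxCost i / G.relUnit ε i - (G.budget i - G.horizon * G.maxCost i) / G.relUnit ε i ≤
      ((G.horizon + 1) * κ + 1) * G.horizon * (1 / ε) := by
    rw [← sub_div, div_le_iff₀ (hℓ i)]
    -- With `ℓ = ε |B| / H` the budget cancels, so only the ratio `κ` of costs to budget matters.
    have : ((G.horizon + 1) * κ + 1) * G.horizon * (1 / ε) * G.relUnit ε i =
        (G.horizon + 1) * (κ * |G.budget i|) + |G.budget i| := by
      unfold relUnit
      field_simp
    rw [this]
    have := neg_abs_le (G.budget i)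
    nlinarith
  linarith

/-- All players share one bound for their factor, in which a single polynomial dominates both the
coefficient of `1 / ε` and the constant term. The product over the players is then an `n`-th power.
-/
theorem Standing.gridSize_le (hG : G.Standing) {ε : ℝ} (hε : 0 < ε) {κ : ℕ}
    (hκ : ∀ i, G.maxCost i ≤ κ * |G.budget i|) :
    (G.gridSize (G.relUnit ε) : ℝ) ≤
      ((G.size ^ 2 * ((G.size + 1) * κ + 1) + G.size + 1 : ℕ) * (1 + 1 / ε)) ^ n := by
  have hH : (G.horizon : ℝ) ≤ G.size := Nat.cast_le.mpr G.le_size.2.2.1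
  have hy : 0 < 1 / ε := by positivity
  calc (G.gridSize (G.relUnit ε) : ℝ)
      = ∏ i, ((G.horizon : ℝ) * G.spread (G.relUnit ε) i + 1) := by simp [gridSize]
    _ ≤ ∏ _i : Fin n, ((G.size ^ 2 * ((G.size + 1) * κ + 1) + G.size + 1 : ℕ) * (1 + 1 / ε)) := by
        refine Finset.prod_le_prod (fun i _ => by positivity) fun i _ => ?_
        calc (G.horizon : ℝ) * G.spread (G.relUnit ε) i + 1
            ≤ G.size * (((G.size + 1) * κ + 1) * G.size * (1 / ε) + 1) + 1 := by
              have := hG.spread_le hε i (hκ i)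
              have h' : ((G.horizon + 1) * κ + 1) * G.horizon * (1 / ε) + 1 ≤
                ((G.size + 1) * κ + 1) * G.size * (1 / ε) + 1 := by gcongr
              gcongr
              exact this.trans h'
          _ ≤ _ := by
              push_cast
              have : 0 ≤ (G.size : ℝ) ^ 2 * ((G.size + 1) * κ + 1) := by positivity
              have : 0 ≤ (G.size : ℝ) * (1 / ε) := by positivity
              nlinarith
    _ = _ := by simp

theorem exists_polynomial_steps_approximation_le (p q : Polynomial ℕ) :
    ∃ P : MvPolynomial (Fin 2) ℕ, ∀ (n : ℕ), 1 ≤ n → ∀ G : MarkovGame n, G.Standing →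
      (∀ i, G.maxCost i ≤ (q.eval G.size : ℕ) * |G.budget i|) →
      ∀ ε : ℝ, 0 < ε → ∀ LP : LPSolver, LP.PolyTime p → ∀ c : EqConcept,
        ((G.approximation (G.relUnit ε) LP c).steps : ℝ) ≤
          MvPolynomial.aeval ![(G.size : ℝ) ^ n, 1 / ε ^ n] P := by
  obtain ⟨Q, hQ⟩ := isPolyFun_approximationSteps p
  -- This is the polynomial of `Standing.gridSize_le` with `κ = q(|G|)`.
  obtain ⟨d, hd⟩ := eval_le_pow (.X ^ 2 * ((.X + 1) * q + 1) + .X + 1)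
  -- Powers of `|G| ^ n`: `d` from the grid factors, one from the prefactor `|G| ≤ |G| ^ n`, and one
  -- from `2 ^ n ≤ |G| ^ n`.
  refine ⟨Polynomial.aeval (.X 0 ^ (d + 2) * (1 + .X 1)) Q, fun n hn G hG hq ε hε LP hLP c => ?_⟩
  have hz : 2 ≤ G.size := G.le_size.2.2.2.2.2
  have hz1 : (1 : ℝ) ≤ G.size := Nat.one_le_cast.mpr (by omega)
  have hz2 : (2 : ℝ) ≤ G.size := Nat.ofNat_le_cast.mpr hz
  have hgrid : ((G.size * G.gridSize (G.relUnit ε) : ℕ) : ℝ) ≤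
      ((G.size : ℝ) ^ n) ^ (d + 2) * (1 + 1 / ε ^ n) := by
    have hE : ((G.size ^ 2 * ((G.size + 1) * q.eval G.size + 1) + G.size + 1 : ℕ) : ℝ) ≤
        (G.size : ℝ) ^ d := by
      have := hd G.size hz
      simp only [Polynomial.eval_add, Polynomial.eval_mul, Polynomial.eval_pow, Polynomial.eval_X,
        Polynomial.eval_one] at this
      exact_mod_cast this
    have hy : 0 ≤ 1 / ε := by positivity
    push_cast
    calc (G.size : ℝ) * G.gridSize (G.relUnit ε)
        ≤ (G.size : ℝ) ^ n * ((G.size : ℝ) ^ d * (1 + 1 / ε)) ^ n := by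
          refine mul_le_mul (le_self_pow₀ hz1 (by omega))
            ((hG.gridSize_le hε hq).trans ?_) (by positivity) (by positivity)
          gcongr
      _ = (G.size : ℝ) ^ n * (((G.size : ℝ) ^ n) ^ d * (1 + 1 / ε) ^ n) := by
          rw [mul_pow, pow_right_comm]
      _ ≤ (G.size : ℝ) ^ n * (((G.size : ℝ) ^ n) ^ d * ((G.size : ℝ) ^ n * (1 + (1 / ε) ^ n))) := by
          gcongr
          refine (one_add_pow_le hy n).trans ?_
          gcongr
      _ = _ := by rw [one_div_pow]; ring
  calc ((G.approximation (G.relUnit ε) LP c).steps : ℝ)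
      ≤ (Q.eval (G.size * G.gridSize (G.relUnit ε)) : ℕ) := by
        rw [← hQ]
        exact Nat.cast_le.mpr (G.steps_approximation_le_gridSize _ hLP c)
    _ = Polynomial.aeval ((G.size * G.gridSize (G.relUnit ε) : ℕ) : ℝ) Q :=
        (Polynomial.eval₂_at_apply (algebraMap ℕ ℝ) _).symm
    _ ≤ Polynomial.aeval (((G.size : ℝ) ^ n) ^ (d + 2) * (1 + 1 / ε ^ n)) Q :=
        aeval_le_aeval Q (Nat.cast_nonneg _) hgrid
    _ = _ := by
        rw [← Polynomial.aeval_algHom_apply]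
        simp

end MarkovGame

end

theorem mainTheorem12 :
    (∀ (n : ℕ) (G : MarkovGame n), G.Standing → ∀ ε : ℝ, 0 < ε →
      ∀ LP : LPSolver, LP.Correct → ∀ c : EqConcept,
        ((G.approximation (G.relUnit ε) LP c).val = none →
          ¬ ∃ π : G.Policy, π.Feasible G.budget) ∧
        (∀ T, (G.approximation (G.relUnit ε) LP c).val = some T →
          (MarkovGame.tablePolicy (G.relUnit ε) T).Feasible (G.relBudget ε) ∧
          (MarkovGame.tablePolicy (G.relUnit ε) T).IsRelApproxACSPE c ε)) ∧
    (∀ p q : Polynomial ℕ, ∃ P : MvPolynomial (Fin 2) ℕ,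
      ∀ (n : ℕ), 1 ≤ n → ∀ G : MarkovGame n, G.Standing →
        (∀ i, G.maxCost i ≤ (q.eval G.size : ℕ) * |G.budget i|) →
        ∀ ε : ℝ, 0 < ε → ∀ LP : LPSolver, LP.PolyTime p → ∀ c : EqConcept,
          ((G.approximation (G.relUnit ε) LP c).steps : ℝ) ≤
            MvPolynomial.aeval ![(G.size : ℝ) ^ n, 1 / ε ^ n] P) := by
  exact ⟨fun n G hG ε hε LP hLP c => MarkovGame.approximation_correct hG hε LP hLP c,
    MarkovGame.exists_polynomial_steps_approximation_le⟩
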